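/- **The space.** Let $A=\mathbb Z^2*\mathbb Z=\langle g_1,g_2,g_3\mid [g_1,g_2]\rangle$ and let $X_A$ (the *tree of flats*) be the universal cover of the Salvetti complex of $A$, i.e. the Cayley complex of this presentation, with its length metric $d$: every coset of $\mathbb Z^2=\langle g_1,g_2\rangle$ spans an isometrically embedded Euclidean plane tiled by unit squares with the elements of the coset as lattice points, and for every $g\in A$ an edge of length $1$ (labelled $g_3$) joins the vertex $g$ to the vertex $gg_3$. Fix a vertex $\mathfrak o$ of $X_A$ as base-point and write $\|x\|=d(\mathfrak o,x)$. **The boundary.** Let $\kappa:[0,\infty)\to[1,\infty)$ be monotone increasing (not necessarily strictly), concave and sublinear ($\kappa(t)/t\to0$ as $t\to\infty$); write $\kappa(x)=\kappa(\|x\|)$. A geodesic ray is an isometric embedding $[0,\infty)\to X_A$ starting at $\mathfrak o$. For $q\ge1$, $Q\ge0$, a $(q,Q)$-quasi-geodesic ray (segment) is a continuous map $\beta$ from $[0,\infty)$ (from $[s,t]$) to $X_A$ with $\frac1q|u-v|-Q\le d(\beta(u),\beta(v))\le q|u-v|+Q$ for all $u,v$; rays start at $\mathfrak o$. Put $\mathcal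 N_\kappa(Z,n)=\{x: d(x,Z)\le n\,\kappa(x)\}$. Two quasi-geodesic rays $\kappa$-fellow travel if the image of each lies in $\mathcal N_\kappa(\text{image of the other},n)$ for some $n$. A set $Z$ is $\kappa$-contracting if there is a constant $c$ such that $d(x,y)\le d(x,Z)$ implies $\operatorname{diam}(x_Z\cup y_Z)\le c\,\kappa(x)$, where $x_Z$ is the set of points of $Z$ nearest to $x$. The $\kappa$-Morse boundary $\partial_\kappa X_A$ is the set of $\kappa$-fellow travelling classes (in the set of all quasi-geodesic rays) of $\kappa$-contracting quasi-geodesic rays. **The topology.** Call $D$ small compared to $r>0$ if $D\le r/(2\kappa(r))$. For a quasi-geodesic ray $\alpha$ let $t_r$ be the first time with $\|\alpha(t_r)\|=r$ and $\alpha|_r=\alpha[0,t_r]$. A function $m$ of $(q,Q)$ is a strong Morse gauge for $Z$ if (i) $m(q,Q)\ge\max(q,Q)$; (ii) every $(q,Q)$-quasi-geodesic segment with end points on $Z$ lies in $\mathcal N_\kappa(Z,m(q,Q))$; (iii) for all $r,n>0$ and every function $\kappa'$ of the same kind as $\kappa$ there is $R>0$ such that for every $(q,Q)$-quasi-geodesic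 ray $\eta$ with $m(q,Q)$ small compared to $r$, $d(\eta(t_R),Z)\le n\,\kappa'(R)$ implies $\eta|_r\subset\mathcal N_\kappa(Z,m(q,Q))$. For each $\mathbf b\in\partial_\kappa X_A$ choose a geodesic ray $b\in\mathbf b$ and a strong Morse gauge $m_b$ for the image of $b$. Let $\mathcal U_\kappa(\mathbf b,r)$ be the set of all $\mathbf a\in\partial_\kappa X_A$ such that $\alpha|_r\subset\mathcal N_\kappa(b,m_b(q,Q))$ for every $(q,Q)$-quasi-geodesic ray $\alpha\in\mathbf a$ with $m_b(q,Q)$ small compared to $r$. A set $W\subset\partial_\kappa X_A$ is open if for every $\mathbf b\in W$ there is $r>0$ with $\mathcal U_\kappa(\mathbf b,r)\subset W$. **Proposition.** For every such $\kappa$ and every vertex $\mathfrak o$, geodesic rays $b$ and gauges $m_b$ as above can be chosen for all $\mathbf b\in\partial_\kappa X_A$, and, for every such choice, the topological space $\partial_\kappa X_A$ is non-compact, totally disconnected and has no isolated points. -/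

import Mathlib

open scoped NNReal Topology

/-! ## Sublinear functions, quasi-geodesics and contracting sets

Throughout, `X` is a metric space with a base-point `o`, and `‖x‖ = dist o x`. -/

/-- `κ : [0, ∞) → [1, ∞)` is monotone increasing, concave and sublinear.
(Only the values of `κ` on `[0, ∞)` are ever used.) -/
structure IsSublinearFunction (κ : ℝ → ℝ) : Prop where
  one_le : ∀ t, 0 ≤ t → 1 ≤ κ t
  mono : MonotoneOn κ (Set.Ici 0)
  concave : ConcaveOn ℝ (Set.Ici 0) κ
  sublinear : Filter.Tendsto (fun t => κ t / t) Filter.atTop (𝓝 0)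

/-- The quantity `D` is small compared to the radius `r`. -/
def IsSmallComparedTo (κ : ℝ → ℝ) (D r : ℝ) : Prop :=
  D ≤ r / (2 * κ r)

section Rays

variable {X : Type*} [MetricSpace X]

/-- A geodesic ray: an isometric embedding `[0, ∞) → X` starting from `o`. -/
def IsGeodesicRay (o : X) (b : ℝ≥0 → X) : Prop :=
  Isometry b ∧ b 0 = o

/-- A `(q, Q)`-quasi-geodesic ray: a continuous `(q, Q)`-quasi-isometric embedding
`[0, ∞) → X` starting from `o`. -/
structure IsQuasiGeodesicRay (o : X) (q Q : ℝ) (β : ℝ≥0 → X) : Prop where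
  one_le : 1 ≤ q
  nonneg : 0 ≤ Q
  continuous : Continuous β
  start : β 0 = o
  lower : ∀ s t, (1 / q) * dist s t - Q ≤ dist (β s) (β t)
  upper : ∀ s t, dist (β s) (β t) ≤ q * dist s t + Q

/-- A `(q, Q)`-quasi-geodesic segment `β : [s, t] → X`; it may start anywhere. -/
structure IsQuasiGeodesicSegment (q Q : ℝ) (s t : ℝ) (β : ℝ → X) : Prop where
  one_le : 1 ≤ q
  nonneg : 0 ≤ Q
  le : s ≤ t
  continuousOn : ContinuousOn β (Set.Icc s t)
  lower : ∀ u ∈ Set.Icc s t, ∀ v ∈ Set.Icc s t, (1 / q) * dist u v - Q ≤ dist (β u) (β v)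
  upper : ∀ u ∈ Set.Icc s t, ∀ v ∈ Set.Icc s t, dist (β u) (β v) ≤ q * dist u v + Q

/-- The `(κ, n)`-neighbourhood of `Z`. -/
def kappaNeighborhood (κ : ℝ → ℝ) (o : X) (Z : Set X) (n : ℝ) : Set X :=
  {x | Metric.infDist x Z ≤ n * κ (dist o x)}

/-- Two rays `κ`-fellow travel if each lies in some `κ`-neighbourhood of the other. -/
def KappaFellowTravel (κ : ℝ → ℝ) (o : X) (β γ : ℝ≥0 → X) : Prop :=
  (∃ n, Set.range β ⊆ kappaNeighborhood κ o (Set.range γ) n) ∧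
    ∃ n, Set.range γ ⊆ kappaNeighborhood κ o (Set.range β) n

/-- The set `x_Z` of the points of `Z` nearest to `x`. -/
def nearestPoints (Z : Set X) (x : X) : Set X :=
  {z ∈ Z | dist x z = Metric.infDist x Z}

/-- `Z` is `κ`-contracting. -/
def IsKappaContracting (κ : ℝ → ℝ) (o : X) (Z : Set X) : Prop :=
  ∃ c : ℝ, ∀ x y : X, dist x y ≤ Metric.infDist x Z →
    Metric.diam (nearestPoints Z x ∪ nearestPoints Z y) ≤ c * κ (dist o x)

/-- The first time `t_r` at which the ray `α` has norm `r`. -/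
noncomputable def firstTime (o : X) (α : ℝ≥0 → X) (r : ℝ) : ℝ≥0 :=
  sInf {t | dist o (α t) = r}

/-- The initial part `α|_r = α[0, t_r]`, as a subset of `X`. -/
def initialPart (o : X) (α : ℝ≥0 → X) (r : ℝ) : Set X :=
  α '' Set.Icc 0 (firstTime o α r)

/-- `m` is a (strong) Morse gauge for `Z`: it dominates both of its arguments, it controls
quasi-geodesic segments with end points on `Z`, and it controls the initial part of every
quasi-geodesic ray that is sublinearly close to `Z` at a suitable large radius. -/
structure IsStrongMorseGauge (κ : ℝ → ℝ) (o : X) (Z : Set X) (m : ℝ → ℝ → ℝ) : Prop where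
  max_le : ∀ q Q, 1 ≤ q → 0 ≤ Q → max q Q ≤ m q Q
  morse : ∀ (q Q s t : ℝ) (β : ℝ → X), IsQuasiGeodesicSegment q Q s t β →
    β s ∈ Z → β t ∈ Z → β '' Set.Icc s t ⊆ kappaNeighborhood κ o Z (m q Q)
  strong : ∀ (r n : ℝ) (κ' : ℝ → ℝ), 0 < r → 0 < n → IsSublinearFunction κ' →
    ∃ R : ℝ, 0 < R ∧ ∀ (q Q : ℝ) (η : ℝ≥0 → X), IsQuasiGeodesicRay o q Q η →
      IsSmallComparedTo κ (m q Q) r →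
      Metric.infDist (η (firstTime o η R)) Z ≤ n * κ' R →
      initialPart o η r ⊆ kappaNeighborhood κ o Z (m q Q)

/-! ## The `κ`-Morse boundary -/

/-- The `κ`-fellow travelling class of `β`, inside the set of all quasi-geodesic rays. -/
def fellowTravelClass (κ : ℝ → ℝ) (o : X) (β : ℝ≥0 → X) : Set (ℝ≥0 → X) :=
  {γ | (∃ q Q, IsQuasiGeodesicRay o q Q γ) ∧ KappaFellowTravel κ o β γ}

/-- The `κ`-Morse boundary: the set of `κ`-fellow travelling classes of `κ`-contracting
quasi-geodesic rays. A point of it is a set of quasi-geodesic rays. -/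
def kappaBoundary (κ : ℝ → ℝ) (o : X) : Set (Set (ℝ≥0 → X)) :=
  {c | ∃ β : ℝ≥0 → X, (∃ q Q, IsQuasiGeodesicRay o q Q β) ∧
    IsKappaContracting κ o (Set.range β) ∧ c = fellowTravelClass κ o β}

/-- The data used to topologize the boundary: in each class `c` the geodesic ray
`geod c ∈ c`, and a strong Morse gauge of this geodesic ray. -/
structure GaugeChoice (κ : ℝ → ℝ) (o : X) where
  geod : kappaBoundary κ o → ℝ≥0 → X
  gauge : kappaBoundary κ o → ℝ → ℝ → ℝ
  geod_mem : ∀ c : kappaBoundary κ o, geod c ∈ (c : Set (ℝ≥0 → X))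
  isGeodesicRay : ∀ c, IsGeodesicRay o (geod c)
  isGauge : ∀ c, IsStrongMorseGauge κ o (Set.range (geod c)) (gauge c)

/-- The set `𝒰_κ(c, r)`. -/
def GaugeChoice.nbhd {κ : ℝ → ℝ} {o : X} (C : GaugeChoice κ o) (c : kappaBoundary κ o)
    (r : ℝ) : Set (kappaBoundary κ o) :=
  {a | ∀ (q Q : ℝ), ∀ α ∈ (a : Set (ℝ≥0 → X)), IsQuasiGeodesicRay o q Q α →
    IsSmallComparedTo κ (C.gauge c q Q) r →
    initialPart o α r ⊆ kappaNeighborhood κ o (Set.range (C.geod c)) (C.gauge c q Q)}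

theorem IsSublinearFunction.div_mono {κ : ℝ → ℝ} (hκ : IsSublinearFunction κ) {r r' : ℝ}
    (hr : 0 < r) (h : r ≤ r') : r / (2 * κ r) ≤ r' / (2 * κ r') := by
  have hr' : 0 < r' := hr.trans_le h
  have h1 := hκ.one_le r hr.le
  have h2 := hκ.one_le r' hr'.le
  have h0 := hκ.one_le 0 le_rfl
  have hc := hκ.concave.2 (show (0 : ℝ) ∈ Set.Ici 0 by simp) (Set.mem_Ici.2 hr'.le)
    (show 0 ≤ 1 - r / r' by rw [sub_nonneg, div_le_one hr']; exact h)
    (show 0 ≤ r / r' by positivity) (by ring)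
  have h3 : r / r' ≤ 1 := by rw [div_le_one hr']; exact h
  simp only [smul_eq_mul, mul_zero, zero_add] at hc
  rw [div_mul_cancel₀ _ hr'.ne'] at hc
  have h4 : r / r' * κ r' ≤ κ r := by nlinarith
  have h5 : r * κ r' ≤ κ r * r' := by
    have := mul_le_mul_of_nonneg_right h4 hr'.le
    calc r * κ r' = r / r' * κ r' * r' := by field_simp
      _ ≤ _ := this
  rw [div_le_div_iff₀ (by linarith) (by linarith)]
  linarith

theorem IsQuasiGeodesicRay.exists_dist_eq {o : X} {q Q : ℝ} {α : ℝ≥0 → X}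
    (hα : IsQuasiGeodesicRay o q Q α) {r : ℝ} (hr : 0 ≤ r) : ∃ t, dist o (α t) = r := by
  have hq : 0 < q := by linarith [hα.one_le]
  have hQ := hα.nonneg
  have hT : 0 ≤ q * (r + Q) := by positivity
  have hl := hα.lower 0 (Real.toNNReal (q * (r + Q)))
  rw [hα.start] at hl
  have hd : dist (0 : ℝ≥0) (Real.toNNReal (q * (r + Q))) = q * (r + Q) := by
    rw [NNReal.dist_eq, Real.coe_toNNReal _ hT, NNReal.coe_zero, zero_sub, abs_neg,
      abs_of_nonneg hT]
  rw [hd] at hl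
  have hl' : r ≤ dist o (α (Real.toNNReal (q * (r + Q)))) := by
    have : 1 / q * (q * (r + Q)) = r + Q := by field_simp
    linarith
  have hcont : Continuous fun t => dist o (α t) := continuous_const.dist hα.continuous
  have h0 : dist o (α 0) ≤ r := by rw [hα.start, dist_self]; exact hr
  exact mem_range_of_exists_le_of_exists_ge hcont ⟨0, h0⟩ ⟨_, hl'⟩

theorem IsQuasiGeodesicRay.initialPart_mono {o : X} {q Q : ℝ} {α : ℝ≥0 → X}
    (hα : IsQuasiGeodesicRay o q Q α) {r r' : ℝ} (hr : 0 < r) (h : r ≤ r') :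
    initialPart o α r ⊆ initialPart o α r' := by
  refine Set.image_mono (Set.Icc_subset_Icc_right ?_)
  refine le_csInf (hα.exists_dist_eq (hr.le.trans h)) ?_
  intro t ht
  have hcont : ContinuousOn (fun t => dist o (α t)) (Set.Icc 0 t) :=
    (continuous_const.dist hα.continuous).continuousOn
  have hmem : r ∈ Set.Icc (dist o (α 0)) (dist o (α t)) := by
    rw [hα.start, dist_self]
    exact ⟨hr.le, h.trans_eq (show dist o (α t) = r' from ht).symm⟩
  obtain ⟨s, hs, hsr⟩ := intermediate_value_Icc (zero_le (a := t)) hcont hmem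
  exact (csInf_le (OrderBot.bddBelow {t : ℝ≥0 | dist o (α t) = r}) hsr).trans hs.2

theorem GaugeChoice.nbhd_anti {κ : ℝ → ℝ} (hκ : IsSublinearFunction κ) {o : X}
    (C : GaugeChoice κ o) (c : kappaBoundary κ o) {r r' : ℝ} (hr : 0 < r) (h : r ≤ r') :
    C.nbhd c r' ⊆ C.nbhd c r := by
  intro a ha q Q α hαa hα hs
  exact (hα.initialPart_mono hr h).trans
    (ha q Q α hαa hα (le_trans hs (hκ.div_mono hr h)))

/-- The topology of the `κ`-Morse boundary: `W` is open if and only if every `c ∈ W` has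
some `r > 0` with `𝒰_κ(c, r) ⊆ W`. -/
@[reducible] def GaugeChoice.topology {κ : ℝ → ℝ} (hκ : IsSublinearFunction κ) {o : X}
    (C : GaugeChoice κ o) : TopologicalSpace (kappaBoundary κ o) where
  IsOpen W := ∀ c ∈ W, ∃ r : ℝ, 0 < r ∧ C.nbhd c r ⊆ W
  isOpen_univ := fun _ _ => ⟨1, one_pos, Set.subset_univ _⟩
  isOpen_inter := by
    rintro V W hV hW c ⟨hcV, hcW⟩
    obtain ⟨r, hr, hrV⟩ := hV c hcV
    obtain ⟨s, hs, hsW⟩ := hW c hcW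
    exact ⟨max r s, lt_max_of_lt_left hr, Set.subset_inter
      ((C.nbhd_anti hκ c hr (le_max_left r s)).trans hrV)
      ((C.nbhd_anti hκ c hs (le_max_right r s)).trans hsW)⟩
  isOpen_sUnion := by
    rintro S hS c ⟨W, hWS, hcW⟩
    obtain ⟨r, hr, hrW⟩ := hS W hWS c hcW
    exact ⟨r, hr, hrW.trans (Set.subset_sUnion_of_mem hWS)⟩

end Rays

/-! ## The tree of flats

The universal cover of the Salvetti complex of `A = ℤ² ∗ ℤ`, i.e. the Cayley complex of
`⟨g₁, g₂, g₃ | [g₁, g₂]⟩`, with its length metric. It is glued from Euclidean planes (the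
planes through the cosets of `⟨g₁, g₂⟩ = ℤ²`, each tiled by unit squares with vertices at the
lattice points) and from unit intervals (the edges labelled `g₃`). -/

namespace TreeOfFlats

/-- The group `A = ℤ² ∗ ℤ`. -/
abbrev A : Type := Monoid.Coprod (Multiplicative (ℤ × ℤ)) (Multiplicative ℤ)

/-- The element `g₁ ^ z.1 * g₂ ^ z.2` of `A`. -/
def ofLattice (z : ℤ × ℤ) : A := Monoid.Coprod.inl (Multiplicative.ofAdd z)

/-- The generator `g₃` of `A`. -/
def g₃ : A := Monoid.Coprod.inr (Multiplicative.ofAdd 1)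

/-- The point of the Euclidean plane with integer coordinates `z`. -/
noncomputable def latticePoint (z : ℤ × ℤ) : EuclideanSpace ℝ (Fin 2) :=
  !₂[(z.1 : ℝ), (z.2 : ℝ)]

/-- Points before gluing: `flat g p` is the point with coordinates `p` in the plane that
contains the vertex `g`, with origin placed at `g`; `edge g t` is the point at distance `t`
from `g` on the edge labelled `g₃` from `g` to `g * g₃`. -/
inductive Pre : Type
  | flat (g : A) (p : EuclideanSpace ℝ (Fin 2)) : Pre
  | edge (g : A) (t : Set.Icc (0 : ℝ) 1) : Pre

/-- `Chain x y ℓ`: there is a finite chain of length `ℓ` from `x` to `y`, made of straight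
segments in planes and edges and of jumps of length `0` between points that are glued. -/
inductive Chain : Pre → Pre → ℝ → Prop
  | refl (x : Pre) : Chain x x 0
  | inFlat (g : A) (p q : EuclideanSpace ℝ (Fin 2)) :
      Chain (.flat g p) (.flat g q) (dist p q)
  | inEdge (g : A) (s t : Set.Icc (0 : ℝ) 1) : Chain (.edge g s) (.edge g t) (dist s t)
  | glueFlat (g : A) (z : ℤ × ℤ) (p : EuclideanSpace ℝ (Fin 2)) :
      Chain (.flat (g * ofLattice z) p) (.flat g (latticePoint z + p)) 0
  | glueStart (g : A) : Chain (.edge g 0) (.flat g 0) 0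
  | glueEnd (g : A) : Chain (.edge g 1) (.flat (g * g₃) 0) 0
  | symm {x y : Pre} {a : ℝ} : Chain x y a → Chain y x a
  | trans {x y z : Pre} {a b : ℝ} : Chain x y a → Chain y z b → Chain x z (a + b)

theorem Chain.nonneg {x y : Pre} {a : ℝ} (h : Chain x y a) : 0 ≤ a := by
  induction h with
  | refl | glueFlat | glueStart | glueEnd => exact le_rfl
  | inFlat | inEdge => exact dist_nonneg
  | symm _ ih => exact ih
  | trans _ _ ih₁ ih₂ => exact add_nonneg ih₁ ih₂

theorem exists_chain_mul_g₃ (h : A) : ∃ a, Chain (.flat h 0) (.flat (h * g₃) 0) a :=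
  ⟨_, ((Chain.glueStart h).symm.trans (Chain.inEdge h 0 1)).trans (Chain.glueEnd h)⟩

theorem exists_chain_mul (g : A) : ∀ h : A, ∃ a, Chain (.flat h 0) (.flat (h * g) 0) a := by
  induction g using Monoid.Coprod.induction_on with
  | inl z =>
    intro h
    exact ⟨_, (Chain.inFlat h 0 _).trans (Chain.glueFlat h z.toAdd 0).symm⟩
  | inr n =>
    have key : ∀ k : ℤ, ∀ h : A, ∃ a, Chain (.flat h 0) (.flat (h * g₃ ^ k) 0) a := by
      intro k
      induction k using Int.induction_on with
      | zero => intro h; rw [zpow_zero, mul_one]; exact ⟨0, .refl _⟩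
      | succ i ih =>
        intro h
        obtain ⟨a, ha⟩ := ih h
        obtain ⟨b, hb⟩ := exists_chain_mul_g₃ (h * g₃ ^ (i : ℤ))
        rw [zpow_add_one, ← mul_assoc]
        exact ⟨_, ha.trans hb⟩
      | pred i ih =>
        intro h
        obtain ⟨a, ha⟩ := ih h
        obtain ⟨b, hb⟩ := exists_chain_mul_g₃ (h * g₃ ^ (-(i : ℤ) - 1))
        rw [mul_assoc, ← zpow_add_one, sub_add_cancel] at hb
        exact ⟨_, ha.trans hb.symm⟩
    intro h
    obtain ⟨a, ha⟩ := key n.toAdd h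
    have hn : g₃ ^ n.toAdd = Monoid.Coprod.inr n := by
      rw [g₃, ← map_zpow, ← ofAdd_zsmul, smul_eq_mul, mul_one, ofAdd_toAdd]
    rw [hn] at ha
    exact ⟨a, ha⟩
  | mul x y hx hy =>
    intro h
    obtain ⟨a, ha⟩ := hx h
    obtain ⟨b, hb⟩ := hy (h * x)
    rw [mul_assoc] at hb
    exact ⟨_, ha.trans hb⟩

theorem exists_chain_vertex (x : Pre) : ∃ g a, Chain x (.flat g 0) a := by
  cases x with
  | flat g p => exact ⟨g, _, .inFlat g p 0⟩
  | edge g t => exact ⟨g, _, (Chain.inEdge g t 0).trans (.glueStart g)⟩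

theorem exists_chain (x y : Pre) : ∃ a, Chain x y a := by
  obtain ⟨g, a, ha⟩ := exists_chain_vertex x
  obtain ⟨h, b, hb⟩ := exists_chain_vertex y
  obtain ⟨c, hc⟩ := exists_chain_mul (g⁻¹ * h) g
  rw [mul_inv_cancel_left] at hc
  exact ⟨_, (ha.trans hc).trans hb.symm⟩

/-- The length (pseudo)metric: the infimum of the lengths of all chains. -/
noncomputable def preDist (x y : Pre) : ℝ := sInf {a | Chain x y a}

theorem preDist_le {x y : Pre} {a : ℝ} (h : Chain x y a) : preDist x y ≤ a :=
  csInf_le ⟨0, fun _ hb => Chain.nonneg hb⟩ h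

noncomputable instance : PseudoMetricSpace Pre where
  dist := preDist
  dist_self x := le_antisymm (preDist_le (.refl x))
    (Real.sInf_nonneg fun _ hb => Chain.nonneg hb)
  dist_comm x y := congrArg sInf (Set.ext fun _ => ⟨.symm, .symm⟩)
  dist_triangle x y z := by
    refine le_of_forall_pos_le_add fun ε hε => ?_
    obtain ⟨a, ha, ha'⟩ := exists_lt_of_csInf_lt (s := {a | Chain x y a}) (exists_chain x y)
      (lt_add_of_pos_right _ (half_pos hε))
    obtain ⟨b, hb, hb'⟩ := exists_lt_of_csInf_lt (s := {a | Chain y z a}) (exists_chain y z)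
      (lt_add_of_pos_right _ (half_pos hε))
    have h := preDist_le (Chain.trans ha hb)
    change preDist x z ≤ preDist x y + preDist y z + ε
    change a < preDist x y + ε / 2 at ha'
    change b < preDist y z + ε / 2 at hb'
    linarith

/-- The tree of flats: the metric space obtained by identifying points at distance `0`. -/
abbrev Space : Type := SeparationQuotient Pre

/-- The vertex of the tree of flats that corresponds to `g ∈ A`: the point `g` of the plane
through `g`, where the two edges labelled `g₃` at `g` are attached. -/
noncomputable def vertex (g : A) : Space := SeparationQuotient.mk (.flat g 0)

end TreeOfFlats

/-! The tree of flats is cut by its vertices: at every vertex of a flat two edges lead into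
branches, and any way between a branch and the rest of the space runs through that vertex. Such a
cut point is a gate (`IsGate`), and the whole argument is expressed in nested sequences of gates
(`IsGateSeq`).

In any metric space, let gates tend to infinity with gaps bounded by a multiple of `κ`.
Quasi-geodesic rays towards this end pass every gate and have only sublinear room in between, so
they fellow travel. A class is then exactly the set of rays with a given end
(`IsGateSeq.mem_fellowTravelClass_iff`). For the same reason a geodesic ray through the gates has a
strong Morse gauge (`IsGateSeq.exists_isStrongMorseGauge`), and it is contracting when the gaps are
bounded (`IsGateSeq.isKappaContracting`). The boundary points beyond a gate form a clopen cylinder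
(`GaugeChoice.isOpen_cylinder`, `GaugeChoice.compl_cylinder`).

The geometric input is that a `κ`-contracting ray leaves every flat for good through one branch
(`exists_eventually_mem_branch`), and that its trace on a flat which it enters at a vertex `v` and
leaves at `v * z` has diameter of order `κ` (`exists_norm_le`). Both rest on one planar fact
(`le_of_displacement_le`): one can walk around a point of a set to another point of the set while
keeping away from the first, and if nearest points move little along the walk, the second point
cannot project to itself. Contracting rays therefore follow infinite reduced words in `ℤ² ∗ ℤ` with
sublinear syllables, and words with bounded syllables do give boundary points.

The three claims follow. Distinct points are separated by a cylinder. The cylinders of the first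
exits from the flat of the base-point are disjoint, open, infinite in number and cover the boundary,
and infinitely many are non-empty. A word can be changed beyond an arbitrarily distant gate, so no
point is isolated. -/

open Filter Set

/-! ## Sublinear functions -/

theorem IsSublinearFunction.eventually_mul_add_lt {κ : ℝ → ℝ} (hκ : IsSublinearFunction κ)
    (n C : ℝ) : ∀ᶠ r in atTop, n * κ r + C < r := by
  have h1 : Tendsto (fun r => n * (κ r / r) + C / r) atTop (𝓝 (n * 0 + 0)) :=
    (hκ.sublinear.const_mul n).add (tendsto_const_nhds.div_atTop tendsto_id)
  have h2 : ∀ᶠ r in atTop, n * (κ r / r) + C / r < 1 :=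
    h1.eventually_lt_const (by norm_num)
  filter_upwards [h2, eventually_gt_atTop 0] with r hr h0
  have h3 : n * κ r + C = (n * (κ r / r) + C / r) * r := by field_simp
  rw [h3]
  nlinarith

theorem IsSublinearFunction.eventually_isSmallComparedTo {κ : ℝ → ℝ}
    (hκ : IsSublinearFunction κ) (D : ℝ) : ∀ᶠ r in atTop, IsSmallComparedTo κ D r := by
  filter_upwards [hκ.eventually_mul_add_lt (2 * D) 0, eventually_ge_atTop 0] with r hr h0
  have h1 := hκ.one_le r h0
  rw [IsSmallComparedTo, le_div_iff₀ (by linarith)]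
  linarith

/-! ### Gates in a metric space -/

section Gates

variable {X : Type*} [MetricSpace X]

/-- The point `m` is a gate between the set `B` and its complement: a shortest way
from the one to the other passes through `m`. -/
def IsGate (m : X) (B : Set X) : Prop :=
  ∀ x, x ∉ B → ∀ y, y ∈ B → dist x m + dist m y ≤ dist x y

theorem IsGate.compl {m : X} {B : Set X} (h : IsGate m B) : IsGate m Bᶜ := by
  intro x hx y hy
  have := h y hy x (not_not.1 hx)
  rw [dist_comm x m, dist_comm m y, dist_comm x y]
  linarith

/-- Leaving `B` from `x` costs at least `dist x m`, so the ball of this radius about `x` stays in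
`B`. -/
theorem IsGate.isOpen {m : X} {B : Set X} (h : IsGate m B) : IsOpen {x | x ∈ B ∧ x ≠ m} := by
  rw [Metric.isOpen_iff]
  rintro x ⟨hx, hm⟩
  refine ⟨dist x m, dist_pos.2 hm, fun y hy => ?_⟩
  rw [Metric.mem_ball] at hy
  refine ⟨by_contra fun hyB => ?_, ?_⟩
  · have h1 := h y hyB x hx
    have h2 := dist_nonneg (x := y) (y := m)
    rw [dist_comm m x] at h1
    linarith
  · rintro rfl
    rw [dist_comm] at hy
    exact lt_irrefl _ hy

/-- If the image missed `m`, then `B` and its complement, both without `m`, would be open sets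
disconnecting it. -/
theorem IsGate.exists_eq {m : X} {B : Set X} (h : IsGate m B) {Y : Type*} [TopologicalSpace Y]
    {γ : Y → X} {S : Set Y} (hS : IsPreconnected S) (hγ : ContinuousOn γ S) {a b : Y}
    (ha : a ∈ S) (hb : b ∈ S) (haB : γ a ∉ B) (hbB : γ b ∈ B) : ∃ t ∈ S, γ t = m := by
  by_contra! hne
  have hconn := hS.image γ hγ
  obtain ⟨x, -, hx1, hx2⟩ := hconn _ _ h.isOpen h.compl.isOpen
    (by
      rintro _ ⟨t, ht, rfl⟩
      by_cases hB : γ t ∈ B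
      · exact Or.inl ⟨hB, hne t ht⟩
      · exact Or.inr ⟨hB, hne t ht⟩)
    ⟨_, ⟨b, hb, rfl⟩, hbB, hne b hb⟩ ⟨_, ⟨a, ha, rfl⟩, haB, hne a ha⟩
  exact hx2.1 hx1.1

/-! ## Quasi-geodesic rays -/

theorem IsQuasiGeodesicRay.norm_le {o : X} {q Q : ℝ} {β : ℝ≥0 → X}
    (hβ : IsQuasiGeodesicRay o q Q β) (t : ℝ≥0) : dist o (β t) ≤ q * t + Q := by
  have := hβ.upper 0 t
  rwa [hβ.start, NNReal.dist_eq, NNReal.coe_zero, zero_sub, abs_neg, NNReal.abs_eq] at this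

theorem IsQuasiGeodesicRay.le_norm {o : X} {q Q : ℝ} {β : ℝ≥0 → X}
    (hβ : IsQuasiGeodesicRay o q Q β) (t : ℝ≥0) : 1 / q * t - Q ≤ dist o (β t) := by
  have := hβ.lower 0 t
  rwa [hβ.start, NNReal.dist_eq, NNReal.coe_zero, zero_sub, abs_neg, NNReal.abs_eq] at this

theorem IsQuasiGeodesicRay.tendsto_norm {o : X} {q Q : ℝ} {β : ℝ≥0 → X}
    (hβ : IsQuasiGeodesicRay o q Q β) : Tendsto (fun t => dist o (β t)) atTop atTop := by
  refine tendsto_atTop_mono hβ.le_norm ?_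
  have hq : 0 < 1 / q := by
    have := hβ.one_le
    positivity
  exact tendsto_atTop_add_const_right _ _
    ((NNReal.tendsto_coe_atTop.2 tendsto_id).const_mul_atTop hq)

theorem IsGeodesicRay.isQuasiGeodesicRay {o : X} {b : ℝ≥0 → X} (hb : IsGeodesicRay o b) :
    IsQuasiGeodesicRay o 1 0 b where
  one_le := le_rfl
  nonneg := le_rfl
  continuous := hb.1.continuous
  start := hb.2
  lower s t := by rw [hb.1.dist_eq]; simp
  upper s t := by rw [hb.1.dist_eq]; simp

theorem IsGeodesicRay.norm_eq {o : X} {b : ℝ≥0 → X} (hb : IsGeodesicRay o b) (t : ℝ≥0) :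
    dist o (b t) = t := by
  rw [← hb.2, hb.1.dist_eq, NNReal.dist_eq, NNReal.coe_zero, zero_sub, abs_neg, NNReal.abs_eq]

theorem IsGeodesicRay.dist_eq {o : X} {b : ℝ≥0 → X} (hb : IsGeodesicRay o b) (s t : ℝ≥0) :
    dist (b s) (b t) = |(s : ℝ) - t| := by
  rw [hb.1.dist_eq, NNReal.dist_eq]

theorem IsQuasiGeodesicRay.dist_firstTime {o : X} {q Q : ℝ} {α : ℝ≥0 → X}
    (hα : IsQuasiGeodesicRay o q Q α) {r : ℝ} (hr : 0 ≤ r) :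
    dist o (α (firstTime o α r)) = r := by
  have hc : IsClosed {t | dist o (α t) = r} :=
    isClosed_eq (continuous_const.dist hα.continuous) continuous_const
  exact hc.csInf_mem (hα.exists_dist_eq hr) (OrderBot.bddBelow _)

theorem IsQuasiGeodesicRay.firstTime_le {o : X} {q Q : ℝ} {α : ℝ≥0 → X}
    (hα : IsQuasiGeodesicRay o q Q α) {r : ℝ} (hr : 0 ≤ r) {t : ℝ≥0}
    (h : r ≤ dist o (α t)) : firstTime o α r ≤ t := by
  have hcont : ContinuousOn (fun t => dist o (α t)) (Icc 0 t) :=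
    (continuous_const.dist hα.continuous).continuousOn
  have hmem : r ∈ Icc (dist o (α 0)) (dist o (α t)) := by
    rw [hα.start, dist_self]
    exact ⟨hr, h⟩
  obtain ⟨s, hs, hsr⟩ := intermediate_value_Icc (zero_le (a := t)) hcont hmem
  exact (csInf_le (OrderBot.bddBelow {t : ℝ≥0 | dist o (α t) = r}) hsr).trans hs.2

theorem IsQuasiGeodesicRay.isQuasiGeodesicSegment {o : X} {q Q : ℝ} {α : ℝ≥0 → X}
    (hα : IsQuasiGeodesicRay o q Q α) {t : ℝ} (ht : 0 ≤ t) :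
    IsQuasiGeodesicSegment q Q 0 t (fun u => α u.toNNReal) where
  one_le := hα.one_le
  nonneg := hα.nonneg
  le := ht
  continuousOn := (hα.continuous.comp continuous_real_toNNReal).continuousOn
  lower u hu v hv := by
    have := hα.lower u.toNNReal v.toNNReal
    rwa [NNReal.dist_eq, Real.coe_toNNReal _ hu.1, Real.coe_toNNReal _ hv.1] at this
  upper u hu v hv := by
    have := hα.upper u.toNNReal v.toNNReal
    rwa [NNReal.dist_eq, Real.coe_toNNReal _ hu.1, Real.coe_toNNReal _ hv.1] at this

/-- The Morse property applied to an initial part of a ray that returns to `Z` later. -/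
theorem IsQuasiGeodesicRay.initialPart_subset {κ : ℝ → ℝ} {o : X} {q Q D : ℝ} {Z : Set X}
    {α : ℝ≥0 → X} (hα : IsQuasiGeodesicRay o q Q α)
    (morse : ∀ (s t : ℝ) (β : ℝ → X), IsQuasiGeodesicSegment q Q s t β →
      β s ∈ Z → β t ∈ Z → β '' Icc s t ⊆ kappaNeighborhood κ o Z D)
    (ho : o ∈ Z) {r : ℝ} (hr : 0 ≤ r) {t : ℝ≥0} (ht : α t ∈ Z) (h : r ≤ dist o (α t)) :
    initialPart o α r ⊆ kappaNeighborhood κ o Z D := by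
  have h1 := morse 0 t _ (hα.isQuasiGeodesicSegment t.2) (by simpa [hα.start] using ho)
    (by simpa using ht)
  rintro _ ⟨u, hu, rfl⟩
  refine h1 ⟨u, ⟨u.2, ?_⟩, by simp⟩
  exact_mod_cast hu.2.trans (hα.firstTime_le hr h)

/-- A ray that is eventually in `B` and far away along `x` forces `x` to be in `B`. -/
theorem IsGate.mem_of_infDist_lt {o m : X} {B : Set X} (hB : IsGate m B) {q Q : ℝ}
    {β : ℝ≥0 → X} (hβ : IsQuasiGeodesicRay o q Q β) {T : ℝ≥0} (hT : ∀ t, T ≤ t → β t ∈ B)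
    {x : X} (hx : Metric.infDist x (range β) + dist o m + (q * T + Q) < dist o x) : x ∈ B := by
  have hq := hβ.one_le
  have hQ := hβ.nonneg
  have hT0 : (0 : ℝ) ≤ T := T.2
  have h0 : 0 ≤ q * T + Q := by positivity
  have h1 : Metric.infDist x (range β) < dist o x - dist o m - (q * T + Q) := by linarith
  obtain ⟨_, ⟨s, rfl⟩, hs⟩ := (Metric.infDist_lt_iff (range_nonempty β)).1 h1
  -- Before time `T` the ray has norm at most `q * T + Q`, too small to be that close to `x`.
  have hTs : T ≤ s := by
    by_contra! hlt
    have h2 := hβ.norm_le s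
    have h3 : q * s ≤ q * T := mul_le_mul_of_nonneg_left (by exact_mod_cast hlt.le) (by linarith)
    have h4 := dist_triangle o (β s) x
    rw [dist_comm (β s) x] at h4
    have := dist_nonneg (x := o) (y := m)
    linarith
  -- From outside `B` the way to `β s` passes `m`, and already `dist x m` exceeds the allowed
  -- distance.
  by_contra hxB
  have h5 := hB x hxB _ (hT s hTs)
  have h6 := dist_triangle o m x
  rw [dist_comm m x] at h6
  have := dist_nonneg (x := m) (y := β s)
  linarith

/-- The distance from `γ` to `β` is sublinear in the norm, whereas changing sides of the gate would
cost about the whole norm. -/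
theorem IsGate.eventually_mem_of_subset {κ : ℝ → ℝ} (hκ : IsSublinearFunction κ) {o m : X}
    {B : Set X} (hB : IsGate m B) {q Q q' Q' n : ℝ} {β γ : ℝ≥0 → X}
    (hβ : IsQuasiGeodesicRay o q Q β) (hγ : IsQuasiGeodesicRay o q' Q' γ)
    (hsub : range γ ⊆ kappaNeighborhood κ o (range β) n) (h : ∀ᶠ t in atTop, β t ∈ B) :
    ∀ᶠ t in atTop, γ t ∈ B := by
  obtain ⟨T, hT⟩ := eventually_atTop.1 h
  filter_upwards [hγ.tendsto_norm.eventually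
    (hκ.eventually_mul_add_lt n (dist o m + (q * T + Q)))] with t ht
  refine hB.mem_of_infDist_lt hβ hT ?_
  have := hsub ⟨t, rfl⟩
  rw [kappaNeighborhood, mem_ofPred_eq] at this
  linarith

/-- Once its norm stays above that of `m`, the ray cannot pass `m` again and so cannot change sides.
-/
theorem IsGate.eventually_mem_or {o m : X} {B : Set X} (hB : IsGate m B) {q Q : ℝ}
    {β : ℝ≥0 → X} (hβ : IsQuasiGeodesicRay o q Q β) :
    (∀ᶠ t in atTop, β t ∈ B) ∨ ∀ᶠ t in atTop, β t ∉ B := by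
  obtain ⟨T, hT⟩ := eventually_atTop.1
    (hβ.tendsto_norm.eventually (eventually_gt_atTop (dist o m)))
  have key : ∀ t, T ≤ t → ∀ s, T ≤ s → β t ∈ B → β s ∈ B := by
    intro t ht s hs htB
    by_contra hsB
    obtain ⟨u, hu, hum⟩ := hB.exists_eq (isPreconnected_Ici (a := T))
      hβ.continuous.continuousOn hs ht hsB htB
    have := hT u hu
    rw [hum] at this
    exact lt_irrefl _ this
  by_cases h : β T ∈ B
  · exact Or.inl (eventually_atTop.2 ⟨T, fun s hs => key T le_rfl s hs h⟩)
  · exact Or.inr (eventually_atTop.2 ⟨T, fun s hs hsB => h (key s hs T le_rfl hsB)⟩)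

/-- A geodesic ray does not backtrack: if it were outside `B` at a time beyond the norm of `m`, it
would have to return to `m` in order to enter. -/
theorem IsGeodesicRay.mem_of_eventually_mem {o m : X} {B : Set X} (hB : IsGate m B)
    {b : ℝ≥0 → X} (hb : IsGeodesicRay o b) (h : ∀ᶠ t in atTop, b t ∈ B) {s : ℝ≥0}
    (hs : dist o m < s) : b s ∈ B := by
  by_contra hsB
  obtain ⟨t, ht, hst⟩ := (h.and (eventually_ge_atTop s)).exists
  have hst' : (s : ℝ) ≤ t := by exact_mod_cast hst
  have h1 := hB _ hsB _ ht
  rw [hb.dist_eq, abs_sub_comm, abs_of_nonneg (by linarith)] at h1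
  have h2 := dist_triangle o m (b s)
  have h3 := dist_triangle o m (b t)
  rw [hb.norm_eq] at h2 h3
  rw [dist_comm m] at h2
  linarith

theorem IsQuasiGeodesicRay.exists_eq_of_eventually_mem {o m : X} {B : Set X} (hB : IsGate m B)
    {q Q : ℝ} {β : ℝ≥0 → X} (hβ : IsQuasiGeodesicRay o q Q β)
    (h : ∀ᶠ t in atTop, β t ∈ B) {s : ℝ≥0} (hs : β s ∉ B) : ∃ t, s ≤ t ∧ β t = m := by
  obtain ⟨t, ht, hst⟩ := (h.and (eventually_ge_atTop s)).exists
  obtain ⟨u, hu, hum⟩ := hB.exists_eq (isPreconnected_Icc (a := s) (b := t))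
    hβ.continuous.continuousOn (left_mem_Icc.2 hst) (right_mem_Icc.2 hst) hs ht
  exact ⟨u, hu.1, hum⟩

/-! ## Sequences of gates -/

/-- A nested sequence of gates `p (n + 1)` that separate the base-point from infinity. -/
structure IsGateSeq (o : X) (p : ℕ → X) (B : ℕ → Set X) : Prop where
  zero : p 0 = o
  univ : B 0 = Set.univ
  gate : ∀ n, IsGate (p n) (B n)
  notMem : ∀ n, o ∉ B (n + 1)
  mem : ∀ n, p (n + 1) ∈ B n
  anti : ∀ n, B (n + 1) ⊆ B n
  -- The first two gates may coincide, since a ray can leave its first flat at the base-point.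
  ne : ∀ n, p (n + 1) ≠ p (n + 2)
  tendsto : Tendsto (fun n => dist o (p n)) atTop atTop

/-- The ray `γ` converges to the end given by the sequence of sets `B`. -/
def ConvergesTo (γ : ℝ≥0 → X) (B : ℕ → Set X) : Prop :=
  ∀ n, ∀ᶠ t in atTop, γ t ∈ B n

namespace IsGateSeq

variable {o : X} {p : ℕ → X} {B : ℕ → Set X}

theorem antitone (h : IsGateSeq o p B) : Antitone B := antitone_nat_of_succ_le h.anti

theorem norm_add_dist (h : IsGateSeq o p B) {n : ℕ} {x : X} (hx : x ∈ B n) :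
    dist o x = dist o (p n) + dist (p n) x := by
  refine le_antisymm (dist_triangle _ _ _) ?_
  cases n with
  | zero => rw [h.zero, dist_self, zero_add]
  | succ n => exact h.gate _ o (h.notMem n) x hx

theorem norm_le (h : IsGateSeq o p B) {n : ℕ} {x : X} (hx : x ∈ B n) :
    dist o (p n) ≤ dist o x := by
  rw [h.norm_add_dist hx]
  linarith [dist_nonneg (x := p n) (y := x)]

theorem norm_succ (h : IsGateSeq o p B) (n : ℕ) :
    dist o (p (n + 1)) = dist o (p n) + dist (p n) (p (n + 1)) :=
  h.norm_add_dist (h.mem n)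

theorem norm_mono (h : IsGateSeq o p B) : Monotone fun n => dist o (p n) :=
  monotone_nat_of_le_succ fun n => h.norm_le (h.mem n)

/-- The shells `B n \ B (n + 1)` exhaust the space, because points of `B n` have norm at least that
of `p n`, which tends to infinity. -/
theorem exists_mem_notMem (h : IsGateSeq o p B) (x : X) : ∃ n, x ∈ B n ∧ x ∉ B (n + 1) := by
  classical
  have hex : ∃ n, x ∉ B n := by
    obtain ⟨n, hn⟩ := (h.tendsto.eventually (eventually_gt_atTop (dist o x))).exists
    exact ⟨n, fun hx => hn.not_ge (h.norm_le hx)⟩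
  obtain ⟨k, hk⟩ : ∃ k, Nat.find hex = k + 1 := by
    refine Nat.exists_eq_succ_of_ne_zero fun h0 => ?_
    have := Nat.find_spec hex
    rw [h0, h.univ] at this
    exact this trivial
  refine ⟨k, not_not.1 (Nat.find_min hex (by omega)), ?_⟩
  rw [← hk]
  exact Nat.find_spec hex

theorem exists_eq (h : IsGateSeq o p B) {q Q : ℝ} {γ : ℝ≥0 → X}
    (hγ : IsQuasiGeodesicRay o q Q γ) (n : ℕ) {t : ℝ≥0} (ht : γ t ∈ B n) :
    ∃ s ≤ t, γ s = p n := by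
  cases n with
  | zero => exact ⟨0, zero_le, by rw [hγ.start, h.zero]⟩
  | succ n =>
    obtain ⟨s, hs, hsp⟩ := (h.gate (n + 1)).exists_eq (isPreconnected_Icc (a := 0) (b := t))
      hγ.continuous.continuousOn (left_mem_Icc.2 zero_le) (right_mem_Icc.2 zero_le)
      (by rw [hγ.start]; exact h.notMem n) ht
    exact ⟨s, hs.2, hsp⟩

theorem mem_range (h : IsGateSeq o p B) {q Q : ℝ} {γ : ℝ≥0 → X}
    (hγ : IsQuasiGeodesicRay o q Q γ) (hB : ConvergesTo γ B) (n : ℕ) : p n ∈ range γ := by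
  obtain ⟨t, ht⟩ := (hB n).exists
  obtain ⟨s, -, hs⟩ := h.exists_eq hγ n ht
  exact ⟨s, hs⟩

/-- Two quasi-geodesic rays that converge to the same end are close to each other if the
gaps of the sequence of gates are sublinear. -/
theorem range_subset (h : IsGateSeq o p B) {κ : ℝ → ℝ} (hκ : IsSublinearFunction κ) {C : ℝ}
    (hgap : ∀ n, dist (p n) (p (n + 1)) ≤ C * κ (dist o (p n))) {q Q q' Q' : ℝ}
    {β γ : ℝ≥0 → X} (hβ : IsQuasiGeodesicRay o q Q β) (hγ : IsQuasiGeodesicRay o q' Q' γ)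
    (hβB : ConvergesTo β B) (hγB : ConvergesTo γ B) :
    range γ ⊆ kappaNeighborhood κ o (range β) (q' ^ 2 * (max C 0 + Q') + Q') := by
  rintro _ ⟨u, rfl⟩
  obtain ⟨n, hn, hn'⟩ := h.exists_mem_notMem (γ u)
  obtain ⟨s, hs, hsp⟩ := h.exists_eq hγ n hn
  obtain ⟨t, ht, htp⟩ := hγ.exists_eq_of_eventually_mem (h.gate (n + 1)) (hγB (n + 1)) hn'
  have hq := hγ.one_le
  have hQ := hγ.nonneg
  have h1 := hγ.lower s t
  have h2 := hγ.upper u s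
  rw [hsp, htp] at h1
  rw [hsp] at h2
  have hs' : (s : ℝ) ≤ u := by exact_mod_cast hs
  have ht' : (u : ℝ) ≤ t := by exact_mod_cast ht
  rw [NNReal.dist_eq, abs_sub_comm, abs_of_nonneg (by linarith)] at h1
  rw [NNReal.dist_eq, abs_of_nonneg (by linarith)] at h2
  -- The time `u` lies between passages of `p n` and `p (n + 1)`; the lower quasi-geodesic bound
  -- turns the gap into a bound on the time between them.
  have h3 : (t : ℝ) - s ≤ q' * (dist (p n) (p (n + 1)) + Q') := by
    rw [one_div, sub_le_iff_le_add, inv_mul_le_iff₀ (by linarith)] at h1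
    exact h1
  have hk : κ (dist o (p n)) ≤ κ (dist o (γ u)) :=
    hκ.mono dist_nonneg dist_nonneg (h.norm_le hn)
  have h4 : dist (p n) (p (n + 1)) ≤ max C 0 * κ (dist o (γ u)) :=
    ((hgap n).trans (mul_le_mul_of_nonneg_right (le_max_left C 0)
      (zero_le_one.trans (hκ.one_le _ dist_nonneg)))).trans
      (mul_le_mul_of_nonneg_left hk (le_max_right _ _))
  have hk1 := hκ.one_le (dist o (γ u)) dist_nonneg
  rw [kappaNeighborhood, mem_ofPred_eq]
  -- All that is used of `β` is that it passes `p n`, so its constants do not enter the bound.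
  refine (Metric.infDist_le_dist_of_mem (h.mem_range hβ hβB n)).trans (h2.trans ?_)
  have h5 : (u : ℝ) - s ≤ q' * (max C 0 * κ (dist o (γ u)) + Q' * κ (dist o (γ u))) := by
    have : Q' ≤ Q' * κ (dist o (γ u)) := le_mul_of_one_le_right hQ hk1
    calc (u : ℝ) - s ≤ t - s := by linarith
      _ ≤ _ := h3
      _ ≤ _ := by gcongr
  calc q' * (u - s) + Q' ≤ q' * (q' * (max C 0 * κ (dist o (γ u)) + Q' * κ (dist o (γ u))))
        + Q' * κ (dist o (γ u)) := by
        gcongr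
        exact le_mul_of_one_le_right hQ hk1
    _ = _ := by ring

/-- Between two gates a geodesic ray runs through the points whose norm lies between those of
the gates. -/
theorem norm_le_of_notMem (h : IsGateSeq o p B) {b : ℝ≥0 → X} (hb : IsGeodesicRay o b)
    (hbB : ConvergesTo b B) {n : ℕ} {a : ℝ≥0} (ha : b a ∉ B n) : a ≤ dist o (p n) := by
  by_contra! hlt
  exact ha (hb.mem_of_eventually_mem (h.gate n) (hbB n) hlt)

theorem geodesic_eq (h : IsGateSeq o p B) {b : ℝ≥0 → X} (hb : IsGeodesicRay o b)
    (hbB : ConvergesTo b B) (n : ℕ) {a : ℝ≥0} (ha : a = dist o (p n)) : b a = p n := by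
  obtain ⟨t, ht⟩ := h.mem_range hb.isQuasiGeodesicRay hbB n
  have := hb.norm_eq t
  rw [ht, ← ha] at this
  rw [← ht]
  congr 1
  exact_mod_cast this

/-- Going from a point of a shell to a point of `b`, a path either ends in the same shell or leaves
it through one of its two gates, which lie on `b`. In each case it meets the piece of `b` between
these gates. -/
theorem exists_mem_of_segment (h : IsGateSeq o p B) {b : ℝ≥0 → X} (hb : IsGeodesicRay o b)
    (hbB : ConvergesTo b B) {γ : ℝ → X} {I : Set ℝ} (hI : IsPreconnected I)
    (hγ : ContinuousOn γ I) {u s : ℝ} (hu : u ∈ I) (hs : s ∈ I) (hsZ : γ s ∈ range b) {n : ℕ}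
    (hn : γ u ∈ B n) (hn' : γ u ∉ B (n + 1)) :
    ∃ τ ∈ I, ∃ a : ℝ≥0, b a = γ τ ∧ dist o (p n) ≤ a ∧ a ≤ dist o (p (n + 1)) := by
  by_cases h1 : γ s ∈ B n
  · by_cases h2 : γ s ∈ B (n + 1)
    · obtain ⟨τ, hτ, hτp⟩ := (h.gate (n + 1)).exists_eq hI hγ hu hs hn' h2
      refine ⟨τ, hτ, (dist o (p (n + 1))).toNNReal, ?_, ?_, ?_⟩
      · rw [hτp]
        exact h.geodesic_eq hb hbB _ (Real.coe_toNNReal _ dist_nonneg)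
      · rw [Real.coe_toNNReal _ dist_nonneg]
        exact h.norm_mono n.le_succ
      · rw [Real.coe_toNNReal _ dist_nonneg]
    · obtain ⟨a, ha⟩ := hsZ
      refine ⟨s, hs, a, ha, ?_, h.norm_le_of_notMem hb hbB (by rwa [ha])⟩
      have := h.norm_le h1
      rwa [← ha, hb.norm_eq] at this
  · obtain ⟨τ, hτ, hτp⟩ := (h.gate n).exists_eq hI hγ hs hu h1 hn
    refine ⟨τ, hτ, (dist o (p n)).toNNReal, ?_, ?_, ?_⟩
    · rw [hτp]
      exact h.geodesic_eq hb hbB _ (Real.coe_toNNReal _ dist_nonneg)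
    · rw [Real.coe_toNNReal _ dist_nonneg]
    · rw [Real.coe_toNNReal _ dist_nonneg]
      exact h.norm_mono n.le_succ

/-- Before and after the time `u`, the segment meets the piece of `b` between the two gates of the
shell of `β u`. That piece is of length at most `C * κ`, so the two meeting times are close and `u`
is between them. -/
theorem image_subset (h : IsGateSeq o p B) {κ : ℝ → ℝ} (hκ : IsSublinearFunction κ) {C : ℝ}
    (hC : 0 ≤ C) (hgap : ∀ n, dist (p n) (p (n + 1)) ≤ C * κ (dist o (p n)))
    {b : ℝ≥0 → X} (hb : IsGeodesicRay o b) (hbB : ConvergesTo b B) {q Q s t : ℝ} {β : ℝ → X}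
    (hβ : IsQuasiGeodesicSegment q Q s t β) (hs : β s ∈ range b) (ht : β t ∈ range b) :
    β '' Icc s t ⊆ kappaNeighborhood κ o (range b) (q ^ 2 * (C + Q) + Q) := by
  rintro _ ⟨u, hu, rfl⟩
  obtain ⟨n, hn, hn'⟩ := h.exists_mem_notMem (β u)
  obtain ⟨τ, hτ, a, ha, ha1, ha2⟩ := h.exists_mem_of_segment hb hbB
    (isPreconnected_Icc (a := s) (b := u))
    (hβ.continuousOn.mono (Icc_subset_Icc_right hu.2)) (right_mem_Icc.2 hu.1)
    (left_mem_Icc.2 hu.1) hs hn hn'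
  obtain ⟨σ, hσ, c, hc, hc1, hc2⟩ := h.exists_mem_of_segment hb hbB
    (isPreconnected_Icc (a := u) (b := t))
    (hβ.continuousOn.mono (Icc_subset_Icc_left hu.1)) (left_mem_Icc.2 hu.2)
    (right_mem_Icc.2 hu.2) ht hn hn'
  have hq := hβ.one_le
  have hQ := hβ.nonneg
  have h1 := hβ.lower τ ⟨hτ.1, hτ.2.trans hu.2⟩ σ ⟨hu.1.trans hσ.1, hσ.2⟩
  have h2 := hβ.upper u hu τ ⟨hτ.1, hτ.2.trans hu.2⟩
  have hk : κ (dist o (p n)) ≤ κ (dist o (β u)) :=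
    hκ.mono dist_nonneg dist_nonneg (h.norm_le hn)
  have hk1 := hκ.one_le (dist o (β u)) dist_nonneg
  have hac : dist (β τ) (β σ) ≤ C * κ (dist o (β u)) := by
    have h3 := hgap n
    have h4 := h.norm_succ n
    rw [← ha, ← hc, hb.dist_eq]
    have : |(a : ℝ) - c| ≤ dist (p n) (p (n + 1)) := by
      rw [abs_le]
      constructor <;> linarith
    exact this.trans (h3.trans (mul_le_mul_of_nonneg_left hk hC))
  have hτu := hτ.2
  have huσ := hσ.1
  rw [Real.dist_eq, abs_sub_comm, abs_of_nonneg (by linarith)] at h1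
  rw [Real.dist_eq, abs_of_nonneg (by linarith)] at h2
  have h3 : σ - τ ≤ q * (C * κ (dist o (β u)) + Q * κ (dist o (β u))) := by
    have : Q ≤ Q * κ (dist o (β u)) := le_mul_of_one_le_right hQ hk1
    rw [one_div, sub_le_iff_le_add, inv_mul_le_iff₀ (by linarith)] at h1
    refine h1.trans ?_
    gcongr
  rw [kappaNeighborhood, mem_ofPred_eq]
  refine (Metric.infDist_le_dist_of_mem (ha ▸ mem_range_self a)).trans (h2.trans ?_)
  calc q * (u - τ) + Q ≤ q * (q * (C * κ (dist o (β u)) + Q * κ (dist o (β u))))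
        + Q * κ (dist o (β u)) := by
        gcongr
        · linarith
        · exact le_mul_of_one_le_right hQ hk1
    _ = _ := by ring

theorem exists_isStrongMorseGauge (h : IsGateSeq o p B) {κ : ℝ → ℝ}
    (hκ : IsSublinearFunction κ) {C : ℝ}
    (hgap : ∀ n, dist (p n) (p (n + 1)) ≤ C * κ (dist o (p n)))
    {b : ℝ≥0 → X} (hb : IsGeodesicRay o b) (hbB : ConvergesTo b B) :
    ∃ m, IsStrongMorseGauge κ o (range b) m := by
  have hgap' : ∀ n, dist (p n) (p (n + 1)) ≤ max C 1 * κ (dist o (p n)) := fun n =>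
    (hgap n).trans (mul_le_mul_of_nonneg_right (le_max_left C 1)
      (zero_le_one.trans (hκ.one_le _ dist_nonneg)))
  -- Raising the constant to at least `1` makes the gauge dominate `q`.
  have hC : 1 ≤ max C 1 := le_max_right _ _
  set D := max C 1
  have morse := fun (q Q s t : ℝ) (β : ℝ → X) (hβ : IsQuasiGeodesicSegment q Q s t β) hs ht =>
    h.image_subset hκ (zero_le_one.trans hC) hgap' hb hbB hβ hs ht
  have hmax : ∀ q Q : ℝ, 1 ≤ q → 0 ≤ Q → max q Q ≤ q ^ 2 * (D + Q) + Q := by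
    intro q Q hq hQ
    have h1 : q ≤ q ^ 2 := by nlinarith
    have h2 : q ^ 2 ≤ q ^ 2 * (D + Q) := le_mul_of_one_le_right (by positivity) (by linarith)
    refine max_le (by linarith) (by linarith)
  refine ⟨fun q Q => q ^ 2 * (D + Q) + Q, hmax, morse, ?_⟩
  intro r n κ' hr hn hκ'
  -- Take a gate `p k` of norm at least `r`, and `R` so large that being sublinearly close to `b` at
  -- norm `R` forces `η` into `B k`. Then `η` has passed `p k`, a point of `b`, and the Morse
  -- property applies up to there.
  obtain ⟨k, hk⟩ := (h.tendsto.eventually (eventually_ge_atTop r)).exists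
  obtain ⟨T, hT⟩ := eventually_atTop.1 (hbB k)
  obtain ⟨R, hR, hR0⟩ := ((hκ'.eventually_mul_add_lt n (dist o (p k) + (1 * T + 0))).and
    (eventually_gt_atTop 0)).exists
  refine ⟨R, hR0, fun q Q η hη _ hclose => ?_⟩
  have hmem : η (firstTime o η R) ∈ B k := by
    refine (h.gate k).mem_of_infDist_lt hb.isQuasiGeodesicRay hT ?_
    rw [hη.dist_firstTime hR0.le]
    linarith
  obtain ⟨s, -, hs⟩ := h.exists_eq hη k hmem
  exact hη.initialPart_subset (morse q Q) ⟨0, hb.2⟩ hr.le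
    (by rw [hs]; exact h.mem_range hb.isQuasiGeodesicRay hbB k) (hk.trans_eq (by rw [hs]))

/-- The points of a geodesic ray that are nearest to a point between two gates lie between
these gates. -/
theorem nearestPoints_subset (h : IsGateSeq o p B) {b : ℝ≥0 → X} (hb : IsGeodesicRay o b)
    (hbB : ConvergesTo b B) {x : X} {n : ℕ} (hx : x ∈ B n) (hx' : x ∉ B (n + 1)) {a : ℝ≥0}
    (ha : dist x (b a) = Metric.infDist x (range b)) :
    dist o (p n) ≤ a ∧ a ≤ dist o (p (n + 1)) := by
  have hle : ∀ k, dist x (b a) ≤ dist x (p k) := fun k => by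
    rw [ha]
    exact Metric.infDist_le_dist_of_mem (h.mem_range hb.isQuasiGeodesicRay hbB k)
  constructor
  · by_contra! hlt
    have hn : b a ∉ B n := fun hB => by
      have := h.norm_le hB
      rw [hb.norm_eq] at this
      linarith
    have h1 := h.gate n _ hn x hx
    have h2 := hle n
    rw [dist_comm (b a) x, dist_comm (p n) x] at h1
    have h3 : dist (b a) (p n) ≤ 0 := by linarith
    rw [← dist_le_zero.1 h3, hb.norm_eq] at hlt
    exact lt_irrefl _ hlt
  · by_contra! hlt
    have h1 := h.gate (n + 1) x hx' _ (hb.mem_of_eventually_mem (h.gate _) (hbB _) hlt)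
    have h2 := hle (n + 1)
    have h3 : dist (p (n + 1)) (b a) ≤ 0 := by linarith
    rw [dist_le_zero.1 h3, hb.norm_eq] at hlt
    exact lt_irrefl _ hlt

theorem norm_lt (h : IsGateSeq o p B) (n : ℕ) :
    dist o (p (n + 1)) < dist o (p (n + 2)) := by
  rw [h.norm_succ (n + 1)]
  linarith [dist_pos.2 (h.ne n)]

/-- A way from `x` two shells further passes `p (n + 1)`, a point of `b`, and then the distinct gate
`p (n + 2)`; so it is strictly longer than the distance from `x` to `b`. -/
theorem index_le_of_dist_le (h : IsGateSeq o p B) {b : ℝ≥0 → X} (hb : IsGeodesicRay o b)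
    (hbB : ConvergesTo b B) {x y : X} {n k : ℕ} (hx' : x ∉ B (n + 1)) (hy : y ∈ B k)
    (hxy : dist x y ≤ Metric.infDist x (range b)) : k ≤ n + 1 := by
  by_contra! hk
  have hy2 : y ∈ B (n + 2) := h.antitone (by omega) hy
  have h1 := h.gate (n + 1) x hx' y (h.anti _ hy2)
  have h2 : p (n + 1) ∉ B (n + 2) := fun hB => (h.norm_lt n).not_ge (h.norm_le hB)
  have h3 := h.gate (n + 2) _ h2 y hy2
  have h4 := dist_pos.2 (h.ne n)
  have h5 := Metric.infDist_le_dist_of_mem (x := x)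
    (h.mem_range hb.isQuasiGeodesicRay hbB (n + 1))
  have h6 := dist_nonneg (x := p (n + 2)) (y := y)
  linarith

theorem index_ge_of_dist_le (h : IsGateSeq o p B) {b : ℝ≥0 → X} (hb : IsGeodesicRay o b)
    (hbB : ConvergesTo b B) {x y : X} {n k : ℕ} (hx : x ∈ B n) (hy' : y ∉ B (k + 1))
    (hxy : dist x y ≤ Metric.infDist x (range b)) : n ≤ k + 1 := by
  by_contra! hk
  have hx2 : x ∈ B (k + 2) := h.antitone (by omega) hx
  have h1 := h.gate (k + 1) y hy' x (h.anti _ hx2)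
  have h2 : p (k + 1) ∉ B (k + 2) := fun hB => (h.norm_lt k).not_ge (h.norm_le hB)
  have h3 := h.gate (k + 2) _ h2 x hx2
  have h4 := dist_pos.2 (h.ne k)
  have h5 := Metric.infDist_le_dist_of_mem (x := x)
    (h.mem_range hb.isQuasiGeodesicRay hbB (k + 2))
  have h6 := dist_nonneg (x := y) (y := p (k + 1))
  rw [dist_comm y x] at h1
  rw [dist_comm x (p (k + 2))] at h5
  linarith

theorem norm_le_add (h : IsGateSeq o p B) {L : ℝ} (hL : ∀ n, dist (p n) (p (n + 1)) ≤ L)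
    (n k : ℕ) : dist o (p (n + k)) ≤ dist o (p n) + k * L := by
  induction k with
  | zero => simp
  | succ k ih =>
    rw [← add_assoc, h.norm_succ]
    push_cast
    linarith [hL (n + k)]

/-- A geodesic ray through gates with bounded gaps is contracting. -/
theorem isKappaContracting (h : IsGateSeq o p B) {κ : ℝ → ℝ} (hκ : IsSublinearFunction κ)
    {L : ℝ} (hL : ∀ n, dist (p n) (p (n + 1)) ≤ L) {b : ℝ≥0 → X} (hb : IsGeodesicRay o b)
    (hbB : ConvergesTo b B) : IsKappaContracting κ o (range b) := by
  have hL0 : 0 ≤ L := dist_nonneg.trans (hL 0)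
  -- The shells of `x` and `y` are equal or adjacent, so all nearest points lie between `p (n - 1)`
  -- and `p (n + 2)`: three gaps. For `n = 0` the truncated `n - 1` is `0`, which is harmless.
  refine ⟨3 * L, fun x y hxy => ?_⟩
  obtain ⟨n, hn, hn'⟩ := h.exists_mem_notMem x
  obtain ⟨k, hk, hk'⟩ := h.exists_mem_notMem y
  have h1 := h.index_le_of_dist_le hb hbB hn' hk hxy
  have h2 := h.index_ge_of_dist_le hb hbB hn hk' hxy
  have key : ∀ z ∈ nearestPoints (range b) x ∪ nearestPoints (range b) y,
      ∃ a : ℝ≥0, b a = z ∧ dist o (p (n - 1)) ≤ a ∧ a ≤ dist o (p (n - 1)) + 3 * L := by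
    rintro _ (⟨⟨a, rfl⟩, ha⟩ | ⟨⟨a, rfl⟩, ha⟩)
    · obtain ⟨h3, h4⟩ := h.nearestPoints_subset hb hbB hn hn' ha
      refine ⟨a, rfl, (h.norm_mono (by omega)).trans h3, ?_⟩
      have h5 := h.norm_le_add hL (n - 1) 3
      have h6 := h.norm_mono (show n + 1 ≤ n - 1 + 3 by omega)
      push_cast at h5
      simp only at h6
      linarith
    · obtain ⟨h3, h4⟩ := h.nearestPoints_subset hb hbB hk hk' ha
      refine ⟨a, rfl, (h.norm_mono (by omega)).trans h3, ?_⟩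
      have h5 := h.norm_le_add hL (n - 1) 3
      have h6 := h.norm_mono (show k + 1 ≤ n - 1 + 3 by omega)
      push_cast at h5
      simp only at h6
      linarith
  have hdiam : Metric.diam (nearestPoints (range b) x ∪ nearestPoints (range b) y) ≤ 3 * L := by
    refine Metric.diam_le_of_forall_dist_le (by linarith) fun z hz w hw => ?_
    obtain ⟨a, rfl, ha1, ha2⟩ := key z hz
    obtain ⟨c, rfl, hc1, hc2⟩ := key w hw
    rw [hb.dist_eq, abs_le]
    constructor <;> linarith
  exact hdiam.trans (le_mul_of_one_le_right (by linarith) (hκ.one_le _ dist_nonneg))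

end IsGateSeq

end Gates

/-! ### Geodesic rays through a sequence of gates -/

section Joining

variable {X : Type*} [MetricSpace X]

/-- The points `x` and `y` are joined by a geodesic. -/
def IsJoined (x y : X) : Prop :=
  ∃ γ : ℝ → X, LipschitzWith 1 γ ∧ γ 0 = x ∧ γ (dist x y) = y

theorem LipschitzWith.ite_le {f g : ℝ → X} (hf : LipschitzWith 1 f) (hg : LipschitzWith 1 g)
    {c : ℝ} (h : f c = g c) : LipschitzWith 1 fun s => if s ≤ c then f s else g s := by
  have hf' : ∀ s t, dist (f s) (f t) ≤ dist s t := fun s t => by simpa using hf.dist_le_mul s t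
  have hg' : ∀ s t, dist (g s) (g t) ≤ dist s t := fun s t => by simpa using hg.dist_le_mul s t
  have key : ∀ s t, s ≤ c → c < t → dist (f s) (g t) ≤ dist s t := fun s t hs ht => by
    refine (dist_triangle _ (f c) _).trans ?_
    have h1 := hf' s c
    have h2 := hg' c t
    rw [← h] at h2
    rw [Real.dist_eq, abs_sub_comm, abs_of_nonneg (by linarith)] at h1 h2 ⊢
    linarith
  refine LipschitzWith.of_dist_le_mul fun s t => ?_
  rw [NNReal.coe_one, one_mul]
  rcases le_or_gt s c with hs | hs <;> rcases le_or_gt t c with ht | ht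
  · simpa [hs, ht] using hf' s t
  · simpa [hs, ht.not_ge] using key s t hs ht
  · rw [dist_comm, dist_comm s t]
    simpa [hs.not_ge, ht] using key t s ht hs
  · simpa [hs.not_ge, ht.not_ge] using hg' s t

theorem LipschitzWith.comp_sub_const {f : ℝ → X} (hf : LipschitzWith 1 f) (c : ℝ) :
    LipschitzWith 1 fun s => f (s - c) := by
  refine LipschitzWith.of_dist_le_mul fun s t => ?_
  simpa using hf.dist_le_mul (s - c) (t - c)

theorem IsJoined.trans {x y z : X} (h : IsJoined x y) (h' : IsJoined y z)
    (hd : dist x z = dist x y + dist y z) : IsJoined x z := by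
  obtain ⟨f, hf, hf0, hf1⟩ := h
  obtain ⟨g, hg, hg0, hg1⟩ := h'
  refine ⟨_, hf.ite_le (c := dist x y) (hg.comp_sub_const (dist x y)) (by simp [hf1, hg0]), ?_, ?_⟩
  · simp [hf0]
  · by_cases h0 : dist x z ≤ dist x y
    · have h1 : dist y z = 0 := le_antisymm (by linarith) dist_nonneg
      rw [if_pos h0, hd, h1, add_zero, hf1, dist_eq_zero.1 h1]
    · rw [if_neg h0, hd, add_sub_cancel_left, hg1]

/-- Concatenating geodesics between consecutive gates gives a `1`-Lipschitz ray whose norm at each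
gate equals the elapsed time. This leaves no slack, so the ray is isometric. -/
theorem IsGateSeq.exists_isGeodesicRay {o : X} {p : ℕ → X} {B : ℕ → Set X}
    (h : IsGateSeq o p B) (hj : ∀ n, IsJoined (p n) (p (n + 1))) :
    ∃ b, IsGeodesicRay o b ∧ ConvergesTo b B := by
  choose γ hγ hγ0 hγ1 using hj
  set P : ℕ → ℝ := fun n => dist o (p n) with hP
  -- `Γ n` is the concatenation of the first `n + 1` geodesics; it is final up to time `P (n + 1)`.
  let Γ : ℕ → ℝ → X := fun n => Nat.rec (γ 0)
    (fun n f s => if s ≤ P (n + 1) then f s else γ (n + 1) (s - P (n + 1))) n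
  have hΓs : ∀ n s, Γ (n + 1) s = if s ≤ P (n + 1) then Γ n s else γ (n + 1) (s - P (n + 1)) :=
    fun _ _ => rfl
  have hPs : ∀ n, P (n + 1) = P n + dist (p n) (p (n + 1)) := h.norm_succ
  have hP0 : P 0 = 0 := by simp [hP, h.zero]
  have hmain : ∀ n, LipschitzWith 1 (Γ n) ∧ Γ n (P (n + 1)) = p (n + 1) := by
    intro n
    induction n with
    | zero => exact ⟨hγ 0, by rw [hPs, hP0, zero_add]; exact hγ1 0⟩
    | succ n ih =>
      refine ⟨ih.1.ite_le ((hγ (n + 1)).comp_sub_const _) (by simp [ih.2, hγ0]), ?_⟩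
      rw [hΓs, if_neg (by linarith [hPs (n + 1), dist_pos.2 (h.ne n)]), hPs (n + 1),
        add_sub_cancel_left, hγ1]
  have hstab : ∀ n k s, s ≤ P (n + 1) → Γ (n + k) s = Γ n s := by
    intro n k s hs
    induction k with
    | zero => rfl
    | succ k ih => rw [← add_assoc, hΓs, if_pos (hs.trans (h.norm_mono (by omega))), ih]
  have hex : ∀ s : ℝ, ∃ n, s ≤ P (n + 1) := fun s =>
    (((tendsto_add_atTop_iff_nat 1).2 h.tendsto).eventually (eventually_ge_atTop s)).exists
  choose N hN using hex
  have hbΓ : ∀ s n, s ≤ P (n + 1) → Γ (N s) s = Γ n s := by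
    intro s n hs
    rcases le_total (N s) n with hle | hle
    · obtain ⟨k, rfl⟩ := Nat.exists_eq_add_of_le hle
      exact (hstab _ k s (hN s)).symm
    · obtain ⟨k, hk⟩ := Nat.exists_eq_add_of_le hle
      rw [hk]
      exact hstab _ k s hs
  let b : ℝ≥0 → X := fun t => Γ (N t) t
  have hlip : ∀ s t : ℝ≥0, dist (b s) (b t) ≤ dist s t := by
    intro s t
    have h1 : b s = Γ (max (N s) (N t)) s :=
      hbΓ s _ ((hN s).trans (h.norm_mono (by omega)))
    have h2 : b t = Γ (max (N s) (N t)) t :=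
      hbΓ t _ ((hN t).trans (h.norm_mono (by omega)))
    rw [h1, h2]
    simpa [NNReal.dist_eq, Real.dist_eq] using (hmain (max (N s) (N t))).1.dist_le_mul s t
  have hb0 : b 0 = o := by
    have : b 0 = Γ 0 0 := by
      have := hbΓ 0 0 (by simp [hP])
      simpa [b] using this
    rw [this, ← h.zero]
    exact hγ0 0
  have hbP : ∀ n, b (P (n + 1)).toNNReal = p (n + 1) := by
    intro n
    have h1 : ((P (n + 1)).toNNReal : ℝ) = P (n + 1) := Real.coe_toNNReal _ dist_nonneg
    have : b (P (n + 1)).toNNReal = Γ n (P (n + 1)) := by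
      change Γ (N ((P (n + 1)).toNNReal : ℝ)) ((P (n + 1)).toNNReal : ℝ) = _
      rw [h1]
      exact hbΓ _ _ le_rfl
    rw [this, (hmain n).2]
  have hiso : Isometry b := by
    refine Isometry.of_dist_eq fun s t => le_antisymm (hlip s t) ?_
    wlog hst : s ≤ t generalizing s t
    · rw [dist_comm, dist_comm (b s)]
      exact this t s (le_of_not_ge hst)
    have hst' : (s : ℝ) ≤ t := by exact_mod_cast hst
    have h1 := hlip 0 s
    -- Compare with a gate reached after `t`: the three pieces from `o` over `b s` and `b t` to this
    -- gate add up to at least its norm.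
    have h2 := hlip t (P (N t + 1)).toNNReal
    have h3 : dist o (p (N t + 1)) ≤ dist o (b s) + dist (b s) (b t) + dist (b t) (p (N t + 1)) :=
      (dist_triangle _ (b t) _).trans (add_le_add_left (dist_triangle _ _ _) _)
    have h4 := hN t
    rw [hb0] at h1
    rw [hbP] at h2
    rw [NNReal.dist_eq, NNReal.coe_zero, zero_sub, abs_neg, NNReal.abs_eq] at h1
    rw [NNReal.dist_eq, Real.coe_toNNReal _ dist_nonneg, abs_sub_comm,
      abs_of_nonneg (by linarith)] at h2
    rw [NNReal.dist_eq, abs_sub_comm, abs_of_nonneg (by linarith)]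
    change P (N t + 1) ≤ _ at h3
    linarith
  have hb : IsGeodesicRay o b := ⟨hiso, hb0⟩
  refine ⟨b, hb, fun n => ?_⟩
  filter_upwards [eventually_gt_atTop (P n).toNNReal] with t ht
  have ht' : P n < t := (Real.toNNReal_lt_iff_lt_coe dist_nonneg).1 ht
  -- Outside `B n` at a time beyond `P n`, the ray would have to return to `p n` before reaching a
  -- later gate.
  by_contra htB
  obtain ⟨k, hk, hnk⟩ := ((((tendsto_add_atTop_iff_nat 1).2 h.tendsto).eventually
    (eventually_ge_atTop (t : ℝ))).and (eventually_ge_atTop n)).exists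
  have hkB : p (k + 1) ∈ B n := h.antitone hnk (h.mem k)
  have h1 := h.gate n _ htB _ hkB
  have h2 := hb.dist_eq t (P (k + 1)).toNNReal
  rw [hbP, Real.coe_toNNReal _ dist_nonneg, abs_sub_comm, abs_of_nonneg (by linarith)] at h2
  have h3 := h.norm_add_dist hkB
  have h4 := dist_triangle o (p n) (b t)
  rw [hb.norm_eq, dist_comm (p n)] at h4
  have h5 : P (k + 1) = dist o (p (k + 1)) := rfl
  have h6 : P n = dist o (p n) := rfl
  linarith

end Joining

/-! ### The boundary and its topology in terms of gates -/

section Boundary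

variable {X : Type*} [MetricSpace X] {κ : ℝ → ℝ} {o : X}

/-- Sublinear closeness cannot change the side of any gate, and conversely rays through the same
sublinearly spaced gates are close. -/
theorem IsGateSeq.mem_fellowTravelClass_iff {p : ℕ → X} {B : ℕ → Set X} (h : IsGateSeq o p B)
    (hκ : IsSublinearFunction κ) {C : ℝ}
    (hgap : ∀ n, dist (p n) (p (n + 1)) ≤ C * κ (dist o (p n))) {β γ : ℝ≥0 → X}
    (hβ : ∃ q Q, IsQuasiGeodesicRay o q Q β) (hβB : ConvergesTo β B) :
    γ ∈ fellowTravelClass κ o β ↔ (∃ q Q, IsQuasiGeodesicRay o q Q γ) ∧ ConvergesTo γ B := by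
  obtain ⟨q, Q, hβ⟩ := hβ
  refine and_congr_right ?_
  rintro ⟨q', Q', hγ⟩
  constructor
  · rintro ⟨-, n, hn⟩ k
    exact (h.gate k).eventually_mem_of_subset hκ hβ hγ hn (hβB k)
  · exact fun hγB => ⟨⟨_, h.range_subset hκ hgap hγ hβ hγB hβB⟩,
      ⟨_, h.range_subset hκ hgap hβ hγ hβB hγB⟩⟩

theorem IsGate.eventually_mem_of_mem_boundary {m : X} {B : Set X} (hB : IsGate m B)
    (hκ : IsSublinearFunction κ) {c : Set (ℝ≥0 → X)} (hc : c ∈ kappaBoundary κ o)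
    {γ γ' : ℝ≥0 → X} (hγ : γ ∈ c) (hγ' : γ' ∈ c) (h : ∀ᶠ t in atTop, γ t ∈ B) :
    ∀ᶠ t in atTop, γ' t ∈ B := by
  obtain ⟨β, ⟨q, Q, hβ⟩, -, rfl⟩ := hc
  obtain ⟨⟨_, _, hγq⟩, ⟨_, hγ1⟩, -⟩ := hγ
  obtain ⟨⟨_, _, hγq'⟩, -, ⟨_, hγ2⟩⟩ := hγ'
  exact hB.eventually_mem_of_subset hκ hβ hγq' hγ2
    (hB.eventually_mem_of_subset hκ hγq hβ hγ1 h)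

/-- The boundary points whose rays are eventually in `B`. -/
def GaugeChoice.cylinder (C : GaugeChoice κ o) (B : Set X) : Set (kappaBoundary κ o) :=
  {a | ∀ᶠ t in atTop, C.geod a t ∈ B}

theorem GaugeChoice.compl_cylinder (C : GaugeChoice κ o) {m : X} {B : Set X}
    (hB : IsGate m B) : (C.cylinder B)ᶜ = C.cylinder Bᶜ := by
  ext a
  constructor
  · exact fun h => (hB.eventually_mem_or (C.isGeodesicRay a).isQuasiGeodesicRay).resolve_left h
  · intro (h : ∀ᶠ t in atTop, C.geod a t ∈ Bᶜ) (h' : ∀ᶠ t in atTop, C.geod a t ∈ B)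
    obtain ⟨t, h1, h2⟩ := (h.and h').exists
    exact h1 h2

/-- For large `r`, the gauge forces the geodesic ray of a point of `C.nbhd c r` to be in `B` at norm
`r`; being beyond `m` at that time, it can no longer leave `B`. Only the gauge value at `(1, 0)`
matters. -/
theorem GaugeChoice.isOpen_cylinder (hκ : IsSublinearFunction κ) (C : GaugeChoice κ o) {m : X}
    {B : Set X} (hB : IsGate m B) : IsOpen[C.topology hκ] (C.cylinder B) := by
  intro c (hc : ∀ᶠ t in atTop, C.geod c t ∈ B)
  obtain ⟨T, hT⟩ := eventually_atTop.1 hc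
  obtain ⟨r, ⟨hr0, hrm⟩, hr1, hr2⟩ := (((eventually_gt_atTop (0 : ℝ)).and
    (eventually_gt_atTop (dist o m))).and ((hκ.eventually_isSmallComparedTo (C.gauge c 1 0)).and
    (hκ.eventually_mul_add_lt (C.gauge c 1 0) (dist o m + (1 * T + 0))))).exists
  refine ⟨r, hr0, fun a ha => ?_⟩
  have hα := C.isGeodesicRay a
  have hαq := hα.isQuasiGeodesicRay
  have h1 := ha 1 0 _ (C.geod_mem a) hαq hr1
  have h2 : dist o (C.geod a (firstTime o (C.geod a) r)) = r := hαq.dist_firstTime hr0.le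
  have h3 := h1 ⟨_, right_mem_Icc.2 zero_le, rfl⟩
  rw [kappaNeighborhood, mem_ofPred_eq, h2] at h3
  have h4 : C.geod a (firstTime o (C.geod a) r) ∈ B := by
    refine hB.mem_of_infDist_lt (C.isGeodesicRay c).isQuasiGeodesicRay hT ?_
    rw [h2]
    linarith
  refine (hB.eventually_mem_or hαq).resolve_right fun h5 => ?_
  refine hα.mem_of_eventually_mem hB.compl h5 ?_ h4
  rw [← hα.norm_eq, h2]
  exact hrm

/-- Every contracting quasi-geodesic ray converges to an end that is described by a sequence of
gates with sublinear gaps. -/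
def HasGateSeqs (κ : ℝ → ℝ) (o : X) : Prop :=
  ∀ β : ℝ≥0 → X, (∃ q Q, IsQuasiGeodesicRay o q Q β) → IsKappaContracting κ o (range β) →
    ∃ (p : ℕ → X) (B : ℕ → Set X) (C : ℝ), IsGateSeq o p B ∧
      (∀ n, dist (p n) (p (n + 1)) ≤ C * κ (dist o (p n))) ∧
      (∀ n, IsJoined (p n) (p (n + 1))) ∧ ConvergesTo β B

theorem HasGateSeqs.nonempty_gaugeChoice (h : HasGateSeqs κ o) (hκ : IsSublinearFunction κ) :
    Nonempty (GaugeChoice κ o) := by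
  have key : ∀ c : kappaBoundary κ o, ∃ (b : ℝ≥0 → X) (m : ℝ → ℝ → ℝ),
      b ∈ (c : Set (ℝ≥0 → X)) ∧ IsGeodesicRay o b ∧ IsStrongMorseGauge κ o (range b) m := by
    rintro ⟨c, β, hβ, hcon, rfl⟩
    obtain ⟨p, B, C, hs, hgap, hj, hβB⟩ := h β hβ hcon
    obtain ⟨b, hb, hbB⟩ := hs.exists_isGeodesicRay hj
    obtain ⟨m, hm⟩ := hs.exists_isStrongMorseGauge hκ hgap hb hbB
    exact ⟨b, m, (hs.mem_fellowTravelClass_iff hκ hgap hβ hβB).2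
      ⟨⟨_, _, hb.isQuasiGeodesicRay⟩, hbB⟩, hb, hm⟩
  choose b m h1 h2 h3 using key
  exact ⟨⟨b, m, h1, h2, h3⟩⟩

/-- Every boundary point has a sequence of gates that its rays, and no others, pass. -/
theorem HasGateSeqs.exists_isGateSeq (h : HasGateSeqs κ o) (hκ : IsSublinearFunction κ)
    (c : kappaBoundary κ o) : ∃ (p : ℕ → X) (B : ℕ → Set X), IsGateSeq o p B ∧
      ∀ γ, γ ∈ (c : Set (ℝ≥0 → X)) ↔ (∃ q Q, IsQuasiGeodesicRay o q Q γ) ∧ ConvergesTo γ B := by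
  obtain ⟨c, β, hβ, hcon, rfl⟩ := c
  obtain ⟨p, B, C, hs, hgap, -, hβB⟩ := h β hβ hcon
  exact ⟨p, B, hs, fun γ => hs.mem_fellowTravelClass_iff hκ hgap hβ hβB⟩

/-- If a ray of `c'` passed all gates of `c`, the two classes would coincide; so some gate of `c`
gives a clopen cylinder containing `c` but not `c'`. -/
theorem HasGateSeqs.totallyDisconnectedSpace (h : HasGateSeqs κ o) (hκ : IsSublinearFunction κ)
    (C : GaugeChoice κ o) : @TotallyDisconnectedSpace (kappaBoundary κ o) (C.topology hκ) := by
  let _ := C.topology hκ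
  have : TotallySeparatedSpace (kappaBoundary κ o) := by
    refine ⟨fun c _ c' _ hne => ?_⟩
    obtain ⟨p, B, hs, hB⟩ := h.exists_isGateSeq hκ c
    obtain ⟨p', B', hs', hB'⟩ := h.exists_isGateSeq hκ c'
    by_cases hall : ConvergesTo (C.geod c') B
    · refine absurd (Subtype.ext (Set.ext fun γ => ?_)) hne
      have hc' : C.geod c' ∈ (c : Set (ℝ≥0 → X)) := (hB _).2 ⟨((hB' _).1 (C.geod_mem c')).1, hall⟩
      constructor
      · exact fun hγ => (hB' γ).2 ⟨((hB γ).1 hγ).1, fun n =>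
          (hs'.gate n).eventually_mem_of_mem_boundary hκ c.2 hc' hγ
            (((hB' _).1 (C.geod_mem c')).2 n)⟩
      · exact fun hγ => (hB γ).2 ⟨((hB' γ).1 hγ).1, fun n =>
          (hs.gate n).eventually_mem_of_mem_boundary hκ c'.2 (C.geod_mem c') hγ (hall n)⟩
    · obtain ⟨n, hn⟩ := not_forall.1 hall
      refine ⟨C.cylinder (B n), (C.cylinder (B n))ᶜ, C.isOpen_cylinder hκ (hs.gate n), ?_,
        ((hB _).1 (C.geod_mem c)).2 n, hn, by simp, disjoint_compl_right⟩
      rw [C.compl_cylinder (hs.gate n)]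
      exact C.isOpen_cylinder hκ (hs.gate n).compl
  infer_instance

/-- The boundary points beyond a gate that the geodesic ray of `c` passes at distance at
least `r` belong to the neighbourhood of `c` of radius `r`. -/
theorem GaugeChoice.mem_nbhd (hκ : IsSublinearFunction κ) (C : GaugeChoice κ o)
    {c a : kappaBoundary κ o} {m : X} {B : Set X} (hB : IsGate m B) (ho : o ∉ B) {r : ℝ}
    (hr : 0 ≤ r) (hrm : r ≤ dist o m) (hc : c ∈ C.cylinder B) (ha : a ∈ C.cylinder B) :
    a ∈ C.nbhd c r := by
  intro q Q α hαa hα _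
  have h1 := hB.eventually_mem_of_mem_boundary hκ a.2 (C.geod_mem a) hαa ha
  obtain ⟨t, -, ht⟩ := hα.exists_eq_of_eventually_mem hB h1 (s := 0) (by rwa [hα.start])
  have hg := C.isGeodesicRay c
  obtain ⟨s, -, hs⟩ := hg.isQuasiGeodesicRay.exists_eq_of_eventually_mem hB hc (s := 0)
    (by rwa [hg.2])
  -- Both `α` and the geodesic ray of `c` pass `m`, so up to there `α` is a quasi-geodesic segment
  -- with end points on the geodesic ray.
  exact hα.initialPart_subset ((C.isGauge c).morse q Q) ⟨0, hg.2⟩ hr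
    (by rw [ht]; exact ⟨s, hs⟩) (by rwa [ht])

/-- A geodesic ray through gates with bounded gaps represents a boundary point. -/
theorem IsGateSeq.exists_boundary_point {p : ℕ → X} {B : ℕ → Set X} (h : IsGateSeq o p B)
    (hκ : IsSublinearFunction κ) {L : ℝ} (hL : ∀ n, dist (p n) (p (n + 1)) ≤ L)
    (hj : ∀ n, IsJoined (p n) (p (n + 1))) (C : GaugeChoice κ o) :
    ∃ a : kappaBoundary κ o, ∀ n, a ∈ C.cylinder (B n) := by
  obtain ⟨b, hb, hbB⟩ := h.exists_isGeodesicRay hj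
  have hba : fellowTravelClass κ o b ∈ kappaBoundary κ o :=
    ⟨b, ⟨_, _, hb.isQuasiGeodesicRay⟩, h.isKappaContracting hκ hL hb hbB, rfl⟩
  refine ⟨⟨_, hba⟩, fun n => ?_⟩
  have hgap : ∀ n, dist (p n) (p (n + 1)) ≤ L * κ (dist o (p n)) := fun n =>
    (hL n).trans (le_mul_of_one_le_right (dist_nonneg.trans (hL n)) (hκ.one_le _ dist_nonneg))
  exact ((h.mem_fellowTravelClass_iff hκ hgap ⟨_, _, hb.isQuasiGeodesicRay⟩ hbB).1
    (C.geod_mem ⟨_, hba⟩)).2 n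

end Boundary

namespace TreeOfFlats

/-! ## Normal forms in `ℤ² ∗ ℤ` -/

/-- The letter `g₃` or its inverse. -/
def letter (ε : Bool) : A := cond ε g₃ g₃⁻¹

theorem letter_not (ε : Bool) : letter (!ε) = (letter ε)⁻¹ := by
  cases ε <;> simp [letter]

theorem letter_mul_letter_not (ε : Bool) : letter ε * letter (!ε) = 1 := by
  rw [letter_not, mul_inv_cancel]

theorem ofLattice_zero : ofLattice 0 = 1 := by
  rw [ofLattice, ofAdd_zero, map_one]

theorem ofLattice_add (z w : ℤ × ℤ) : ofLattice (z + w) = ofLattice z * ofLattice w := by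
  rw [ofLattice, ofAdd_add, map_mul]
  rfl

theorem ofLattice_neg (z : ℤ × ℤ) : ofLattice (-z) = (ofLattice z)⁻¹ := by
  rw [ofLattice, ofAdd_neg, map_inv]
  rfl

/-- Extending a product on the right is how one walks along planes and edges of the space. -/
theorem induction_right {P : A → Prop} (one : P 1) (lat : ∀ h z, P h → P (h * ofLattice z))
    (let_ : ∀ h ε, P h → P (h * letter ε)) (h : A) : P h := by
  have key : ∀ a : A, ∀ h, P h → P (h * a) := by
    intro a
    induction a using Monoid.Coprod.induction_on with
    | inl z => exact fun h hh => lat h z.toAdd hh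
    | inr n =>
      have hn : Monoid.Coprod.inr n = g₃ ^ n.toAdd := by
        rw [g₃, ← map_zpow, ← ofAdd_zsmul, smul_eq_mul, mul_one, ofAdd_toAdd]
      rw [hn]
      intro h hh
      induction n.toAdd using Int.induction_on with
      | zero => simpa using hh
      | succ i ih =>
        rw [zpow_add_one, ← mul_assoc]
        exact let_ _ true ih
      | pred i ih =>
        rw [zpow_sub_one, ← mul_assoc]
        exact let_ _ false ih
    | mul x y hx hy =>
      intro h hh
      rw [← mul_assoc]
      exact hy _ (hx _ hh)
  simpa using key h 1 one

/-- Two consecutive syllables `g₃ ^ ε * z` and `g₃ ^ ε' * z'` do not cancel. -/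
def NotCancel (a b : Bool × (ℤ × ℤ)) : Prop := ¬ (a.2 = 0 ∧ b.1 = !a.1)

instance : DecidableRel NotCancel := fun _ _ => inferInstanceAs (Decidable (¬ _))

/-- Reduced words `z₀ * g₃ ^ ε₁ * z₁ * ⋯ * g₃ ^ εₖ * zₖ`. -/
abbrev Word : Type := {w : (ℤ × ℤ) × List (Bool × (ℤ × ℤ)) // w.2.IsChain NotCancel}

namespace Word

/-- Multiplication of a word by an element of `ℤ²` from the left. -/
def shift (z : ℤ × ℤ) (w : Word) : Word := ⟨(z + w.1.1, w.1.2), w.2⟩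

/-- Multiplication of a word by a letter from the left. -/
def step (ε : Bool) : Word → Word
  | ⟨(z, []), _⟩ => ⟨(0, [(ε, z)]), by simp⟩
  | ⟨(z, a :: L), h⟩ =>
    if hz : NotCancel (ε, z) a then ⟨(0, (ε, z) :: a :: L), List.IsChain.cons_cons hz h⟩
    else ⟨(a.2, L), h.tail⟩

theorem step_step (ε : Bool) (w : Word) : step (!ε) (step ε w) = w := by
  obtain ⟨⟨z, L⟩, h⟩ := w
  cases L with
  | nil => simp [step, NotCancel]
  | cons a L =>
    by_cases hz : NotCancel (ε, z) a
    · have h1 : ¬ NotCancel (!ε, 0) (ε, z) := by simp [NotCancel]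
      simp [step, hz, h1]
    · rw [step, dif_neg hz]
      obtain ⟨rfl, ha⟩ := not_not.1 hz
      obtain ⟨a1, a2⟩ := a
      obtain rfl : a1 = !ε := ha
      cases L with
      | nil => simp [step]
      | cons c L =>
        have hc : NotCancel (!ε, a2) c := by
          simp only [List.isChain_cons_cons] at h
          exact h.1
        simp [step, hc]

/-- The action of a letter on words. -/
def stepEquiv (ε : Bool) : Equiv.Perm Word where
  toFun := step ε
  invFun := step (!ε)
  left_inv := step_step ε
  right_inv w := by simpa using step_step (!ε) w

/-- The action of `ℤ²` on words. -/
def shiftHom : Multiplicative (ℤ × ℤ) →* Equiv.Perm Word where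
  toFun z :=
    { toFun := shift z.toAdd
      invFun := shift (-z.toAdd)
      left_inv := fun w => by simp [shift]
      right_inv := fun w => by simp [shift] }
  map_one' := by ext w <;> simp [shift]
  map_mul' x y := by
    ext w <;> simp [shift, add_assoc]

/-- The action of `A` on words. -/
def act : A →* Equiv.Perm Word :=
  Monoid.Coprod.lift shiftHom (zpowersHom _ (stepEquiv true))

theorem act_ofLattice (z : ℤ × ℤ) (w : Word) : act (ofLattice z) w = shift z w := by
  simp [act, ofLattice, shiftHom]

theorem act_letter (ε : Bool) (w : Word) : act (letter ε) w = step ε w := by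
  have h : act g₃ = stepEquiv true := by
    simp [act, g₃]
  cases ε
  · rw [letter, cond_false, map_inv, h]
    rfl
  · rw [letter, cond_true, h]
    rfl

/-- The value of a word. -/
def eval (w : Word) : A :=
  ofLattice w.1.1 * (w.1.2.map fun a => letter a.1 * ofLattice a.2).prod

theorem eval_step (ε : Bool) (w : Word) : eval (step ε w) = letter ε * eval w := by
  obtain ⟨⟨z, L⟩, h⟩ := w
  cases L with
  | nil => simp [step, eval, ofLattice_zero]
  | cons a L =>
    by_cases hz : NotCancel (ε, z) a
    · simp [step, hz, eval, ofLattice_zero, mul_assoc]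
    · rw [step, dif_neg hz]
      obtain ⟨rfl, ha⟩ := not_not.1 hz
      obtain ⟨a1, a2⟩ := a
      obtain rfl : a1 = !ε := ha
      simp [eval, ofLattice_zero, letter_not, ← mul_assoc]

theorem eval_act (h : A) : ∀ w, eval (act h w) = h * eval w := by
  induction h using induction_right with
  | one => simp
  | lat h z ih =>
    intro w
    rw [map_mul, Equiv.Perm.mul_apply, ih, act_ofLattice]
    simp [eval, shift, ofLattice_add, mul_assoc]
  | let_ h ε ih =>
    intro w
    rw [map_mul, Equiv.Perm.mul_apply, ih, act_letter, eval_step, mul_assoc]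

/-- The empty word. -/
def nil : Word := ⟨(0, []), by simp⟩

/-- Van der Waerden's trick: as `A` acts on reduced words, the image of the empty word under `h` is
a reduced word for `h`. -/
theorem eval_act_nil (h : A) : eval (act h nil) = h := by
  rw [eval_act]
  simp [eval, nil, ofLattice_zero]

end Word

/-- The first exit of `h` from `ℤ²`: for an element that starts with `z * g₃ ^ ε` the pair `(z, ε)`,
and `none` for elements of `ℤ²`. -/
def firstExit (h : A) : Option ((ℤ × ℤ) × Bool) :=
  -- Right multiplication of `h` acts on the front of the word of `h⁻¹` and so spares its last
  -- syllable; the inverse of that syllable is the first exit of `h`.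
  (Word.act h⁻¹ Word.nil).1.2.getLast?.map fun a => (-a.2, !a.1)

theorem firstExit_ofLattice (z : ℤ × ℤ) : firstExit (ofLattice z) = none := by
  rw [firstExit, ← ofLattice_neg, Word.act_ofLattice]
  simp [Word.shift, Word.nil]

theorem firstExit_one : firstExit 1 = none := by
  rw [← ofLattice_zero, firstExit_ofLattice]

theorem firstExit_eq_none_iff {h : A} : firstExit h = none ↔ ∃ z, h = ofLattice z := by
  refine ⟨fun hh => ?_, ?_⟩
  · have h1 := Word.eval_act_nil h⁻¹
    simp only [firstExit, Option.map_eq_none_iff, List.getLast?_eq_none_iff] at hh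
    rw [Word.eval, hh, List.map_nil, List.prod_nil, mul_one] at h1
    exact ⟨_, by rw [ofLattice_neg, h1, inv_inv]⟩
  · rintro ⟨z, rfl⟩
    exact firstExit_ofLattice z

theorem firstExit_mul_ofLattice (h : A) (z : ℤ × ℤ) : firstExit (h * ofLattice z) = firstExit h := by
  rw [firstExit, mul_inv_rev, ← ofLattice_neg, map_mul, Equiv.Perm.mul_apply, Word.act_ofLattice]
  rfl

theorem firstExit_ofLattice_mul_letter (z : ℤ × ℤ) (ε : Bool) :
    firstExit (ofLattice z * letter ε) = some (z, ε) := by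
  rw [firstExit, mul_inv_rev, ← ofLattice_neg, ← letter_not, map_mul, Equiv.Perm.mul_apply,
    Word.act_ofLattice, Word.act_letter]
  simp [Word.shift, Word.nil, Word.step]

/-- The letter changes the word of `h⁻¹` at the front only, and its last syllable survives unless
the list is empty before or after. -/
theorem firstExit_mul_letter {h : A} {ε : Bool} (h1 : firstExit h ≠ none)
    (h2 : firstExit (h * letter ε) ≠ none) : firstExit (h * letter ε) = firstExit h := by
  rw [firstExit, mul_inv_rev, ← letter_not, map_mul, Equiv.Perm.mul_apply, Word.act_letter] at h2 ⊢
  rw [firstExit] at h1 ⊢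
  congr 1
  generalize Word.act h⁻¹ Word.nil = w at h1 h2
  obtain ⟨⟨z, L⟩, hw⟩ := w
  cases L with
  | nil => simp at h1
  | cons a L =>
    by_cases hz : NotCancel (!ε, z) a
    · simp [Word.step, hz]
    · rw [Word.step, dif_neg hz] at h2 ⊢
      cases L with
      | nil => simp at h2
      | cons c L => simp

theorem firstExit_ofLattice_mul (z : ℤ × ℤ) (h : A) :
    firstExit (ofLattice z * h) = (firstExit h).map fun a => (z + a.1, a.2) := by
  induction h using induction_right with
  | one => rw [mul_one, firstExit_ofLattice, firstExit_one, Option.map_none]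
  | lat h w ih => rw [← mul_assoc, firstExit_mul_ofLattice, firstExit_mul_ofLattice, ih]
  | let_ h ε ih =>
    by_cases h1 : firstExit h = none
    · obtain ⟨w, rfl⟩ := firstExit_eq_none_iff.1 h1
      rw [← mul_assoc, ← ofLattice_add, firstExit_ofLattice_mul_letter, firstExit_ofLattice_mul_letter,
        Option.map_some]
    by_cases h2 : firstExit (h * letter ε) = none
    · obtain ⟨w, hw⟩ := firstExit_eq_none_iff.1 h2
      rw [hw, ← ofLattice_add, firstExit_ofLattice, firstExit_ofLattice, Option.map_none]
    rw [firstExit_mul_letter h1 h2, ← ih, ← mul_assoc]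
    refine firstExit_mul_letter (by rw [ih]; simpa using h1) fun h3 => h2 ?_
    obtain ⟨w, hw⟩ := firstExit_eq_none_iff.1 h3
    rw [mul_assoc, ← eq_inv_mul_iff_mul_eq, ← ofLattice_neg, ← ofLattice_add] at hw
    rw [hw, firstExit_ofLattice]

theorem firstExit_letter (ε : Bool) : firstExit (letter ε) = some (0, ε) := by
  simpa [ofLattice_zero] using firstExit_ofLattice_mul_letter 0 ε

theorem firstExit_letter_mul_ofLattice (ε : Bool) (z : ℤ × ℤ) :
    firstExit (letter ε * ofLattice z) = some (0, ε) := by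
  rw [firstExit_mul_ofLattice, firstExit_letter]

/-- An edge separates `A` into the elements beyond the one end and those beyond the other. -/
theorem firstExit_letter_mul_iff (ε : Bool) (h : A) :
    firstExit (letter ε * h) = some (0, ε) ↔ firstExit h ≠ some (0, !ε) := by
  induction h using induction_right with
  | one => simp [firstExit_letter, firstExit_one]
  | lat h z ih => rwa [← mul_assoc, firstExit_mul_ofLattice, firstExit_mul_ofLattice]
  | let_ h δ ih =>
    by_cases h1 : firstExit h = none
    · obtain ⟨z, rfl⟩ := firstExit_eq_none_iff.1 h1
      rw [firstExit_ofLattice_mul_letter, ← mul_assoc]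
      -- Falling back into `ℤ²` means crossing the same edge backwards, which forces `z = 0` and `δ
      -- = !ε`.
      by_cases h2 : firstExit (letter ε * ofLattice z * letter δ) = none
      · obtain ⟨w, hw⟩ := firstExit_eq_none_iff.1 h2
        have h3 := firstExit_letter_mul_ofLattice ε z
        rw [← eq_mul_inv_iff_mul_eq, ← letter_not] at hw
        rw [hw, firstExit_ofLattice_mul_letter, Option.some_inj, Prod.mk.injEq] at h3
        obtain ⟨rfl, rfl⟩ := h3
        rw [h2]
        rw [ofLattice_zero, one_mul] at hw
        have hz : ofLattice z = 1 := by simpa using hw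
        have hz0 : z = 0 := by
          have := firstExit_ofLattice_mul_letter z true
          rw [hz, one_mul, firstExit_letter] at this
          simpa using this.symm
        simp [hz0]
      · rw [firstExit_mul_letter (by rw [firstExit_letter_mul_ofLattice]; simp) h2,
          firstExit_letter_mul_ofLattice]
        simp only [ne_eq, Option.some_inj, Prod.mk.injEq, true_iff]
        rintro ⟨rfl, rfl⟩
        rw [ofLattice_zero, mul_one, letter_mul_letter_not, firstExit_one] at h2
        exact h2 rfl
    by_cases h2 : firstExit (h * letter δ) = none
    · obtain ⟨z, hz⟩ := firstExit_eq_none_iff.1 h2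
      rw [hz, firstExit_letter_mul_ofLattice, firstExit_ofLattice]
      simp
    rw [firstExit_mul_letter h1 h2, ← ih]
    by_cases h3 : firstExit (letter ε * h) = none
    · obtain ⟨w, hw⟩ := firstExit_eq_none_iff.1 h3
      rw [h3, ← mul_assoc, hw, firstExit_ofLattice_mul_letter]
      simp only [reduceCtorEq, iff_false, Option.some_inj, Prod.mk.injEq]
      rintro ⟨rfl, rfl⟩
      rw [ofLattice_zero, mul_eq_one_iff_eq_inv'] at hw
      rw [hw, inv_mul_cancel, firstExit_one] at h2
      exact h2 rfl
    by_cases h4 : firstExit (letter ε * h * letter δ) = none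
    · obtain ⟨w, hw⟩ := firstExit_eq_none_iff.1 h4
      have h5 : h * letter δ = letter (!ε) * ofLattice w := by
        rw [← hw, letter_not]
        group
      have h6 := firstExit_mul_letter h1 h2
      rw [h5, firstExit_letter_mul_ofLattice] at h6
      rw [← mul_assoc, h4, ih, ← h6]
      simp
    rw [← mul_assoc, firstExit_mul_letter h3 h4]

end TreeOfFlats

namespace TreeOfFlats

/-! ## Lipschitz maps on the tree of flats -/

theorem le_dist_of_chain {x y : Pre} {L : ℝ} (h : ∀ a, Chain x y a → L ≤ a) : L ≤ dist x y :=
  le_csInf (exists_chain x y) h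

theorem dist_mk_le {x y : Pre} {a : ℝ} (h : Chain x y a) :
    dist (SeparationQuotient.mk x) (SeparationQuotient.mk y) ≤ a := by
  rw [SeparationQuotient.dist_mk]
  exact preDist_le h

theorem mk_eq_mk {x y : Pre} (h : Chain x y 0) :
    SeparationQuotient.mk x = SeparationQuotient.mk y :=
  dist_le_zero.1 (dist_mk_le h)

/-- The point with coordinates `p` in the plane through `v`. -/
noncomputable def flatPt (v : A) (p : EuclideanSpace ℝ (Fin 2)) : Space :=
  SeparationQuotient.mk (.flat v p)

/-- The point at distance `t` from `g` on the edge from `g` to `g * g₃`. -/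
noncomputable def edgePt (g : A) (t : Icc (0 : ℝ) 1) : Space :=
  SeparationQuotient.mk (.edge g t)

theorem flatPt_zero (v : A) : flatPt v 0 = vertex v := rfl

theorem edgePt_zero (g : A) : edgePt g 0 = vertex g := mk_eq_mk (.glueStart g)

theorem edgePt_one (g : A) : edgePt g 1 = vertex (g * g₃) := mk_eq_mk (.glueEnd g)

theorem flatPt_mul_ofLattice (v : A) (z : ℤ × ℤ) (p : EuclideanSpace ℝ (Fin 2)) :
    flatPt (v * ofLattice z) p = flatPt v (latticePoint z + p) := mk_eq_mk (.glueFlat v z p)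

theorem vertex_mul_ofLattice (v : A) (z : ℤ × ℤ) :
    vertex (v * ofLattice z) = flatPt v (latticePoint z) := by
  rw [← flatPt_zero, flatPt_mul_ofLattice, add_zero]

theorem exists_rep (x : Space) : (∃ v p, x = flatPt v p) ∨ ∃ g t, x = edgePt g t := by
  obtain ⟨y, rfl⟩ := SeparationQuotient.surjective_mk x
  cases y with
  | flat v p => exact Or.inl ⟨v, p, rfl⟩
  | edge g t => exact Or.inr ⟨g, t, rfl⟩

/-! ### Maps out of the glued space -/

section Lift

variable {Y : Type*} [MetricSpace Y]

/-- A map on the planes and edges that is `1`-Lipschitz on each and respects the gluing. -/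
structure IsCompatible (F : Pre → Y) : Prop where
  flat : ∀ g p q, dist (F (.flat g p)) (F (.flat g q)) ≤ dist p q
  edge : ∀ g s t, dist (F (.edge g s)) (F (.edge g t)) ≤ dist s t
  glueFlat : ∀ g z p, F (.flat (g * ofLattice z) p) = F (.flat g (latticePoint z + p))
  glueStart : ∀ g, F (.edge g 0) = F (.flat g 0)
  glueEnd : ∀ g, F (.edge g 1) = F (.flat (g * g₃) 0)

variable {F : Pre → Y}

/-- No elementary move of a chain is lengthened. Compatible maps thus give lower bounds for the
length metric, in particular that edges and planes are isometrically embedded. -/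
theorem IsCompatible.dist_le_of_chain (hF : IsCompatible F) {x y : Pre} {a : ℝ}
    (h : Chain x y a) : dist (F x) (F y) ≤ a := by
  induction h with
  | refl => exact (dist_self _).le
  | inFlat => exact hF.flat _ _ _
  | inEdge => exact hF.edge _ _ _
  | glueFlat => exact (dist_eq_zero.2 (hF.glueFlat _ _ _)).le
  | glueStart => exact (dist_eq_zero.2 (hF.glueStart _)).le
  | glueEnd => exact (dist_eq_zero.2 (hF.glueEnd _)).le
  | symm _ ih => rwa [dist_comm]
  | trans _ _ ih₁ ih₂ => exact (dist_triangle _ _ _).trans (add_le_add ih₁ ih₂)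

theorem IsCompatible.dist_le (hF : IsCompatible F) (x y : Pre) :
    dist (F x) (F y) ≤ dist x y :=
  le_dist_of_chain fun _ => hF.dist_le_of_chain

/-- The map on the tree of flats induced by a compatible map. -/
noncomputable def IsCompatible.lift (hF : IsCompatible F) : Space → Y :=
  SeparationQuotient.lift F fun x y h =>
    dist_le_zero.1 ((hF.dist_le x y).trans_eq (Metric.inseparable_iff.1 h))

theorem IsCompatible.dist_lift_le (hF : IsCompatible F) (x y : Space) :
    dist (hF.lift x) (hF.lift y) ≤ dist x y := by
  obtain ⟨x, rfl⟩ := SeparationQuotient.surjective_mk x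
  obtain ⟨y, rfl⟩ := SeparationQuotient.surjective_mk y
  exact hF.dist_le x y

end Lift

theorem latticePoint_zero : latticePoint 0 = 0 := by
  ext i
  fin_cases i <;> simp [latticePoint]

theorem latticePoint_add (z w : ℤ × ℤ) :
    latticePoint (z + w) = latticePoint z + latticePoint w := by
  ext i
  fin_cases i <;> simp [latticePoint]

/-! ### The height -/

/-- The exponent sum of `g₃`. -/
def exponentSum (h : A) : ℤ := (Monoid.Coprod.snd h).toAdd

theorem exponentSum_mul_ofLattice (h : A) (z : ℤ × ℤ) :
    exponentSum (h * ofLattice z) = exponentSum h := by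
  simp [exponentSum, ofLattice]

theorem exponentSum_mul_g₃ (h : A) : exponentSum (h * g₃) = exponentSum h + 1 := by
  simp [exponentSum, g₃]

/-- The height before gluing. -/
def preHeight : Pre → ℝ
  | .flat h _ => exponentSum h
  | .edge h t => exponentSum h + t

theorem isCompatible_preHeight : IsCompatible preHeight where
  flat g p q := by simp [preHeight]
  edge g s t := by simp [preHeight, Subtype.dist_eq]
  glueFlat g z p := by simp [preHeight, exponentSum_mul_ofLattice]
  glueStart g := by simp [preHeight]
  glueEnd g := by simp [preHeight, exponentSum_mul_g₃]

/-- The height is `1`-Lipschitz and is isometric along each edge. -/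
theorem dist_edgePt (g : A) (s t : Icc (0 : ℝ) 1) :
    dist (edgePt g s) (edgePt g t) = dist s t := by
  refine le_antisymm (dist_mk_le (.inEdge g s t)) ?_
  have h := isCompatible_preHeight.dist_lift_le (edgePt g s) (edgePt g t)
  change dist (preHeight (.edge g s)) (preHeight (.edge g t)) ≤ _ at h
  simpa [preHeight, Subtype.dist_eq] using h

/-! ### The retraction to a flat -/

/-- The element of `ℤ²` at which `h` leaves `ℤ²`. -/
def exitPoint (h : A) : ℤ × ℤ :=
  match firstExit h with
  | none => (Monoid.Coprod.fst h).toAdd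
  | some a => a.1

theorem exitPoint_ofLattice (z : ℤ × ℤ) : exitPoint (ofLattice z) = z := by
  rw [exitPoint, firstExit_ofLattice]
  simp [ofLattice]

theorem exitPoint_of_firstExit {h : A} {a : (ℤ × ℤ) × Bool} (ha : firstExit h = some a) :
    exitPoint h = a.1 := by
  rw [exitPoint, ha]

theorem firstExit_mul_g₃ (h : A) :
    (∃ z, h = ofLattice z) ∨ (∃ z, h * g₃ = ofLattice z) ∨ firstExit (h * g₃) = firstExit h := by
  by_cases h1 : firstExit h = none
  · exact Or.inl (firstExit_eq_none_iff.1 h1)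
  by_cases h2 : firstExit (h * g₃) = none
  · exact Or.inr (Or.inl (firstExit_eq_none_iff.1 h2))
  · exact Or.inr (Or.inr (firstExit_mul_letter (ε := true) h1 h2))

theorem firstExit_of_mul_g₃ {h : A} {z : ℤ × ℤ} (hz : h * g₃ = ofLattice z) :
    firstExit h = some (z, false) := by
  rw [← eq_mul_inv_iff_mul_eq] at hz
  rw [hz]
  exact firstExit_ofLattice_mul_letter z false

theorem firstExit_ofLattice_mul_g₃ (z : ℤ × ℤ) :
    firstExit (ofLattice z * g₃) = some (z, true) :=
  firstExit_ofLattice_mul_letter z true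

/-- An edge either has an end in the flat, which is then also the exit point of its other end, or
lies wholly beyond one exit. Hence collapsing branches to their attaching vertices respects the
gluing. -/
theorem exitPoint_mul_g₃ (h : A) : exitPoint (h * g₃) = exitPoint h := by
  rcases firstExit_mul_g₃ h with ⟨z, rfl⟩ | ⟨z, hz⟩ | he
  · rw [exitPoint_ofLattice, exitPoint_of_firstExit (firstExit_ofLattice_mul_g₃ z)]
  · rw [hz, exitPoint_ofLattice, exitPoint_of_firstExit (firstExit_of_mul_g₃ hz)]
  · by_cases hn : firstExit h = none
    · obtain ⟨z, rfl⟩ := firstExit_eq_none_iff.1 hn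
      rw [hn, firstExit_ofLattice_mul_g₃] at he
      exact absurd he (by simp)
    · obtain ⟨a, ha⟩ := Option.ne_none_iff_exists'.1 hn
      rw [exitPoint_of_firstExit ha, exitPoint_of_firstExit (he.trans ha)]

open Classical in
/-- The retraction to the flat through `v`, in coordinates centred at `v`, before gluing. -/
noncomputable def preRetract (v : A) : Pre → EuclideanSpace ℝ (Fin 2)
  | .flat h p => latticePoint (exitPoint (v⁻¹ * h)) + if firstExit (v⁻¹ * h) = none then p else 0
  | .edge h _ => latticePoint (exitPoint (v⁻¹ * h))

theorem isCompatible_preRetract (v : A) : IsCompatible (preRetract v) where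
  flat g p q := by
    by_cases h : firstExit (v⁻¹ * g) = none <;> simp [preRetract, h]
  edge g s t := by simp [preRetract]
  glueFlat g z p := by
    by_cases h : firstExit (v⁻¹ * g) = none
    · obtain ⟨w, hw⟩ := firstExit_eq_none_iff.1 h
      simp only [preRetract, ← mul_assoc]
      rw [hw, ← ofLattice_add]
      simp [firstExit_ofLattice, exitPoint_ofLattice, latticePoint_add, add_assoc]
    · obtain ⟨a, ha⟩ := Option.ne_none_iff_exists'.1 h
      have ha' : firstExit (v⁻¹ * g * ofLattice z) = some a := by rw [firstExit_mul_ofLattice, ha]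
      simp only [preRetract, ← mul_assoc]
      rw [exitPoint_of_firstExit ha, exitPoint_of_firstExit ha', ha, ha']
      simp
  glueStart g := by simp [preRetract]
  glueEnd g := by simp [preRetract, ← mul_assoc, exitPoint_mul_g₃]

/-- The retraction of the tree of flats to the flat through `v`. -/
noncomputable def retract (v : A) : Space → EuclideanSpace ℝ (Fin 2) :=
  (isCompatible_preRetract v).lift

theorem dist_retract_le (v : A) (x y : Space) : dist (retract v x) (retract v y) ≤ dist x y :=
  (isCompatible_preRetract v).dist_lift_le x y

theorem continuous_retract (v : A) : Continuous (retract v) :=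
  (LipschitzWith.of_dist_le_mul (K := 1) fun x y => by
    simpa using dist_retract_le v x y).continuous

theorem retract_flatPt (v : A) (p : EuclideanSpace ℝ (Fin 2)) : retract v (flatPt v p) = p := by
  change preRetract v (.flat v p) = p
  have := exitPoint_ofLattice 0
  rw [ofLattice_zero] at this
  simp [preRetract, firstExit_one, this, latticePoint_zero]

/-- The retraction is a `1`-Lipschitz left inverse of the inclusion of the flat. -/
theorem dist_flatPt (v : A) (p q : EuclideanSpace ℝ (Fin 2)) :
    dist (flatPt v p) (flatPt v q) = dist p q := by
  refine le_antisymm (dist_mk_le (.inFlat v p q)) ?_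
  simpa [retract_flatPt] using dist_retract_le v (flatPt v p) (flatPt v q)

/-! ### Regions -/

/-- The indicator function of a set of vertices, extended affinely to the edges. -/
noncomputable def preInterp (V : Set A) : Pre → ℝ
  | .flat h _ => V.indicator 1 h
  | .edge h t => (1 - t) * V.indicator 1 h + t * V.indicator 1 (h * g₃)

theorem isCompatible_preInterp {V : Set A} (hV : ∀ h z, h * ofLattice z ∈ V ↔ h ∈ V) :
    IsCompatible (preInterp V) where
  flat g p q := by simp [preInterp]
  edge g s t := by
    have h : |V.indicator (1 : A → ℝ) (g * g₃) - V.indicator 1 g| ≤ 1 := by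
      by_cases h1 : g ∈ V <;> by_cases h2 : g * g₃ ∈ V <;> simp [h1, h2]
    rw [Subtype.dist_eq, Real.dist_eq, Real.dist_eq]
    have : preInterp V (.edge g s) - preInterp V (.edge g t) =
        (s - t : ℝ) * (V.indicator (1 : A → ℝ) (g * g₃) - V.indicator 1 g) := by
      simp only [preInterp]
      ring
    rw [this, abs_mul]
    exact mul_le_of_le_one_right (abs_nonneg _) h
  glueFlat g z p := by
    by_cases h : g ∈ V
    · have h' := (hV g z).2 h
      simp [preInterp, h, h']
    · have h' : g * ofLattice z ∉ V := fun hh => h ((hV g z).1 hh)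
      simp [preInterp, h, h']
  glueStart g := by simp [preInterp]
  glueEnd g := by simp [preInterp]

theorem preInterp_edge_pos_iff {V : Set A} {h : A} {t : Icc (0 : ℝ) 1} :
    0 < preInterp V (.edge h t) ↔ (t ≠ 1 ∧ h ∈ V) ∨ (t ≠ 0 ∧ h * g₃ ∈ V) := by
  have h0 := t.2.1
  have h1 := t.2.2
  have e1 : t ≠ 1 ↔ (t : ℝ) < 1 := by
    rw [lt_iff_le_and_ne, Ne, ← Subtype.coe_inj]
    simp [h1]
  have e0 : t ≠ 0 ↔ 0 < (t : ℝ) := by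
    rw [lt_iff_le_and_ne, Ne, ← Subtype.coe_inj]
    simp [h0, eq_comm]
  rw [e1, e0]
  by_cases hV : h ∈ V <;> by_cases hV' : h * g₃ ∈ V <;> simp [preInterp, hV, hV']
  by_contra! hc
  have : (1 : ℝ) ≤ 0 := Subtype.coe_le_coe.2 (hc.1.trans hc.2)
  linarith

theorem preInterp_flat_pos_iff {V : Set A} {h : A} {p : EuclideanSpace ℝ (Fin 2)} :
    0 < preInterp V (.flat h p) ↔ h ∈ V := by
  by_cases hV : h ∈ V <;> simp [preInterp, hV]

/-- A chain can change sides only inside an edge with exactly one end in `V`. Its other end is `w`,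
so that move already runs through `w`. Both directions are proved together because reversing a chain
exchanges them. -/
theorem dist_add_dist_le_of_chain {V : Set A} (hV : ∀ h z, h * ofLattice z ∈ V ↔ h ∈ V) {w : A}
    (hw : ∀ h, h ∈ V → h * g₃ ∉ V → h * g₃ = w) (hw' : ∀ h, h ∉ V → h * g₃ ∈ V → h = w)
    {x y : Pre} {a : ℝ} (h : Chain x y a) :
    (¬ 0 < preInterp V x → 0 < preInterp V y → dist x (.flat w 0) + dist (.flat w 0) y ≤ a) ∧
    (0 < preInterp V x → ¬ 0 < preInterp V y →
      dist x (.flat w 0) + dist (.flat w 0) y ≤ a) := by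
  have comp := isCompatible_preInterp hV
  have edge : ∀ (g : A) (s t : Icc (0 : ℝ) 1), ¬ 0 < preInterp V (.edge g s) →
      0 < preInterp V (.edge g t) → dist (Pre.edge g s) (.flat w 0) +
      dist (.flat w 0) (Pre.edge g t) ≤ dist s t := by
    intro g s t hs ht
    rw [preInterp_edge_pos_iff] at hs ht
    by_cases h1 : g ∈ V <;> by_cases h2 : g * g₃ ∈ V
    · simp only [h1, h2, and_true, not_or, not_not] at hs
      exact absurd (hs.1.symm.trans hs.2) (by simp)
    · simp only [h1, h2, and_true, and_false, or_false, not_not] at hs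
      subst hs
      obtain rfl := hw g h1 h2
      have h3 : dist (Pre.edge g 1) (.flat (g * g₃) 0) ≤ 0 := preDist_le (.glueEnd g)
      have h4 : dist (Pre.flat (g * g₃) 0) (.edge g t) ≤ 0 + dist 1 t :=
        preDist_le ((Chain.glueEnd g).symm.trans (.inEdge g 1 t))
      linarith
    · simp only [h1, h2, and_true, and_false, false_or, not_not] at hs
      subst hs
      obtain rfl := hw' g h1 h2
      have h3 : dist (Pre.edge g 0) (.flat g 0) ≤ 0 := preDist_le (.glueStart g)
      have h4 : dist (Pre.flat g 0) (.edge g t) ≤ 0 + dist 0 t :=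
        preDist_le ((Chain.glueStart g).symm.trans (.inEdge g 0 t))
      linarith
    · simp [h1, h2] at ht
  induction h with
  | refl => exact ⟨fun h1 h2 => absurd h2 h1, fun h1 h2 => absurd h1 h2⟩
  | inFlat g p q =>
    simp only [preInterp_flat_pos_iff]
    exact ⟨fun h1 h2 => absurd h2 h1, fun h1 h2 => absurd h1 h2⟩
  | inEdge g s t =>
    refine ⟨edge g s t, fun h1 h2 => ?_⟩
    have := edge g t s h2 h1
    rw [dist_comm (Pre.edge g s), dist_comm _ (Pre.edge g t), dist_comm s t]
    linarith
  | glueFlat g z p =>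
    rw [comp.glueFlat]
    exact ⟨fun h1 h2 => absurd h2 h1, fun h1 h2 => absurd h1 h2⟩
  | glueStart g =>
    rw [comp.glueStart]
    exact ⟨fun h1 h2 => absurd h2 h1, fun h1 h2 => absurd h1 h2⟩
  | glueEnd g =>
    rw [comp.glueEnd]
    exact ⟨fun h1 h2 => absurd h2 h1, fun h1 h2 => absurd h1 h2⟩
  | @symm x y a _ ih =>
    rw [dist_comm y, dist_comm _ x, add_comm]
    exact ⟨fun h1 h2 => ih.2 h2 h1, fun h1 h2 => ih.1 h2 h1⟩
  | @trans x y z a b hxy hyz ih₁ ih₂ =>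
    have h3 : dist x y ≤ a := preDist_le hxy
    have h4 : dist y z ≤ b := preDist_le hyz
    have h5 := dist_triangle x y (.flat w 0)
    have h6 := dist_triangle (.flat w 0) y z
    -- The side of the intermediate point decides which of the two partial chains crosses.
    by_cases hy : 0 < preInterp V y
    · exact ⟨fun h1 _ => by linarith [ih₁.1 h1 hy], fun _ h2 => by linarith [ih₂.2 hy h2]⟩
    · exact ⟨fun _ h2 => by linarith [ih₂.1 hy h2], fun h1 _ => by linarith [ih₁.2 h1 hy]⟩

/-- The vertices beyond the edge that leaves the flat through `v` at `v * z` in the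
direction `ε`. -/
def branchVertices (v : A) (z : ℤ × ℤ) (ε : Bool) : Set A :=
  {h | firstExit (v⁻¹ * h) = some (z, ε)}

theorem mul_ofLattice_mem_branchVertices (v : A) (z : ℤ × ℤ) (ε : Bool) (h : A) (w : ℤ × ℤ) :
    h * ofLattice w ∈ branchVertices v z ε ↔ h ∈ branchVertices v z ε := by
  simp only [branchVertices, mem_ofPred_eq]
  rw [← mul_assoc, firstExit_mul_ofLattice]

/-- The first exit changes along an edge only where the edge touches the flat, hence at the exit
point. -/
theorem branchVertices_mul_g₃_eq {v : A} {z : ℤ × ℤ} {ε : Bool} {h : A}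
    (h1 : h ∈ branchVertices v z ε) (h2 : h * g₃ ∉ branchVertices v z ε) :
    h * g₃ = v * ofLattice z := by
  simp only [branchVertices, mem_ofPred_eq] at h1 h2
  rw [← mul_assoc] at h2
  rcases firstExit_mul_g₃ (v⁻¹ * h) with ⟨w, hw⟩ | ⟨w, hw⟩ | he
  · rw [hw, firstExit_ofLattice] at h1
    exact absurd h1 (by simp)
  · rw [firstExit_of_mul_g₃ hw, Option.some_inj, Prod.mk.injEq] at h1
    rw [← h1.1, ← hw]
    group
  · exact absurd (he.trans h1) h2

theorem branchVertices_eq {v : A} {z : ℤ × ℤ} {ε : Bool} {h : A}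
    (h1 : h ∉ branchVertices v z ε) (h2 : h * g₃ ∈ branchVertices v z ε) :
    h = v * ofLattice z := by
  simp only [branchVertices, mem_ofPred_eq] at h1 h2
  rw [← mul_assoc] at h2
  rcases firstExit_mul_g₃ (v⁻¹ * h) with ⟨w, hw⟩ | ⟨w, hw⟩ | he
  · rw [hw, firstExit_ofLattice_mul_g₃, Option.some_inj, Prod.mk.injEq] at h2
    rw [← h2.1, ← hw]
    group
  · rw [hw, firstExit_ofLattice] at h2
    exact absurd h2 (by simp)
  · exact absurd (he.symm.trans h2) h1

/-- The branch of the tree of flats that is attached to the flat through `v` at the vertex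
`v * z` by the edge in the direction `ε`, without this vertex. -/
def branch (v : A) (z : ℤ × ℤ) (ε : Bool) : Set Space :=
  {x | 0 < (isCompatible_preInterp (mul_ofLattice_mem_branchVertices v z ε)).lift x}

theorem flatPt_mem_branch {v h : A} {z : ℤ × ℤ} {ε : Bool} {p : EuclideanSpace ℝ (Fin 2)} :
    flatPt h p ∈ branch v z ε ↔ firstExit (v⁻¹ * h) = some (z, ε) :=
  preInterp_flat_pos_iff (V := branchVertices v z ε) (p := p)

theorem vertex_mem_branch {v h : A} {z : ℤ × ℤ} {ε : Bool} :
    vertex h ∈ branch v z ε ↔ firstExit (v⁻¹ * h) = some (z, ε) :=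
  flatPt_mem_branch (p := 0)

theorem edgePt_mem_branch {v h : A} {z : ℤ × ℤ} {ε : Bool} {t : Icc (0 : ℝ) 1} :
    edgePt h t ∈ branch v z ε ↔
      (t ≠ 1 ∧ h ∈ branchVertices v z ε) ∨ (t ≠ 0 ∧ h * g₃ ∈ branchVertices v z ε) :=
  preInterp_edge_pos_iff (V := branchVertices v z ε)

theorem flatPt_notMem_branch (v : A) (z : ℤ × ℤ) (ε : Bool) (p : EuclideanSpace ℝ (Fin 2)) :
    flatPt v p ∉ branch v z ε := by
  rw [flatPt_mem_branch, inv_mul_cancel, firstExit_one]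
  simp

theorem isGate_branch (v : A) (z : ℤ × ℤ) (ε : Bool) :
    IsGate (vertex (v * ofLattice z)) (branch v z ε) := by
  intro x hx y hy
  obtain ⟨x, rfl⟩ := SeparationQuotient.surjective_mk x
  obtain ⟨y, rfl⟩ := SeparationQuotient.surjective_mk y
  exact le_dist_of_chain fun a ha =>
    (dist_add_dist_le_of_chain (mul_ofLattice_mem_branchVertices v z ε)
      (fun _ => branchVertices_mul_g₃_eq) (fun _ => branchVertices_eq) ha).1 hx hy

/-- An edge with ends in different branches would have an end on the flat, which belongs to no
branch. -/
theorem branch_inj {v : A} {z z' : ℤ × ℤ} {ε ε' : Bool} {x : Space} (h : x ∈ branch v z ε)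
    (h' : x ∈ branch v z' ε') : (z, ε) = (z', ε') := by
  have hd : ∀ g, g ∈ branchVertices v z ε → g ∈ branchVertices v z' ε' → (z, ε) = (z', ε') :=
    fun g h1 h2 => Option.some_inj.1 ((Eq.symm h1).trans h2)
  have hn : ∀ z ε w, v * ofLattice w ∉ branchVertices v z ε := fun z ε w hm => by
    rw [branchVertices, mem_ofPred_eq, inv_mul_cancel_left, firstExit_ofLattice] at hm
    simp at hm
  rcases exists_rep x with ⟨g, p, rfl⟩ | ⟨g, t, rfl⟩
  · rw [flatPt_mem_branch] at h h'
    exact hd g h h'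
  · rw [edgePt_mem_branch] at h h'
    by_contra hne
    rcases h with ⟨-, h⟩ | ⟨-, h⟩ <;> rcases h' with ⟨-, h'⟩ | ⟨-, h'⟩
    · exact hne (hd _ h h')
    · have h1 : g * g₃ ∉ branchVertices v z ε := fun hh => hne (hd _ hh h')
      rw [branchVertices_mul_g₃_eq h h1] at h'
      exact hn _ _ _ h'
    · have h1 : g ∉ branchVertices v z ε := fun hh => hne (hd _ hh h')
      rw [branchVertices_eq h1 h] at h'
      exact hn _ _ _ h'
    · exact hne (hd _ h h')

theorem exists_flatPt_or_mem_branch (v : A) (x : Space) :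
    (∃ p, x = flatPt v p) ∨ ∃ z ε, x ∈ branch v z ε := by
  have key : ∀ h p, (∃ p', flatPt h p = flatPt v p') ∨ ∃ z ε, flatPt h p ∈ branch v z ε := by
    intro h p
    by_cases h1 : firstExit (v⁻¹ * h) = none
    · obtain ⟨z, hz⟩ := firstExit_eq_none_iff.1 h1
      refine Or.inl ⟨latticePoint z + p, ?_⟩
      rw [← flatPt_mul_ofLattice, ← hz, mul_inv_cancel_left]
    · obtain ⟨⟨z, ε⟩, ha⟩ := Option.ne_none_iff_exists'.1 h1
      exact Or.inr ⟨z, ε, flatPt_mem_branch.2 ha⟩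
  rcases exists_rep x with ⟨h, p, rfl⟩ | ⟨h, t, rfl⟩
  · exact key h p
  · by_cases h0 : t = 0
    · subst h0
      rw [edgePt_zero]
      exact key h 0
    by_cases h1 : t = 1
    · subst h1
      rw [edgePt_one]
      exact key _ 0
    right
    by_cases h2 : firstExit (v⁻¹ * h) = none
    · obtain ⟨z, hz⟩ := firstExit_eq_none_iff.1 h2
      refine ⟨z, true, edgePt_mem_branch.2 (Or.inr ⟨h0, ?_⟩)⟩
      rw [branchVertices, mem_ofPred_eq, ← mul_assoc, hz, firstExit_ofLattice_mul_g₃]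
    · obtain ⟨⟨z, ε⟩, ha⟩ := Option.ne_none_iff_exists'.1 h2
      exact ⟨z, ε, edgePt_mem_branch.2 (Or.inl ⟨h1, ha⟩)⟩

theorem retract_of_mem_branch {v : A} {z : ℤ × ℤ} {ε : Bool} {x : Space}
    (hx : x ∈ branch v z ε) : retract v x = latticePoint z := by
  rcases exists_rep x with ⟨h, p, rfl⟩ | ⟨h, t, rfl⟩
  · rw [flatPt_mem_branch] at hx
    change preRetract v (.flat h p) = _
    simp [preRetract, exitPoint_of_firstExit hx, hx]
  · rw [edgePt_mem_branch] at hx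
    change preRetract v (.edge h t) = _
    rcases hx with ⟨-, hx⟩ | ⟨-, hx⟩
    · simp [preRetract, exitPoint_of_firstExit hx]
    · rw [branchVertices, mem_ofPred_eq, ← mul_assoc] at hx
      simp [preRetract, ← exitPoint_mul_g₃ (v⁻¹ * h), exitPoint_of_firstExit hx]

/-! ### Adjacent flats -/

/-- The two sides of an edge. -/
theorem mem_branchVertices_iff (u : A) (z : ℤ × ℤ) (ε : Bool) (h : A) :
    h ∈ branchVertices u z ε ↔
      h ∉ branchVertices (u * ofLattice z * letter ε) 0 (!ε) := by
  have h1 := firstExit_letter_mul_iff ε ((u * ofLattice z * letter ε)⁻¹ * h)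
  have h2 := firstExit_ofLattice_mul z (letter ε * ((u * ofLattice z * letter ε)⁻¹ * h))
  have h3 : ofLattice z * (letter ε * ((u * ofLattice z * letter ε)⁻¹ * h)) = u⁻¹ * h := by
    group
  rw [h3] at h2
  simp only [branchVertices, mem_ofPred_eq]
  rw [← ne_eq, ← h1, h2]
  generalize firstExit (letter ε * ((u * ofLattice z * letter ε)⁻¹ * h)) = a
  cases a with
  | none => simp
  | some a =>
    obtain ⟨a1, a2⟩ := a
    simp

theorem vertex_mem_branch_or (u : A) (z : ℤ × ℤ) (ε : Bool) {h : A}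
    (hh : vertex h ∉ branch u z ε) :
    vertex h ∈ branch (u * ofLattice z * letter ε) 0 (!ε) := by
  rw [vertex_mem_branch] at hh ⊢
  by_contra hc
  exact hh ((mem_branchVertices_iff u z ε h).2 hc)

/-- Seen from the flat at the far end of an edge, every branch except the one leading back lies
across the edge; this makes the branches of a reduced word nested. -/
theorem branch_subset_branch (u : A) (z : ℤ × ℤ) (ε : Bool) {z' : ℤ × ℤ} {ε' : Bool}
    (hne : (z', ε') ≠ (0, !ε)) :
    branch (u * ofLattice z * letter ε) z' ε' ⊆ branch u z ε := by
  have hV : branchVertices (u * ofLattice z * letter ε) z' ε' ⊆ branchVertices u z ε := by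
    intro h hh
    rw [mem_branchVertices_iff]
    exact fun hc => hne (Option.some_inj.1 ((Eq.symm hh).trans hc))
  intro x hx
  rcases exists_rep x with ⟨h, p, rfl⟩ | ⟨h, t, rfl⟩
  · rw [flatPt_mem_branch] at hx ⊢
    exact hV hx
  · rw [edgePt_mem_branch] at hx ⊢
    exact hx.imp (And.imp_right fun h => hV h) (And.imp_right fun h => hV h)

/-- The branches on the two sides of an edge overlap only inside this edge, so an unbounded ray
cannot stay in both. -/
theorem dist_vertex_le_one {u : A} {z : ℤ × ℤ} {ε : Bool} {x : Space} (hx : x ∈ branch u z ε)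
    (hx' : x ∈ branch (u * ofLattice z * letter ε) 0 (!ε)) :
    dist x (vertex (u * ofLattice z)) ≤ 1 := by
  have hV := mem_branchVertices_iff u z ε
  have hd : ∀ s t : Icc (0 : ℝ) 1, dist s t ≤ 1 := fun s t => by
    rw [Subtype.dist_eq, Real.dist_eq, abs_le]
    constructor <;> linarith [s.2.1, s.2.2, t.2.1, t.2.2]
  rcases exists_rep x with ⟨h, p, rfl⟩ | ⟨h, t, rfl⟩
  · rw [flatPt_mem_branch] at hx hx'
    exact absurd hx' ((hV h).1 hx)
  · rw [edgePt_mem_branch] at hx hx'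
    rcases hx with ⟨-, hx⟩ | ⟨-, hx⟩ <;> rcases hx' with ⟨-, hx'⟩ | ⟨-, hx'⟩
    · exact absurd hx' ((hV h).1 hx)
    · rw [← branchVertices_mul_g₃_eq hx fun hc => (hV _).1 hc hx', ← edgePt_one, dist_edgePt]
      exact hd _ _
    · rw [← branchVertices_eq (fun hc => (hV _).1 hc hx') hx, ← edgePt_zero, dist_edgePt]
      exact hd _ _
    · exact absurd hx' ((hV _).1 hx)

/-! ### Geodesics -/

theorem isJoined_flatPt (v : A) (p q : EuclideanSpace ℝ (Fin 2)) :
    IsJoined (flatPt v p) (flatPt v q) := by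
  refine ⟨fun s => flatPt v (p + (s / dist p q) • (q - p)), ?_, by simp, ?_⟩
  · refine LipschitzWith.of_dist_le_mul fun s t => ?_
    rw [dist_flatPt, dist_add_left, dist_eq_norm, ← sub_smul, norm_smul, NNReal.coe_one, one_mul,
      ← sub_div, norm_div, ← dist_eq_norm q p, dist_comm q p, Real.norm_eq_abs,
      Real.norm_of_nonneg dist_nonneg, Real.dist_eq]
    by_cases h : dist p q = 0
    · simp [h]
    · rw [div_mul_cancel₀ _ h]
  · rw [dist_flatPt]
    by_cases h : dist p q = 0
    · simp [dist_eq_zero.1 h]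
    · simp [div_self h]

theorem dist_vertex_letter (u : A) (ε : Bool) : dist (vertex u) (vertex (u * letter ε)) = 1 := by
  have key : ∀ u, dist (vertex u) (vertex (u * g₃)) = 1 := fun u => by
    rw [← edgePt_zero, ← edgePt_one, dist_edgePt, Subtype.dist_eq]
    simp
  cases ε
  · have := key (u * g₃⁻¹)
    rw [inv_mul_cancel_right, dist_comm] at this
    exact this
  · exact key u

theorem isJoined_symm {x y : Space} (h : IsJoined x y) : IsJoined y x := by
  obtain ⟨f, hf, hf0, hf1⟩ := h
  refine ⟨fun s => f (dist x y - s), LipschitzWith.of_dist_le_mul fun s t => ?_, ?_, ?_⟩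
  · have := hf.dist_le_mul (dist x y - s) (dist x y - t)
    rwa [dist_sub_left] at this
  · simpa using hf1
  · simpa [dist_comm y x] using hf0

theorem isJoined_vertex_letter (u : A) (ε : Bool) :
    IsJoined (vertex u) (vertex (u * letter ε)) := by
  have key : ∀ u, IsJoined (vertex u) (vertex (u * g₃)) := fun u => by
    refine ⟨fun s => edgePt u (projIcc 0 1 zero_le_one s), ?_, ?_, ?_⟩
    · refine LipschitzWith.of_dist_le_mul fun s t => ?_
      rw [dist_edgePt]
      exact (LipschitzWith.projIcc zero_le_one).dist_le_mul s t
    · change edgePt u (projIcc 0 1 zero_le_one 0) = _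
      rw [projIcc_left]
      exact edgePt_zero u
    · have h1 : dist (vertex u) (vertex (u * g₃)) = 1 := dist_vertex_letter u true
      change edgePt u (projIcc 0 1 zero_le_one (dist (vertex u) (vertex (u * g₃)))) = _
      rw [h1, projIcc_right]
      exact edgePt_one u
  cases ε
  · have := key (u * g₃⁻¹)
    rw [inv_mul_cancel_right] at this
    exact isJoined_symm this
  · exact key u

theorem dist_vertex_mul_ofLattice (v : A) (z : ℤ × ℤ) :
    dist (vertex v) (vertex (v * ofLattice z)) = ‖latticePoint z‖ := by
  rw [vertex_mul_ofLattice, ← flatPt_zero, dist_flatPt, dist_zero_left]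

theorem isJoined_vertex_mul_ofLattice (v : A) (z : ℤ × ℤ) :
    IsJoined (vertex v) (vertex (v * ofLattice z)) := by
  rw [vertex_mul_ofLattice, ← flatPt_zero]
  exact isJoined_flatPt v _ _

/-- The far end of the edge is a gate: `vertex u` lies in the branch leading back and the target on
the flat does not, so the lengths add. -/
theorem dist_vertex_letter_mul_ofLattice (u : A) (ε : Bool) (z : ℤ × ℤ) :
    dist (vertex u) (vertex (u * letter ε * ofLattice z)) = 1 + ‖latticePoint z‖ := by
  have h1 := dist_triangle (vertex u) (vertex (u * letter ε)) (vertex (u * letter ε * ofLattice z))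
  have h2 := isGate_branch (u * letter ε) 0 (!ε) (vertex (u * letter ε * ofLattice z))
    (by rw [vertex_mul_ofLattice]; exact flatPt_notMem_branch _ _ _ _) (vertex u)
    (by
      rw [vertex_mem_branch]
      have : (u * letter ε)⁻¹ * u = letter (!ε) := by
        rw [letter_not]
        group
      rw [this, firstExit_letter])
  rw [ofLattice_zero, mul_one] at h2
  rw [dist_comm _ (vertex (u * letter ε)), dist_comm _ (vertex u),
    dist_comm _ (vertex u)] at h2
  rw [dist_vertex_letter, dist_vertex_mul_ofLattice] at h1 h2
  linarith

theorem isJoined_vertex_letter_mul_ofLattice (u : A) (ε : Bool) (z : ℤ × ℤ) :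
    IsJoined (vertex u) (vertex (u * letter ε * ofLattice z)) := by
  refine (isJoined_vertex_letter u ε).trans (isJoined_vertex_mul_ofLattice _ z) ?_
  rw [dist_vertex_letter_mul_ofLattice, dist_vertex_letter, dist_vertex_mul_ofLattice]

end TreeOfFlats

namespace TreeOfFlats

/-! ## Infinite words -/

/-- The end points of the edges that are crossed by the infinite word
`g * z₀ * g₃ ^ ε₀ * z₁ * g₃ ^ ε₁ * ⋯`. -/
def wordVertex (g : A) (w : ℕ → (ℤ × ℤ) × Bool) : ℕ → A
  | 0 => g
  | n + 1 => wordVertex g w n * ofLattice (w n).1 * letter (w n).2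

/-- The base-point, followed by the starting points of the edges crossed by an infinite word. -/
noncomputable def wordGate (g : A) (w : ℕ → (ℤ × ℤ) × Bool) : ℕ → Space
  | 0 => vertex g
  | n + 1 => vertex (wordVertex g w n * ofLattice (w n).1)

/-- The branches into which an infinite word leads. -/
def wordBranch (g : A) (w : ℕ → (ℤ × ℤ) × Bool) : ℕ → Set Space
  | 0 => Set.univ
  | n + 1 => branch (wordVertex g w n) (w n).1 (w n).2

/-- The infinite word `w` is reduced. -/
def IsReducedWord (w : ℕ → (ℤ × ℤ) × Bool) : Prop :=
  ∀ n, w (n + 1) ≠ (0, !(w n).2)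

variable {g : A} {w : ℕ → (ℤ × ℤ) × Bool}

theorem wordBranch_succ_subset (hw : IsReducedWord w) (n : ℕ) :
    wordBranch g w (n + 1) ⊆ wordBranch g w n := by
  cases n with
  | zero => exact subset_univ _
  | succ n => exact branch_subset_branch _ _ _ (hw n)

theorem notMem_wordBranch (hw : IsReducedWord w) (n : ℕ) :
    vertex g ∉ wordBranch g w (n + 1) := by
  induction n with
  | zero => exact flatPt_notMem_branch g _ _ 0
  | succ n ih => exact fun h => ih (wordBranch_succ_subset hw _ h)

theorem wordGate_mem (n : ℕ) : wordGate g w (n + 1) ∈ wordBranch g w n := by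
  cases n with
  | zero => trivial
  | succ n =>
    refine vertex_mem_branch.2 ?_
    rw [wordVertex, ← mul_assoc, firstExit_mul_ofLattice, mul_assoc, inv_mul_cancel_left,
      firstExit_ofLattice_mul_letter]

theorem dist_wordGate_succ (n : ℕ) : dist (wordGate g w (n + 1)) (wordGate g w (n + 2)) =
    1 + ‖latticePoint (w (n + 1)).1‖ :=
  dist_vertex_letter_mul_ofLattice _ _ _

theorem dist_wordGate_le (n : ℕ) :
    dist (wordGate g w n) (wordGate g w (n + 1)) ≤ 1 + ‖latticePoint (w n).1‖ := by
  cases n with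
  | zero =>
    refine (dist_vertex_mul_ofLattice g (w 0).1).trans_le ?_
    linarith
  | succ n => exact (dist_wordGate_succ n).le

theorem isJoined_wordGate (n : ℕ) : IsJoined (wordGate g w n) (wordGate g w (n + 1)) := by
  cases n with
  | zero => exact isJoined_vertex_mul_ofLattice g _
  | succ n => exact isJoined_vertex_letter_mul_ofLattice _ _ _

theorem isGate_wordBranch (n : ℕ) : IsGate (wordGate g w n) (wordBranch g w n) := by
  cases n with
  | zero => exact fun x hx => absurd trivial hx
  | succ n => exact isGate_branch _ _ _

theorem isGateSeq (hw : IsReducedWord w) :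
    IsGateSeq (vertex g) (wordGate g w) (wordBranch g w) where
  zero := rfl
  univ := rfl
  gate := isGate_wordBranch
  notMem := notMem_wordBranch hw
  mem := wordGate_mem
  anti := wordBranch_succ_subset hw
  ne n := by
    rw [← dist_pos, dist_wordGate_succ]
    positivity
  -- Each gate after the first crossing adds at least the length of an edge, so `wordGate g w (n +
  -- 1)` has norm at least `n`.
  tendsto := by
    rw [← tendsto_add_atTop_iff_nat 1]
    refine tendsto_atTop_mono (f := fun n : ℕ => (n : ℝ)) (fun n => ?_)
      tendsto_natCast_atTop_atTop
    induction n with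
    | zero => simp
    | succ n ih =>
      have h := isGate_wordBranch (g := g) (w := w) (n + 1) _ (notMem_wordBranch hw n) _
        (wordGate_mem _)
      rw [dist_wordGate_succ] at h
      push_cast
      linarith [norm_nonneg (latticePoint (w (n + 1)).1)]

/-- A reduced word with bounded syllables leads to a boundary point. -/
theorem exists_mem_cylinder {κ : ℝ → ℝ} (hκ : IsSublinearFunction κ) (hw : IsReducedWord w)
    {L : ℝ} (hL : ∀ n, ‖latticePoint (w n).1‖ ≤ L) (C : GaugeChoice κ (vertex g)) :
    ∃ a : kappaBoundary κ (vertex g), ∀ n, a ∈ C.cylinder (wordBranch g w n) :=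
  (isGateSeq hw).exists_boundary_point hκ (L := 1 + L)
    (fun n => (dist_wordGate_le n).trans (by linarith [hL n])) isJoined_wordGate C

/-- The word that agrees with `w` up to the index `n`, then makes a detour by `(1, 0)`, and goes
straight on after that. -/
def detour (w : ℕ → (ℤ × ℤ) × Bool) (n : ℕ) : ℕ → (ℤ × ℤ) × Bool := fun k =>
  if k ≤ n then w k else (if k = n + 1 then (w k).1 + (1, 0) else 0, (w n).2)

theorem detour_of_le {n k : ℕ} (h : k ≤ n) : detour w n k = w k := if_pos h

/-- From index `n` on, the direction never changes, so no cancellation can occur whatever the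
lattice parts are. -/
theorem isReducedWord_detour (hw : IsReducedWord w) (n : ℕ) : IsReducedWord (detour w n) := by
  intro k
  rcases lt_trichotomy k n with h | rfl | h
  · rw [detour_of_le h.le, detour_of_le (Nat.succ_le_of_lt h)]
    exact hw k
  · rw [detour_of_le le_rfl]
    simp [detour]
  · simp [detour, h.not_ge, show ¬ k + 1 ≤ n by omega]

theorem exists_norm_detour_le (w : ℕ → (ℤ × ℤ) × Bool) (n : ℕ) :
    ∃ L, ∀ k, ‖latticePoint (detour w n k).1‖ ≤ L := by
  refine ⟨∑ k ∈ Finset.range (n + 2), ‖latticePoint (detour w n k).1‖, fun k => ?_⟩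
  by_cases hk : k < n + 2
  · exact Finset.single_le_sum (f := fun k => ‖latticePoint (detour w n k).1‖)
      (fun _ _ => norm_nonneg _) (Finset.mem_range.2 hk)
  · have : (detour w n k).1 = 0 := by
      simp [detour, show ¬ k ≤ n by omega, show k ≠ n + 1 by omega]
    rw [this, latticePoint_zero, norm_zero]
    positivity

theorem wordVertex_congr {w' : ℕ → (ℤ × ℤ) × Bool} {n : ℕ} (h : ∀ k < n, w k = w' k) :
    wordVertex g w n = wordVertex g w' n := by
  induction n with
  | zero => rfl
  | succ n ih =>
    rw [wordVertex, wordVertex, ih fun k hk => h k (by omega), h n (by omega)]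

theorem wordVertex_detour {n k : ℕ} (h : k ≤ n + 1) :
    wordVertex g (detour w n) k = wordVertex g w k :=
  wordVertex_congr fun _ hj => detour_of_le (by omega)

end TreeOfFlats

/-! ## Contraction in the Euclidean plane -/

theorem IsCompact.exists_dist_max {X : Type*} [MetricSpace X] {K : Set X} (hK : IsCompact K)
    (hne : K.Nonempty) : ∃ z ∈ K, ∃ w ∈ K, ∀ a ∈ K, ∀ b ∈ K, dist a b ≤ dist z w := by
  obtain ⟨a, ha, hmax⟩ := (hK.prod hK).exists_isMaxOn (hne.prod hne)
    (f := fun a : X × X => dist a.1 a.2) continuous_dist.continuousOn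
  exact ⟨a.1, ha.1, a.2, ha.2, fun b hb c hc => hmax (mk_mem_prod hb hc)⟩

section Plane

/-- The Euclidean plane. -/
abbrev Plane : Type := EuclideanSpace ℝ (Fin 2)

/-- The point `z` is a point of `K` nearest to `x`. -/
def IsNearest {X : Type*} [MetricSpace X] (K : Set X) (x z : X) : Prop :=
  z ∈ K ∧ ∀ k ∈ K, dist x z ≤ dist x k

/-- When the angle is not obtuse the cross term is non-negative, and `(1 - τ) ^ 2 + τ ^ 2` is at
least `1 / 4`. -/
theorem half_le_norm_segment {V : Type*} [NormedAddCommGroup V] [InnerProductSpace ℝ V]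
    {u u' : V} {ρ τ : ℝ} (hρ : 0 ≤ ρ) (hu : ρ ≤ ‖u‖) (hu' : ρ ≤ ‖u'‖) (h : 0 ≤ inner ℝ u u')
    (h0 : 0 ≤ τ) (h1 : τ ≤ 1) : ρ / 2 ≤ ‖(1 - τ) • u + τ • u'‖ := by
  have h2 : ‖(1 - τ) • u + τ • u'‖ ^ 2 =
      (1 - τ) ^ 2 * ‖u‖ ^ 2 + 2 * ((1 - τ) * τ * inner ℝ u u') + τ ^ 2 * ‖u'‖ ^ 2 := by
    rw [norm_add_sq_real, norm_smul, norm_smul, inner_smul_left, inner_smul_right, mul_pow,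
      mul_pow, Real.norm_eq_abs, Real.norm_eq_abs, sq_abs, sq_abs]
    simp
    ring
  have h3 : 0 ≤ (1 - τ) * τ * inner ℝ u u' := by
    have : 0 ≤ 1 - τ := by linarith
    positivity
  have h4 : ρ ^ 2 ≤ ‖u‖ ^ 2 := by gcongr
  have h5 : ρ ^ 2 ≤ ‖u'‖ ^ 2 := by gcongr
  have h6 : (1 - τ) ^ 2 * ρ ^ 2 ≤ (1 - τ) ^ 2 * ‖u‖ ^ 2 := by gcongr
  have h7 : τ ^ 2 * ρ ^ 2 ≤ τ ^ 2 * ‖u'‖ ^ 2 := by gcongr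
  have h8 : ρ ^ 2 * (1 / 4) ≤ ρ ^ 2 * ((1 - τ) ^ 2 + τ ^ 2) := by
    gcongr
    nlinarith [sq_nonneg (2 * τ - 1)]
  refine le_of_sq_le_sq ?_ (norm_nonneg _)
  rw [h2]
  nlinarith
where
  le_of_sq_le_sq {a b : ℝ} (h : a ^ 2 ≤ b ^ 2) (hb : 0 ≤ b) : a ≤ b :=
    (abs_le_of_sq_le_sq' h hb).2

/-- A right-angle turn of `u` with suitable sign. It serves as an intermediate stop on the way from
`u` to `v`, so that neither leg turns by an obtuse angle and both keep away from the origin. -/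
theorem exists_orthogonal {u : Plane} (hu : u ≠ 0) (v : Plane) {S : ℝ} (hS : 0 ≤ S) :
    ∃ n : Plane, ‖n‖ = S ∧ inner ℝ u n = 0 ∧ 0 ≤ inner ℝ n v := by
  let J : Plane := !₂[-u 1, u 0]
  have hJ : ‖J‖ = ‖u‖ := by
    rw [EuclideanSpace.norm_eq, EuclideanSpace.norm_eq]
    congr 1
    simp [J, add_comm]
  have huJ : inner ℝ u J = 0 := by
    rw [PiLp.inner_apply]
    simp [J]
    ring
  have hu0 : ‖u‖ ≠ 0 := norm_ne_zero_iff.2 hu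
  rcases le_total 0 (inner ℝ J v) with h | h
  · refine ⟨(S / ‖u‖) • J, ?_, ?_, ?_⟩
    · rw [norm_smul, hJ, Real.norm_of_nonneg (by positivity), div_mul_cancel₀ _ hu0]
    · rw [inner_smul_right, huJ, mul_zero]
    · rw [inner_smul_left]
      exact mul_nonneg (by simp; positivity) h
  · refine ⟨(-(S / ‖u‖)) • J, ?_, ?_, ?_⟩
    · rw [norm_smul, hJ, norm_neg, Real.norm_of_nonneg (by positivity), div_mul_cancel₀ _ hu0]
    · rw [inner_smul_right, huJ, mul_zero]
    · rw [inner_smul_left]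
      exact mul_nonneg_of_nonpos_of_nonpos (by simp; positivity) h

variable {K : Set Plane} {S D : ℝ} {z₀ : Plane}

/-- If projections to `K` move little, then walking along a segment that stays away from `z₀`
one keeps projecting close to `z₀`. -/
theorem dist_le_of_segment (hex : ∀ x, ∃ z, IsNearest K x z)
    (hD : ∀ x y z z', dist x z₀ ≤ S → dist x y ≤ dist x z → IsNearest K x z →
      IsNearest K y z' → dist z z' ≤ D) (hD0 : 0 ≤ D) {u u' : Plane} {s : ℝ} (hu : ‖u‖ ≤ S)
    (hu' : ‖u'‖ ≤ S) (hs : ∀ τ : ℝ, 0 ≤ τ → τ ≤ 1 → s ≤ ‖(1 - τ) • u + τ • u'‖) {k : ℝ} {M : ℕ}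
    (hM : 0 < M) (hstep : ‖u' - u‖ ≤ M * (s / 2)) (hk : (k + M) * D ≤ s / 2)
    (hG : ∀ z, IsNearest K (z₀ + u) z → dist z z₀ ≤ k * D) {z : Plane}
    (hz : IsNearest K (z₀ + u') z) : dist z z₀ ≤ (k + M) * D := by
  have hM' : (0 : ℝ) < M := by exact_mod_cast hM
  have key : ∀ i : ℕ, i ≤ M → ∀ z,
      IsNearest K (z₀ + ((1 - (i / M : ℝ)) • u + (i / M : ℝ) • u')) z →
      dist z z₀ ≤ (k + i) * D := by
    intro i
    induction i with
    | zero =>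
      intro _ z hz
      simpa using hG z (by simpa using hz)
    | succ i ih =>
      intro hi z hz
      have hi' : (i : ℝ) + 1 ≤ M := by exact_mod_cast hi
      set x := z₀ + ((1 - (i / M : ℝ)) • u + (i / M : ℝ) • u') with hx
      have h0 : (0 : ℝ) ≤ i / M := by positivity
      have h1 : (i / M : ℝ) ≤ 1 := by
        rw [div_le_one hM']
        linarith
      obtain ⟨y, hy⟩ := hex x
      have hyz := ih (by omega) y hy
      have hxz : dist x z₀ = ‖(1 - (i / M : ℝ)) • u + (i / M : ℝ) • u'‖ := by
        rw [hx, dist_eq_norm, add_sub_cancel_left]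
      have hxS : dist x z₀ ≤ S := by
        rw [hxz]
        refine (norm_add_le _ _).trans ?_
        rw [norm_smul, norm_smul, Real.norm_of_nonneg h0, Real.norm_of_nonneg (by linarith)]
        nlinarith
      have hxs : s ≤ dist x z₀ := (hs _ h0 h1).trans_eq hxz.symm
      have hkD : (k + i) * D ≤ (k + M) * D := by
        gcongr
        linarith
      -- The walk is at distance at least `s` from `z₀` and its projection is within `s / 2` of
      -- `z₀`, so a step of length `s / 2` is allowed and moves the projection by at most `D`.
      have hxy : s / 2 ≤ dist x y := by
        have := dist_triangle x y z₀
        linarith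
      have hmove : dist x (z₀ + ((1 - ((i + 1 : ℕ) / M : ℝ)) • u + ((i + 1 : ℕ) / M : ℝ) • u'))
          ≤ s / 2 := by
        have : x - (z₀ + ((1 - ((i + 1 : ℕ) / M : ℝ)) • u + ((i + 1 : ℕ) / M : ℝ) • u')) =
            (-(1 / M : ℝ)) • (u' - u) := by
          rw [hx]
          push_cast
          module
        rw [dist_eq_norm, this, norm_smul, norm_neg, Real.norm_of_nonneg (by positivity),
          one_div, inv_mul_le_iff₀ hM']
        exact hstep
      have := hD x _ y z hxS (hmove.trans hxy) hy hz
      have h2 := dist_triangle z y z₀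
      rw [dist_comm z y] at h2
      push_cast
      linarith
  exact key M le_rfl z (by simpa [div_self hM'.ne'] using hz)

/-- Walk from `x₀` to `w` by way of a point orthogonal to `x₀` as seen from `z₀`. If `D` were too
small, projections would stay near `z₀` all along, but `w` is its own projection and is far from
`z₀`. -/
theorem le_of_displacement_le (hex : ∀ x, ∃ z, IsNearest K x z)
    (hD : ∀ x y z z', dist x z₀ ≤ S → dist x y ≤ dist x z → IsNearest K x z →
      IsNearest K y z' → dist z z' ≤ D) (hD0 : 0 ≤ D) {x₀ w : Plane} (hx₀ : IsNearest K x₀ z₀)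
    (hρ : 0 < dist x₀ z₀) (hw : w ∈ K) (hS : dist w z₀ = S) (hρS : dist x₀ z₀ ≤ S) :
    dist x₀ z₀ ≤ 4 * (3 + 16 * (S / dist x₀ z₀)) * D := by
  set ρ := dist x₀ z₀ with hρdef
  by_contra! hlt
  have hS0 : 0 < S := hρ.trans_le hρS
  -- Each leg has length at most `2 * S` and keeps distance `ρ / 2` from `z₀`, so it is covered by
  -- `M` steps of length `ρ / 4`. The total displacement is at most `(1 + 2 * M) * D`, the `1`
  -- coming from the choice of nearest point at the start.
  set M := ⌈8 * (S / ρ)⌉₊ with hMdef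
  have hM1 : 8 * (S / ρ) ≤ M := Nat.le_ceil _
  have hM2 : (M : ℝ) < 8 * (S / ρ) + 1 := Nat.ceil_lt_add_one (by positivity)
  have hM0 : 0 < M := Nat.ceil_pos.2 (by positivity)
  have hSM : 2 * S ≤ M * (ρ / 2 / 2) := by
    have : S / ρ * ρ = S := div_mul_cancel₀ _ hρ.ne'
    nlinarith
  have hMD : (1 + 2 * M : ℝ) * D ≤ ρ / 4 := by
    have : (1 + 2 * M : ℝ) * D ≤ (3 + 16 * (S / ρ)) * D :=
      mul_le_mul_of_nonneg_right (by linarith) hD0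
    linarith
  have hM0' : (0 : ℝ) ≤ M := Nat.cast_nonneg M
  have hMDpos : 0 ≤ M * D := mul_nonneg hM0' hD0
  set u := x₀ - z₀ with hu
  have hun : ‖u‖ = ρ := (dist_eq_norm _ _).symm
  have hwn : ‖w - z₀‖ = S := by rw [← dist_eq_norm, hS]
  have hu0 : u ≠ 0 := norm_ne_zero_iff.1 (by rw [hun]; exact hρ.ne')
  obtain ⟨n, hn, hun0, hnw⟩ := exists_orthogonal hu0 (w - z₀) hS0.le
  have hG0 : ∀ z, IsNearest K (z₀ + u) z → dist z z₀ ≤ 1 * D := by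
    intro z hz
    rw [hu, add_sub_cancel] at hz
    rw [one_mul]
    exact hD x₀ x₀ z z₀ hρS (by rw [dist_self]; exact dist_nonneg) hz hx₀
  have hG1 : ∀ z, IsNearest K (z₀ + n) z → dist z z₀ ≤ (1 + M) * D := fun z hz =>
    dist_le_of_segment hex hD hD0 (hun.trans_le hρS) hn.le
      (fun τ h0 h1 => half_le_norm_segment hρ.le hun.ge (by rw [hn]; exact hρS) hun0.ge h0 h1)
      hM0 ((norm_sub_le _ _).trans (by linarith)) (by nlinarith) hG0 hz
  have hG2 := dist_le_of_segment hex hD hD0 (k := 1 + M) (M := M) hn.le hwn.le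
      (fun τ h0 h1 => half_le_norm_segment hρ.le (by rw [hn]; exact hρS)
        (by rw [hwn]; exact hρS) hnw h0 h1) hM0 ((norm_sub_le _ _).trans (by linarith))
      (by nlinarith) hG1 (z := w) ⟨by simpa using hw, fun k _ => by simp⟩
  rw [hS] at hG2
  nlinarith

/-- `Δ` is the diameter of `K`, attained at `z₀` and `w`. The reflection of `w` in `z₀` has `z₀` as
a nearest point, since a nearer one would be too far from `w`. Then `ρ = S = Δ`, and `4 * (3 + 16) =
76`. -/
theorem exists_norm_le_of_displacement_le (hKc : IsCompact K) (h0 : 0 ∈ K) {p : Plane}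
    (hp : p ∈ K) (hex : ∀ x, ∃ z, IsNearest K x z) {f : ℝ → ℝ} (hf : ∀ Δ, 0 ≤ Δ → 0 ≤ f Δ)
    (hD : ∀ Δ x y z z', ‖x‖ ≤ 2 * Δ → dist x y ≤ dist x z → IsNearest K x z →
      IsNearest K y z' → dist z z' ≤ f Δ) : ∃ Δ, ‖p‖ ≤ Δ ∧ Δ ≤ 76 * f Δ := by
  obtain ⟨z₀, hz₀, w, hw, hmax'⟩ := hKc.exists_dist_max ⟨0, h0⟩
  have hmax₀ : ∀ a ∈ K, ‖a‖ ≤ dist z₀ w := fun a ha => by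
    rw [← dist_zero_right]
    exact hmax' a ha 0 h0
  refine ⟨dist z₀ w, hmax₀ p hp, ?_⟩
  rcases (dist_nonneg (x := z₀) (y := w)).eq_or_lt with hΔ | hΔ
  · rw [← hΔ]
    have := hf 0 le_rfl
    positivity
  have hx₀ : dist (z₀ + (z₀ - w)) z₀ = dist z₀ w := by
    rw [dist_eq_norm, add_sub_cancel_left, dist_eq_norm]
  have hxw : dist (z₀ + (z₀ - w)) w = 2 * dist z₀ w := by
    rw [dist_eq_norm, show z₀ + (z₀ - w) - w = (2 : ℝ) • (z₀ - w) by module, norm_smul,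
      dist_eq_norm, Real.norm_of_nonneg zero_le_two]
  have hnear : IsNearest K (z₀ + (z₀ - w)) z₀ := by
    refine ⟨hz₀, fun k hk => ?_⟩
    have h1 := dist_triangle (z₀ + (z₀ - w)) k w
    have h2 := hmax' k hk w hw
    linarith
  have h := le_of_displacement_le (S := dist z₀ w) hex (fun x y z z' hx hxy hz hz' =>
      hD (dist z₀ w) x y z z' (by
        have h1 := dist_triangle x z₀ 0
        rw [dist_zero_right, dist_zero_right] at h1
        linarith [hmax₀ z₀ hz₀]) hxy hz hz') (hf _ hΔ.le) hnear (by rwa [hx₀]) hw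
    (dist_comm w z₀) hx₀.le
  rw [hx₀, div_self hΔ.ne'] at h
  linarith

end Plane

namespace TreeOfFlats

/-! ## Contracting rays leave every flat -/

/-- If `2 * Δ ≤ a`, concavity gives `κ (2 * a) ≤ 2 * κ a`; otherwise `Δ ≤ |N| * κ (4 * Δ)`, and
sublinearity bounds `Δ` by a constant. -/
theorem _root_.IsSublinearFunction.exists_le_of_le_mul {κ : ℝ → ℝ} (hκ : IsSublinearFunction κ)
    (N : ℝ) : ∃ C, 0 ≤ C ∧ ∀ a Δ, 0 ≤ a → 0 ≤ Δ → Δ ≤ N * κ (a + 2 * Δ) → Δ ≤ C * κ a := by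
  obtain ⟨T, hT⟩ := eventually_atTop.1 (hκ.eventually_mul_add_lt (4 * |N|) 0)
  refine ⟨2 * |N| + |T|, by positivity, fun a Δ ha hΔ h => ?_⟩
  have hκa := hκ.one_le a ha
  have h1 : Δ ≤ |N| * κ (a + 2 * Δ) := h.trans (mul_le_mul_of_nonneg_right (le_abs_self N)
    (zero_le_one.trans (hκ.one_le _ (by positivity))))
  have hN : 0 ≤ |N| * κ a := by positivity
  have hT' : |T| ≤ |T| * κ a := le_mul_of_one_le_right (abs_nonneg _) hκa
  rcases le_total (2 * Δ) a with hle | hle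
  · rcases ha.eq_or_lt with rfl | ha'
    · have : Δ = 0 := by linarith
      rw [this]
      positivity
    · have h2 : κ (a + 2 * Δ) ≤ κ (2 * a) := hκ.mono (by simp; positivity) (by simp; positivity)
        (by linarith)
      have h3 : κ (2 * a) ≤ 2 * κ a := by
        have h4 := hκ.div_mono ha' (show a ≤ 2 * a by linarith)
        have h5 := hκ.one_le (2 * a) (by positivity)
        rw [div_le_div_iff₀ (by positivity) (by positivity)] at h4
        nlinarith
      have h6 : |N| * κ (a + 2 * Δ) ≤ |N| * (2 * κ a) := by gcongr; linarith
      nlinarith [abs_nonneg T]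
  · have h2 : κ (a + 2 * Δ) ≤ κ (4 * Δ) := hκ.mono (by simp; positivity) (by simp; positivity)
      (by linarith)
    have h3 : |N| * κ (a + 2 * Δ) ≤ |N| * κ (4 * Δ) := by gcongr
    have h4 : 4 * Δ < T := by
      by_contra! hc
      have := hT _ hc
      linarith
    have := le_abs_self T
    nlinarith

/-! ### The trace of a ray on a flat -/

section Ray

variable {o : Space} {q Q : ℝ} {β : ℝ≥0 → Space}

/-- A ray that does not stay in the branch at which it enters a flat passes the vertex of
the flat at which this branch is attached. -/
theorem flatPt_retract_mem_range (hβ : IsQuasiGeodesicRay o q Q β) {v : A}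
    (h : ∀ z ε, o ∉ branch v z ε ∨ ¬ ∀ᶠ t in atTop, β t ∈ branch v z ε) (t : ℝ≥0) :
    flatPt v (retract v (β t)) ∈ range β := by
  rcases exists_flatPt_or_mem_branch v (β t) with ⟨p, hp⟩ | ⟨z, ε, hz⟩
  · rw [hp, retract_flatPt, ← hp]
    exact ⟨t, rfl⟩
  · rw [retract_of_mem_branch hz, ← vertex_mul_ofLattice]
    rcases h z ε with ho | hn
    · obtain ⟨s, -, hs⟩ := (isGate_branch v z ε).exists_eq (isPreconnected_Icc (a := 0) (b := t))
        hβ.continuous.continuousOn (left_mem_Icc.2 zero_le) (right_mem_Icc.2 zero_le)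
        (by rwa [hβ.start]) hz
      exact ⟨s, hs⟩
    · have h1 := ((isGate_branch v z ε).eventually_mem_or hβ).resolve_left hn
      obtain ⟨s, -, hs⟩ := hβ.exists_eq_of_eventually_mem (isGate_branch v z ε).compl h1
        (not_not.2 hz)
      exact ⟨s, hs⟩

theorem _root_.IsQuasiGeodesicRay.exists_isMinOn_dist (hβ : IsQuasiGeodesicRay o q Q β)
    (x : Space) : ∃ t, ∀ s, dist x (β t) ≤ dist x (β s) := by
  have hc : Continuous fun t => dist x (β t) := continuous_const.dist hβ.continuous
  refine hc.exists_forall_le' 0 ?_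
  obtain ⟨T, hT⟩ := eventually_atTop.1 (hβ.tendsto_norm.eventually
    (eventually_ge_atTop (dist x (β 0) + dist x o)))
  filter_upwards [(isCompact_Icc (a := 0) (b := T)).compl_mem_cocompact] with t ht
  have h1 : T ≤ t := by
    by_contra! hlt
    exact ht ⟨zero_le, hlt.le⟩
  have h2 := hT t h1
  have h3 := dist_triangle o x (β t)
  rw [dist_comm o x] at h3
  linarith

variable {v : A}

/-- Retracting does not increase distances and maps the ray into its trace on the flat; contraction
thereby becomes a statement about a planar set. -/
theorem infDist_flatPt (hZ : ∀ t, flatPt v (retract v (β t)) ∈ range β)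
    {x z : Plane} (hz : IsNearest {p | flatPt v p ∈ range β} x z) :
    Metric.infDist (flatPt v x) (range β) = dist x z := by
  refine le_antisymm ?_ ((Metric.le_infDist (range_nonempty β)).2 ?_)
  · rw [← dist_flatPt v]
    exact Metric.infDist_le_dist_of_mem hz.1
  · rintro _ ⟨t, rfl⟩
    refine (hz.2 _ (hZ t)).trans ?_
    simpa [retract_flatPt] using dist_retract_le v (flatPt v x) (β t)

theorem exists_isNearest (hZ : ∀ t, flatPt v (retract v (β t)) ∈ range β)
    (hβ : IsQuasiGeodesicRay o q Q β) (x : Plane) :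
    ∃ z, IsNearest {p | flatPt v p ∈ range β} x z := by
  obtain ⟨t, ht⟩ := hβ.exists_isMinOn_dist (flatPt v x)
  refine ⟨retract v (β t), hZ t, fun k hk => ?_⟩
  obtain ⟨s, hs⟩ := hk
  have h1 := dist_retract_le v (flatPt v x) (β t)
  rw [retract_flatPt] at h1
  refine h1.trans ((ht s).trans_eq ?_)
  rw [hs, dist_flatPt]

theorem dist_nearest_le (hZ : ∀ t, flatPt v (retract v (β t)) ∈ range β)
    {κ : ℝ → ℝ} {c : ℝ} (hκ : IsSublinearFunction κ)
    (hc : ∀ x y : Space, dist x y ≤ Metric.infDist x (range β) →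
      Metric.diam (nearestPoints (range β) x ∪ nearestPoints (range β) y) ≤ c * κ (dist o x))
    {x y z z' : Plane} (hxy : dist x y ≤ dist x z)
    (hz : IsNearest {p | flatPt v p ∈ range β} x z)
    (hz' : IsNearest {p | flatPt v p ∈ range β} y z') {r : ℝ}
    (hr : dist o (vertex v) + ‖x‖ ≤ r) : dist z z' ≤ |c| * κ r := by
  -- `Metric.diam` is `0` on unbounded sets, so boundedness is needed before a diameter bounds a
  -- distance.
  have hbdd : ∀ x : Space, Bornology.IsBounded (nearestPoints (range β) x) := fun x =>
    Metric.isBounded_closedBall.subset fun y hy => by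
      rw [Metric.mem_closedBall']
      exact hy.2.le
  have h1 := hc (flatPt v x) (flatPt v y) (by rwa [infDist_flatPt hZ hz, dist_flatPt])
  have h2 : dist o (flatPt v x) ≤ r := by
    refine (dist_triangle _ (vertex v) _).trans ?_
    rwa [← flatPt_zero, dist_flatPt, dist_zero_left]
  have h3 : κ (dist o (flatPt v x)) ≤ κ r := hκ.mono dist_nonneg (dist_nonneg.trans h2) h2
  rw [← dist_flatPt v]
  calc dist (flatPt v z) (flatPt v z') ≤ _ := Metric.dist_le_diam_of_mem
        ((hbdd _).union (hbdd _))
        (Or.inl ⟨hz.1, by rw [infDist_flatPt hZ hz, dist_flatPt]⟩)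
        (Or.inr ⟨hz'.1, by rw [infDist_flatPt hZ hz', dist_flatPt]⟩)
    _ ≤ _ := h1
    _ ≤ |c| * κ (dist o (flatPt v x)) := mul_le_mul_of_nonneg_right (le_abs_self c)
        (zero_le_one.trans (hκ.one_le _ dist_nonneg))
    _ ≤ _ := by gcongr

/-- The part of a contracting ray inside a flat that it leaves is small. -/
theorem exists_norm_le (hZ : ∀ t, flatPt v (retract v (β t)) ∈ range β) {κ : ℝ → ℝ} {c : ℝ}
    (hκ : IsSublinearFunction κ) (hβ : IsQuasiGeodesicRay o q Q β)
    (hc : ∀ x y : Space, dist x y ≤ Metric.infDist x (range β) →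
      Metric.diam (nearestPoints (range β) x ∪ nearestPoints (range β) y) ≤ c * κ (dist o x))
    (hv : vertex v ∈ range β) {z : ℤ × ℤ} {ε : Bool}
    (hz : ∀ᶠ t in atTop, β t ∈ branch v z ε) :
    ∃ Δ, ‖latticePoint z‖ ≤ Δ ∧ Δ ≤ 76 * (|c| * κ (dist o (vertex v) + 2 * Δ)) := by
  obtain ⟨T, hT⟩ := eventually_atTop.1 hz
  have hmem : latticePoint z ∈ {p | flatPt v p ∈ range β} := by
    have := hZ T
    rwa [retract_of_mem_branch (hT T le_rfl)] at this
  -- After time `T` the ray retracts to the single exit point, so the trace is a compact path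
  -- together with that point.
  have hKeq : {p | flatPt v p ∈ range β} =
      insert (latticePoint z) ((fun t => retract v (β t)) '' Icc 0 T) := by
    ext p
    constructor
    · rintro ⟨t, ht⟩
      have hp : p = retract v (β t) := by rw [ht, retract_flatPt]
      rcases le_total t T with h | h
      · exact Or.inr ⟨t, ⟨zero_le, h⟩, hp.symm⟩
      · exact Or.inl (by rw [hp, retract_of_mem_branch (hT t h)])
    · rintro (rfl | ⟨t, -, rfl⟩)
      · exact hmem
      · exact hZ t
  have hKc : IsCompact {p | flatPt v p ∈ range β} := by
    rw [hKeq]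
    exact (isCompact_Icc.image ((continuous_retract v).comp hβ.continuous)).insert _
  refine exists_norm_le_of_displacement_le hKc (by rwa [← flatPt_zero] at hv) hmem
    (exists_isNearest hZ hβ) (f := fun Δ => |c| * κ (dist o (vertex v) + 2 * Δ))
    (fun Δ hΔ => mul_nonneg (abs_nonneg _) (zero_le_one.trans (hκ.one_le _ (by positivity))))
    fun Δ x y z z' hx hxy hz hz' => dist_nearest_le hZ hκ hc hxy hz hz' (by linarith)

end Ray

end TreeOfFlats

/-! ### Quasi-geodesic rays cannot fill a flat -/

namespace TreeOfFlats

/-- The grid point of the square of side length `R`, divided into `N * N` squares. -/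
noncomputable def gridPoint (R : ℝ) (N : ℕ) (a : ℕ × ℕ) : Plane :=
  !₂[R / N * a.1, R / N * a.2]

theorem norm_gridPoint_le {R : ℝ} (hR : 0 ≤ R) {N : ℕ} (hN : 0 < N) {a : ℕ × ℕ} (h1 : a.1 < N)
    (h2 : a.2 < N) : ‖gridPoint R N a‖ ≤ 2 * R := by
  have hN' : (0 : ℝ) < N := by exact_mod_cast hN
  have key : ∀ i : ℕ, i < N → R / N * i ≤ R := fun i hi => by
    have hi' : (i : ℝ) ≤ N := by exact_mod_cast hi.le
    calc R / N * i ≤ R / N * N := by gcongr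
      _ = R := div_mul_cancel₀ _ hN'.ne'
  rw [EuclideanSpace.norm_eq, Real.sqrt_le_left (by positivity)]
  simp only [gridPoint, Fin.sum_univ_two, Real.norm_eq_abs, sq_abs]
  have h3 := key _ h1
  have h4 := key _ h2
  have h5 : 0 ≤ R / N * a.1 := by positivity
  have h6 : 0 ≤ R / N * a.2 := by positivity
  simp
  nlinarith

theorem le_dist_gridPoint {R : ℝ} (hR : 0 ≤ R) {N : ℕ} {a b : ℕ × ℕ} (hab : a ≠ b) :
    R / N ≤ dist (gridPoint R N a) (gridPoint R N b) := by
  have key : ∀ i j : ℕ, i ≠ j → R / N ≤ |R / N * i - R / N * j| := fun i j hij => by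
    rw [← mul_sub, abs_mul, abs_of_nonneg (by positivity : 0 ≤ R / N)]
    refine le_mul_of_one_le_right (by positivity) ?_
    have h : (1 : ℤ) ≤ |(i : ℤ) - j| := Int.one_le_abs (by omega)
    exact_mod_cast h
  have hn : ∀ i : Fin 2, |gridPoint R N a i - gridPoint R N b i| ≤
      dist (gridPoint R N a) (gridPoint R N b) := fun i => by
    rw [dist_eq_norm]
    simpa using PiLp.norm_apply_le (gridPoint R N a - gridPoint R N b) i
  by_cases h : a.1 = b.1
  · have h2 : a.2 ≠ b.2 := fun h2 => hab (Prod.ext h h2)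
    refine (key _ _ h2).trans ?_
    simpa [gridPoint] using hn 1
  · refine (key _ _ h).trans ?_
    simpa [gridPoint] using hn 0

/-- A quasi-geodesic ray does not come close to all points of a large square. -/
theorem exists_far_point {o : Space} {q Q : ℝ} {β : ℝ≥0 → Space}
    (hβ : IsQuasiGeodesicRay o q Q β) (v : A) :
    ∃ δ R₀ : ℝ, 0 < δ ∧ ∀ R, R₀ ≤ R → ∃ x : Plane, ‖x‖ ≤ 2 * R ∧
      ∀ p, flatPt v p ∈ range β → δ * R ≤ dist x p := by
  have hq := hβ.one_le
  have hQ := hβ.nonneg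
  -- If all `N ^ 2` grid points had points of the ray nearby, these would occur at times up to `4 *
  -- q * R`, no two within `R / (4 * N * q)` of each other. That leaves room for at most `16 * q ^ 2
  -- * N + 1` of them.
  obtain ⟨N, hN⟩ := exists_nat_gt (16 * q ^ 2 + 1)
  have hN1 : (1 : ℝ) < N := by nlinarith
  have hN0 : (0 : ℝ) < N := by linarith
  have hN0' : 0 < N := by exact_mod_cast hN0
  refine ⟨1 / (4 * N), max 1 (max (4 * N * Q) (dist o (vertex v) + Q)), by positivity,
    fun R hR => ?_⟩
  have hR1 : 1 ≤ R := (le_max_left _ _).trans hR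
  have hR2 : 4 * N * Q ≤ R := ((le_max_left _ _).trans (le_max_right _ _)).trans hR
  have hR3 : dist o (vertex v) + Q ≤ R := ((le_max_right _ _).trans (le_max_right _ _)).trans hR
  by_contra! hcon
  have hex : ∀ a : ℕ × ℕ, ∃ t : ℝ≥0, a.1 < N → a.2 < N → ∃ p, flatPt v p = β t ∧
      dist (gridPoint R N a) p < 1 / (4 * N) * R := by
    intro a
    by_cases ha : a.1 < N ∧ a.2 < N
    · obtain ⟨p, ⟨t, ht⟩, hd⟩ := hcon _ (norm_gridPoint_le (by linarith) hN0' ha.1 ha.2)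
      exact ⟨t, fun _ _ => ⟨p, ht.symm, hd⟩⟩
    · exact ⟨0, fun h1 h2 => absurd ⟨h1, h2⟩ ha⟩
  choose t ht using hex
  set s : ℝ := R / (4 * N * q) with hs
  have hs0 : 0 < s := by positivity
  have hRN : R / (4 * N * q) * q = R / N / 4 := by field_simp
  have hRN' : 1 / (4 * N) * R = R / N / 4 := by field_simp
  have hRNpos : 0 < R / N := by positivity
  have hQN : Q ≤ R / N / 4 := by
    rw [div_div, le_div_iff₀ (by positivity)]
    linarith
  have hRN1 : R / N ≤ R := div_le_self (by linarith) hN1.le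
  set f : ℕ × ℕ → ℕ := fun a => ⌊(t a : ℝ) / s⌋₊ with hf
  have hmaps : ∀ a ∈ Finset.range N ×ˢ Finset.range N,
      f a ∈ Finset.range (⌊16 * q ^ 2 * N⌋₊ + 1) := by
    intro a ha
    rw [Finset.mem_product, Finset.mem_range, Finset.mem_range] at ha
    obtain ⟨p, hp, hd⟩ := ht a ha.1 ha.2
    rw [Finset.mem_range, Nat.lt_succ_iff]
    refine Nat.floor_le_floor ?_
    have h1 := hβ.le_norm (t a)
    have h2 : ‖p‖ ≤ 2 * R + R / N / 4 := by
      have h3 := dist_triangle p (gridPoint R N a) 0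
      rw [dist_zero_right, dist_zero_right, dist_comm p] at h3
      have := norm_gridPoint_le (R := R) (by linarith) hN0' ha.1 ha.2
      linarith
    have h4 : dist o (β (t a)) ≤ dist o (vertex v) + ‖p‖ := by
      refine (dist_triangle _ (vertex v) _).trans_eq ?_
      rw [← hp, ← flatPt_zero, dist_flatPt, dist_zero_left]
    have h5 : 1 / q * t a ≤ 4 * R := by linarith
    rw [one_div, inv_mul_le_iff₀ (by linarith)] at h5
    rw [div_le_iff₀ hs0]
    calc (t a : ℝ) ≤ q * (4 * R) := h5
      _ = 16 * q ^ 2 * N * s := by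
        rw [hs]
        field_simp
        norm_num
  have hinj : Set.InjOn f (Finset.range N ×ˢ Finset.range N : Finset (ℕ × ℕ)) := by
    intro a ha b hb hab
    rw [Finset.mem_coe, Finset.mem_product, Finset.mem_range, Finset.mem_range] at ha hb
    by_contra hne
    obtain ⟨p, hp, hd⟩ := ht a ha.1 ha.2
    obtain ⟨p', hp', hd'⟩ := ht b hb.1 hb.2
    have h1 := le_dist_gridPoint (R := R) (by linarith) (N := N) hne
    have h2 := dist_triangle4 (gridPoint R N a) p p' (gridPoint R N b)
    have h3 := hβ.upper (t a) (t b)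
    rw [← hp, ← hp', dist_flatPt] at h3
    rw [dist_comm p'] at h2
    have h4 : dist (t a) (t b) < s := by
      have e1 := Nat.floor_le (show 0 ≤ (t a : ℝ) / s by positivity)
      have e2 := Nat.lt_floor_add_one ((t a : ℝ) / s)
      have e3 := Nat.floor_le (show 0 ≤ (t b : ℝ) / s by positivity)
      have e4 := Nat.lt_floor_add_one ((t b : ℝ) / s)
      have e5 : (⌊(t a : ℝ) / s⌋₊ : ℝ) = ⌊(t b : ℝ) / s⌋₊ := by exact_mod_cast hab
      rw [e5] at e1 e2
      rw [le_div_iff₀ hs0] at e1 e3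
      rw [div_lt_iff₀ hs0] at e2 e4
      rw [NNReal.dist_eq, abs_lt]
      constructor <;> nlinarith
    have h5 : q * dist (t a) (t b) < R / N / 4 := by
      rw [← hRN, mul_comm]
      exact mul_lt_mul_of_pos_right h4 (by linarith)
    linarith
  have hcard := Finset.card_le_card_of_injOn f hmaps hinj
  rw [Finset.card_product, Finset.card_range, Finset.card_range] at hcard
  have h1 : (N : ℝ) * N ≤ ⌊16 * q ^ 2 * N⌋₊ + 1 := by exact_mod_cast hcard
  have h2 := Nat.floor_le (show 0 ≤ 16 * q ^ 2 * N by positivity)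
  nlinarith

/-- A contracting quasi-geodesic ray leaves every flat for good. -/
theorem exists_eventually_mem_branch {κ : ℝ → ℝ} (hκ : IsSublinearFunction κ) {o : Space}
    {q Q : ℝ} {β : ℝ≥0 → Space} (hβ : IsQuasiGeodesicRay o q Q β)
    (hcon : IsKappaContracting κ o (range β)) (v : A) :
    ∃ z ε, ∀ᶠ t in atTop, β t ∈ branch v z ε := by
  by_contra! hne
  obtain ⟨c, hc⟩ := hcon
  -- If the ray settles in no branch, it returns to the flat at arbitrarily late times, so its trace
  -- there is unbounded; `le_of_displacement_le` will be contradicted at scale `R`.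
  have hZ := flatPt_retract_mem_range hβ (v := v) fun z ε => Or.inr (not_eventually.2 (hne z ε))
  have hflat : ∀ T, ∃ t, T ≤ t ∧ ∃ p, β t = flatPt v p := by
    intro T
    rcases exists_flatPt_or_mem_branch v (β T) with ⟨p, hp⟩ | ⟨z, ε, hz⟩
    · exact ⟨T, le_rfl, p, hp⟩
    · have h1 := ((isGate_branch v z ε).eventually_mem_or hβ).resolve_left
        (not_eventually.2 (hne z ε))
      obtain ⟨s, hs, hs'⟩ := hβ.exists_eq_of_eventually_mem (isGate_branch v z ε).compl h1
        (not_not.2 hz)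
      exact ⟨s, hs, latticePoint z, by rw [hs', vertex_mul_ofLattice]⟩
  obtain ⟨δ, R₀, hδ, hfar⟩ := exists_far_point hβ v
  set a := dist o (vertex v) with ha
  set k₀ := retract v (β 0) with hk₀
  -- The walk stays within `11 * R` of `z₀`, while `‖z₀‖ ≤ 5 * R` and `a ≤ R`; so norms are at most
  -- `17 * R`. The factor `176` is `16 * 11`.
  obtain ⟨r, hr, hr0⟩ := ((hκ.eventually_mul_add_lt
    (17 * (4 * (3 + 176 / δ) * |c| / δ)) 0).and (eventually_ge_atTop
    (17 * (max R₀ (1 + a + ‖k₀‖))))).exists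
  set R := r / 17 with hR
  have hrR : r = 17 * R := by rw [hR]; ring
  rw [hrR] at hr hr0
  have hR0 : R₀ ≤ R := by linarith [le_max_left R₀ (1 + a + ‖k₀‖)]
  have hR1 : 1 + a + ‖k₀‖ ≤ R := by linarith [le_max_right R₀ (1 + a + ‖k₀‖)]
  have ha0 : 0 ≤ a := dist_nonneg
  have hk0 : 0 ≤ ‖k₀‖ := norm_nonneg _
  have hRpos : 0 < R := by linarith
  obtain ⟨x₀, hx₀, hx₀'⟩ := hfar R hR0
  obtain ⟨z₀, hz₀⟩ := exists_isNearest hZ hβ x₀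
  have hρ : δ * R ≤ dist x₀ z₀ := hx₀' z₀ hz₀.1
  have hρ3 : dist x₀ z₀ ≤ 3 * R := by
    have h1 := hz₀.2 k₀ (hZ 0)
    have h2 : dist x₀ k₀ ≤ ‖x₀‖ + ‖k₀‖ := dist_le_norm_add_norm _ _
    linarith
  have hz₀5 : ‖z₀‖ ≤ 5 * R := by
    have h1 := dist_triangle z₀ x₀ 0
    rw [dist_zero_right, dist_zero_right, dist_comm z₀] at h1
    linarith
  -- The retracted ray starts within `11 * R` of `z₀` and later gets further away, so by continuity
  -- it attains this distance.
  obtain ⟨w, hw, hwS⟩ : ∃ w, flatPt v w ∈ range β ∧ dist w z₀ = 11 * R := by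
    have hcont : Continuous fun t => dist (retract v (β t)) z₀ :=
      ((continuous_retract v).comp hβ.continuous).dist continuous_const
    obtain ⟨T, hT⟩ := eventually_atTop.1
      (hβ.tendsto_norm.eventually (eventually_ge_atTop (16 * R + a)))
    obtain ⟨t, htT, p, hp⟩ := hflat T
    have h1 : dist (retract v (β 0)) z₀ ≤ 11 * R := by
      have : dist k₀ z₀ ≤ ‖k₀‖ + ‖z₀‖ := dist_le_norm_add_norm _ _
      linarith
    have h2 : 11 * R ≤ dist (retract v (β t)) z₀ := by
      have h3 := hT t htT
      have h4 := dist_triangle o (vertex v) (β t)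
      rw [hp, ← flatPt_zero, dist_flatPt, dist_zero_left, flatPt_zero] at h4
      rw [hp] at h3 ⊢
      rw [retract_flatPt]
      have h5 := dist_triangle p z₀ 0
      rw [dist_zero_right, dist_zero_right] at h5
      linarith
    obtain ⟨u, hu⟩ := mem_range_of_exists_le_of_exists_ge hcont ⟨0, h1⟩ ⟨t, h2⟩
    exact ⟨_, hZ u, hu⟩
  have hκR : 0 ≤ κ (17 * R) := zero_le_one.trans (hκ.one_le _ (by positivity))
  have hδR : 0 < δ * R := by positivity
  have hmain := le_of_displacement_le (K := {p | flatPt v p ∈ range β}) (S := 11 * R)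
    (exists_isNearest hZ hβ)
    (fun x y z z' hx hxy hz hz' => dist_nearest_le hZ hκ hc hxy hz hz' (r := 17 * R) (by
      have h1 := dist_triangle x z₀ 0
      rw [dist_zero_right, dist_zero_right] at h1
      linarith))
    (mul_nonneg (abs_nonneg _) hκR) hz₀ (hδR.trans_le hρ) hw hwS (by linarith)
  have h1 : 11 * R / dist x₀ z₀ ≤ 11 / δ := by
    rw [div_le_div_iff₀ (hδR.trans_le hρ) hδ]
    linarith
  have h2 : δ * R ≤ 4 * (3 + 176 / δ) * (|c| * κ (17 * R)) := by
    refine hρ.trans (hmain.trans ?_)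
    gcongr
    calc 16 * (11 * R / dist x₀ z₀) ≤ 16 * (11 / δ) := by gcongr
      _ = 176 / δ := by ring
  have h3 : 17 * (4 * (3 + 176 / δ) * |c| / δ) * κ (17 * R) =
      17 * (4 * (3 + 176 / δ) * (|c| * κ (17 * R)) / δ) := by ring
  rw [h3, add_zero] at hr
  have h4 : 4 * (3 + 176 / δ) * (|c| * κ (17 * R)) / δ < R := by linarith
  rw [div_lt_iff₀ hδ] at h4
  linarith

end TreeOfFlats

namespace TreeOfFlats

/-! ## The boundary of the tree of flats -/

variable {g : A}

/-- A contracting quasi-geodesic ray follows an infinite reduced word. -/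
theorem exists_word {κ : ℝ → ℝ} (hκ : IsSublinearFunction κ) {q Q : ℝ} {β : ℝ≥0 → Space}
    (hβ : IsQuasiGeodesicRay (vertex g) q Q β) (hcon : IsKappaContracting κ (vertex g) (range β)) :
    ∃ w, IsReducedWord w ∧ ConvergesTo β (wordBranch g w) := by
  choose z ε hzε using exists_eventually_mem_branch hκ hβ hcon
  let v : ℕ → A := fun n => Nat.rec g (fun _ u => u * ofLattice (z u) * letter (ε u)) n
  have hvs : ∀ n, v (n + 1) = v n * ofLattice (z (v n)) * letter (ε (v n)) := fun _ => rfl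
  let w : ℕ → (ℤ × ℤ) × Bool := fun n => (z (v n), ε (v n))
  have hv : ∀ n, wordVertex g w n = v n := by
    intro n
    induction n with
    | zero => rfl
    | succ n ih => rw [wordVertex, ih, hvs]
  refine ⟨w, fun n hn => ?_, fun n => ?_⟩
  -- A cancellation would keep the ray on both sides of one edge, hence within distance `1` of a
  -- vertex, although its norm tends to infinity.
  · have h1 := hzε (v n)
    have h2 := hzε (v (n + 1))
    have h3 : z (v (n + 1)) = 0 ∧ ε (v (n + 1)) = !ε (v n) := Prod.mk.inj hn
    rw [h3.1, h3.2, hvs] at h2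
    obtain ⟨t, ⟨ht1, ht2⟩, ht⟩ := ((h1.and h2).and (hβ.tendsto_norm.eventually
      (eventually_gt_atTop (dist (vertex g) (vertex (v n * ofLattice (z (v n)))) + 1)))).exists
    have h4 := dist_vertex_le_one ht1 ht2
    have h5 := dist_triangle (vertex g) (vertex (v n * ofLattice (z (v n)))) (β t)
    rw [dist_comm] at h4
    linarith
  · cases n with
    | zero => exact Eventually.of_forall fun _ => trivial
    | succ n =>
      rw [wordBranch, hv]
      exact hzε (v n)

/-- From the far end of each crossed edge, the base-point lies in the branch leading back, which the
ray eventually avoids; so the ray passes this end too. This supplies the point at which it enters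
the next flat. -/
theorem vertex_wordVertex_mem_range {q Q : ℝ} {β : ℝ≥0 → Space}
    (hβ : IsQuasiGeodesicRay (vertex g) q Q β) {w : ℕ → (ℤ × ℤ) × Bool} (hw : IsReducedWord w)
    (h : ConvergesTo β (wordBranch g w)) (n : ℕ) :
    vertex (wordVertex g w n) ∈ range β := by
  cases n with
  | zero => exact ⟨0, hβ.start⟩
  | succ n =>
    have h1 := vertex_mem_branch_or _ _ _ (notMem_wordBranch (g := g) hw n)
    have hgate := isGate_branch (wordVertex g w (n + 1)) 0 (!(w n).2)
    rw [ofLattice_zero, mul_one] at hgate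
    have h2 : ∀ᶠ t in atTop, β t ∉ branch (wordVertex g w (n + 1)) 0 (!(w n).2) := by
      filter_upwards [h (n + 2)] with t ht ht'
      exact hw n (branch_inj ht ht')
    obtain ⟨t, -, ht⟩ := hβ.exists_eq_of_eventually_mem hgate.compl h2 (s := 0)
      (by rw [hβ.start]; exact not_not.2 h1)
    exact ⟨t, ht⟩

theorem norm_wordVertex_le (w : ℕ → (ℤ × ℤ) × Bool) (n : ℕ) :
    dist (vertex g) (vertex (wordVertex g w n)) ≤ dist (vertex g) (wordGate g w n) + 1 := by
  cases n with
  | zero => simp [wordVertex, wordGate]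
  | succ n =>
    refine (dist_triangle _ (wordGate g w (n + 1)) _).trans ?_
    rw [wordVertex, wordGate, dist_vertex_letter]

/-- The gaps along the word followed by a contracting ray are sublinear. -/
theorem exists_gap_le {κ : ℝ → ℝ} (hκ : IsSublinearFunction κ) {q Q : ℝ} {β : ℝ≥0 → Space}
    (hβ : IsQuasiGeodesicRay (vertex g) q Q β) (hcon : IsKappaContracting κ (vertex g) (range β))
    {w : ℕ → (ℤ × ℤ) × Bool} (hw : IsReducedWord w) (h : ConvergesTo β (wordBranch g w)) :
    ∃ C, ∀ n, dist (wordGate g w n) (wordGate g w (n + 1)) ≤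
      C * κ (dist (vertex g) (wordGate g w n)) := by
  obtain ⟨c, hc⟩ := hcon
  -- It is applied to `Δ + 1`: the part of the gap in the flat plus the edge of length `1`, which `κ
  -- ≥ 1` absorbs.
  obtain ⟨C, -, hC⟩ := hκ.exists_le_of_le_mul (76 * |c| + 1)
  refine ⟨C, fun n => ?_⟩
  have hZ := flatPt_retract_mem_range hβ (v := wordVertex g w n) fun z ε => by
    refine or_iff_not_imp_right.2 fun h1 => ?_
    obtain ⟨t, h2, h3⟩ := ((not_not.1 h1).and (h (n + 1))).exists
    obtain ⟨h4, h5⟩ := Prod.mk.inj (branch_inj h2 h3)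
    rw [h4, h5]
    exact notMem_wordBranch hw n
  obtain ⟨Δ, hΔ, hΔ'⟩ := exists_norm_le hZ hκ hβ hc (vertex_wordVertex_mem_range hβ hw h n)
    (h (n + 1))
  have hΔ0 : 0 ≤ Δ := (norm_nonneg _).trans hΔ
  set a := dist (vertex g) (wordGate g w n) with ha
  have ha0 : 0 ≤ a := dist_nonneg
  have h1 := norm_wordVertex_le (g := g) w n
  have h2 : κ (dist (vertex g) (vertex (wordVertex g w n)) + 2 * Δ) ≤ κ (a + 2 * (Δ + 1)) :=
    hκ.mono (by simp; positivity) (by simp; positivity) (by linarith)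
  have h3 := hκ.one_le (a + 2 * (Δ + 1)) (by positivity)
  refine (dist_wordGate_le n).trans (le_trans (by linarith) (hC a (Δ + 1) ha0 (by linarith) ?_))
  have h4 : |c| * κ (dist (vertex g) (vertex (wordVertex g w n)) + 2 * Δ) ≤
      |c| * κ (a + 2 * (Δ + 1)) := mul_le_mul_of_nonneg_left h2 (abs_nonneg c)
  linarith

theorem hasGateSeqs {κ : ℝ → ℝ} (hκ : IsSublinearFunction κ) (g : A) :
    HasGateSeqs κ (vertex g) := by
  rintro β ⟨q, Q, hβ⟩ hcon
  obtain ⟨w, hw, hβw⟩ := exists_word hκ hβ hcon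
  obtain ⟨C, hC⟩ := exists_gap_le hκ hβ hcon hw hβw
  exact ⟨_, _, C, isGateSeq hw, hC, isJoined_wordGate, hβw⟩

theorem exists_word_of_boundary {κ : ℝ → ℝ} (hκ : IsSublinearFunction κ)
    (C : GaugeChoice κ (vertex g)) (c : kappaBoundary κ (vertex g)) :
    ∃ w, IsReducedWord w ∧ ∀ n, c ∈ C.cylinder (wordBranch g w n) := by
  obtain ⟨β, ⟨q, Q, hβ⟩, hcon, hcβ⟩ := c.2
  obtain ⟨w, hw, hβw⟩ := exists_word hκ hβ hcon
  obtain ⟨L, hL⟩ := exists_gap_le hκ hβ hcon hw hβw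
  have hmem := C.geod_mem c
  rw [hcβ] at hmem
  exact ⟨w, hw, (((isGateSeq hw).mem_fellowTravelClass_iff hκ hL ⟨q, Q, hβ⟩ hβw).1 hmem).2⟩

theorem eq_of_mem_cylinder {κ : ℝ → ℝ} (C : GaugeChoice κ (vertex g))
    {a : kappaBoundary κ (vertex g)} {v : A} {z z' : ℤ × ℤ} {ε ε' : Bool}
    (h : a ∈ C.cylinder (branch v z ε)) (h' : a ∈ C.cylinder (branch v z' ε')) :
    (z, ε) = (z', ε') := by
  obtain ⟨t, ht, ht'⟩ := (Eventually.and h h').exists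
  exact branch_inj ht ht'

/-- The cylinders of the exits from the first flat are a disjoint open cover. A finite subfamily
misses some lattice point `z`, but the word that exits at `z` and then goes straight on gives a
boundary point. -/
theorem not_compactSpace {κ : ℝ → ℝ} (hκ : IsSublinearFunction κ)
    (C : GaugeChoice κ (vertex g)) :
    ¬ @CompactSpace (kappaBoundary κ (vertex g)) (C.topology hκ) := by
  let _ := C.topology hκ
  intro hcomp
  obtain ⟨T, hT⟩ := (isCompact_univ (X := kappaBoundary κ (vertex g))).elim_finite_subcover
    (fun i : (ℤ × ℤ) × Bool => C.cylinder (branch g i.1 i.2))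
    (fun i => C.isOpen_cylinder hκ (isGate_branch g i.1 i.2))
    (fun c _ => by
      obtain ⟨w, -, hw⟩ := exists_word_of_boundary hκ C c
      exact mem_iUnion.2 ⟨w 0, hw 1⟩)
  obtain ⟨z, hz⟩ := Infinite.exists_notMem_finset (T.image Prod.fst)
  let w : ℕ → (ℤ × ℤ) × Bool := fun n => (if n = 0 then z else 0, true)
  have hw : IsReducedWord w := fun n => by simp [w]
  obtain ⟨a, ha⟩ := exists_mem_cylinder hκ hw (L := ‖latticePoint z‖) (fun n => by
    by_cases h : n = 0
    · simp [w, h]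
    · simp [w, h, latticePoint_zero]) C
  obtain ⟨i, hi, hai⟩ := mem_iUnion₂.1 (hT (mem_univ a))
  have h1 : (z, true) = (i.1, i.2) := eq_of_mem_cylinder C (ha 1) hai
  exact hz (Finset.mem_image.2 ⟨i, hi, (Prod.mk.inj h1).1.symm⟩)

/-- The detour shares with `c` a gate of norm at least `r`, so its end lies in the neighbourhood of
radius `r`; but it leaves the next flat at another vertex. -/
theorem not_isOpen_singleton {κ : ℝ → ℝ} (hκ : IsSublinearFunction κ)
    (C : GaugeChoice κ (vertex g)) (c : kappaBoundary κ (vertex g)) :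
    ¬ IsOpen[C.topology hκ] {c} := by
  intro hopen
  obtain ⟨r, hr, hsub⟩ := hopen c rfl
  obtain ⟨w, hw, hc⟩ := exists_word_of_boundary hκ C c
  obtain ⟨n, hn⟩ := (((tendsto_add_atTop_iff_nat 1).2 (isGateSeq (g := g) hw).tendsto).eventually
    (eventually_ge_atTop r)).exists
  obtain ⟨L, hL⟩ := exists_norm_detour_le w n
  obtain ⟨a, ha⟩ := exists_mem_cylinder hκ (isReducedWord_detour hw n) hL C
  have h1 := ha (n + 1)
  rw [wordBranch, wordVertex_detour n.le_succ, detour_of_le le_rfl] at h1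
  have h2 := hsub (C.mem_nbhd hκ (isGate_wordBranch (n + 1)) (notMem_wordBranch hw n) hr.le hn
    (hc (n + 1)) h1)
  obtain rfl : a = c := h2
  have h3 := ha (n + 2)
  rw [wordBranch, wordVertex_detour le_rfl] at h3
  have h4 := (Prod.mk.inj (eq_of_mem_cylinder C h3 (hc (n + 2)))).1
  simp [detour] at h4

end TreeOfFlats

/-- The `κ`-Morse boundary of the tree of flats, based at any vertex, is non-compact, totally
disconnected and has no isolated points. The first part says that its topology is defined:
every class contains a geodesic ray that has a strong Morse gauge. The rest holds for the
topology given by any choice of such gauges. -/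
theorem proposition6p5 (κ : ℝ → ℝ) (hκ : IsSublinearFunction κ) (g : TreeOfFlats.A) :
    Nonempty (GaugeChoice κ (TreeOfFlats.vertex g)) ∧
    ∀ C : GaugeChoice κ (TreeOfFlats.vertex g),
      ¬ @CompactSpace (kappaBoundary κ (TreeOfFlats.vertex g)) (C.topology hκ) ∧
      @TotallyDisconnectedSpace (kappaBoundary κ (TreeOfFlats.vertex g)) (C.topology hκ) ∧
      ∀ c : kappaBoundary κ (TreeOfFlats.vertex g), ¬ IsOpen[C.topology hκ] {c} := by
  have h := TreeOfFlats.hasGateSeqs hκ g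
  exact ⟨h.nonempty_gaugeChoice hκ, fun C => ⟨TreeOfFlats.not_compactSpace hκ C,
    h.totallyDisconnectedSpace hκ C, TreeOfFlats.not_isOpen_singleton hκ C⟩⟩
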